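/- **Theorem.** Let $\Omega\subset\mathbb R^2$ be a domain (nonempty, open, connected), let $I,J\subset\mathbb R$ be nonempty open intervals, and let $d_1:I\to(0,\infty)$, $d_2:J\to(0,\infty)$ be smooth. Consider the system $$u_t=(d_1(u)u_x)_x,\qquad v_t=(d_2(v)v_x)_x,\qquad (t,x)\in\Omega,\ u\in I,\ v\in J. \tag{S}$$ Its maximal algebra of invariance (MAI) is the Lie algebra of all smooth operators $X=\xi^0\partial_t+\xi^1\partial_x+\eta^1\partial_u+\eta^2\partial_v$, with coefficients depending on $(t,x,u,v)\in\Omega\times I\times J$, whose second prolongation annihilates the equations of (S) on the manifold that (S) determines in the space of second-order jets. Put $A=\langle\partial_t,\ \partial_x,\ 2t\partial_t+x\partial_x\rangle$. Below, $k_1,k_2,k$ are positive constants, $m,n$ are nonzero constants, a power of $u$ (of $v$) occurs only with $I\subset(0,\infty)$ (with $J\subset(0,\infty)$), and $\alpha(t,x)$, $\beta(t,x)$ are arbitrary smooth solutions on $\Omega$ of $\alpha_t=k_1\alpha_{xx}$, $\beta_t=k_2\beta_{xx}$ ($k_1=k_2=k$ in case 9$'$). (i) In each of the following cases the MAI of (S)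 has the basic operators listed; the individually listed operators are linearly independent, also modulo the operators $\alpha\partial_u$, $\beta\partial_v$ where these occur. * Case 2: $d_1=k_1$, $d_2$ not constant: $A,\ u\partial_u,\ \alpha\partial_u$. * Case 3: $d_1$ not constant, $d_2=k_2$: $A,\ v\partial_v,\ \beta\partial_v$. * Case 4: $d_1=e^u$, $d_2=e^v$: $A,\ x\partial_x+2\partial_u+2\partial_v$. * Case 5: $d_1=e^u$, $d_2=v^m$: $A,\ x\partial_x+2\partial_u+\frac2m v\partial_v$. * Case 6: $d_1=u^n$, $d_2=e^v$: $A,\ x\partial_x+\frac2n u\partial_u+2\partial_v$. * Case 7: $d_1=u^n$, $d_2=v^m$, $(n,m)\ne(-\frac43,-\frac43)$: $A,\ x\partial_x+\frac2n u\partial_u+\frac2m v\partial_v$. * Case 8: $d_1=u^{-4/3}$, $d_2=v^{-4/3}$: $A,\ x\partial_x-\frac32u\partial_u-\frac32v\partial_v,\ x^2\partial_x-3xu\partial_u-3xv\partial_v$. * Case 9: $d_1=k_1$, $d_2=k_2$, $k_1\neq k_2$: $A,\ u\partial_u,\ v\partial_v,\ \alpha\partial_u,\ \beta\partial_v,\ 2t\partial_x-x\left(\frac1{k_1}u\partial_u+\frac1{k_2}v\partial_v\right),\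 4tx\partial_x+4t^2\partial_t-\frac1{k_1}(x^2+2k_1t)u\partial_u-\frac1{k_2}(x^2+2k_2t)v\partial_v$. * Case 9$'$: $d_1=d_2=k$: the operators of case 9 with $k_1=k_2=k$, together with $v\partial_u$ and $u\partial_v$. (ii) If an equivalence transformation $$t\to e_0t+t_0,\quad x\to e_1x+x_0,\quad u\to e_2u+u_0,\quad v\to e_3v+v_0\qquad(e_0e_1e_2e_3\neq0)$$ carries (S) to a system of one of the cases 2–9$'$, then the MAI of (S) is the algebra that this transformation carries to the one listed for that case. (iii) Case 1: the MAI of (S) is the three-dimensional algebra $A$ if and only if no equivalence transformation carries (S) to a system of one of the cases 2–9$'$. So every system (S) whose MAI is not $A$ is reduced by an equivalence transformation to one of the cases 2–9$'$. -/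

import Mathlib

open Set
open scoped ContDiff

noncomputable section

namespace HeatSystem

/-! Jet spaces.  Independent variables: index `0` is `t`, index `1` is `x`.
Dependent variables: index `0` is `u`, index `1` is `v`. -/

/-- The space of the variables `(t, x, u, v)`, written as `((t, x), (u, v))`. -/
abbrev Base := (Fin 2 → ℝ) × (Fin 2 → ℝ)

/-- First-order jets: `j.2 k i` is the derivative of the `k`-th dependent variable with respect to
the `i`-th independent one. -/
abbrev Jet1 := Base × (Fin 2 → Fin 2 → ℝ)

/-- Second-order jets: `j.2 k i l` is the second derivative of the `k`-th dependent variable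
with respect to the `i`-th and the `l`-th independent ones (a jet has to be symmetric in
`i, l`; see `equationManifold`). -/
abbrev Jet2 := Jet1 × (Fin 2 → Fin 2 → Fin 2 → ℝ)

/-- Infinitesimal operators `ξ⁰ ∂_t + ξ¹ ∂_x + η¹ ∂_u + η² ∂_v`, given by their coefficients
`((ξ⁰, ξ¹), (η¹, η²))`, which are functions of `(t, x, u, v)`. -/
abbrev Operator := Base → Base

/-- Total derivative `D_i f` of a function of `(t, x, u, v)`. -/
def totalDeriv0 (i : Fin 2) (f : Base → ℝ) (j : Jet1) : ℝ :=
  fderiv ℝ f j.1 (Pi.single i 1, fun k => j.2 k i)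

/-- Total derivative `D_i f` of a function on the space of first-order jets. -/
def totalDeriv1 (i : Fin 2) (f : Jet1 → ℝ) (j : Jet2) : ℝ :=
  fderiv ℝ f j.1 ((Pi.single i 1, fun k => j.1.2 k i), fun k l => j.2 k l i)

/-- First prolongation of an operator:
the coefficient of `∂/∂u^k_i` is `D_i η^k - ∑ l, u^k_l D_i ξ^l`. -/
def prolong1 (X : Operator) (j : Jet1) : Jet1 :=
  (X j.1, fun k i =>
    totalDeriv0 i (fun p => (X p).2 k) j - ∑ l, j.2 k l * totalDeriv0 i (fun p => (X p).1 l) j)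

/-- Second prolongation of an operator:
the coefficient of `∂/∂u^k_{il}` is `D_l η^k_i - ∑ a, u^k_{ia} D_l ξ^a`. -/
def prolong2 (X : Operator) (j : Jet2) : Jet2 :=
  (prolong1 X j.1, fun k i l =>
    totalDeriv1 l (fun j₁ => (prolong1 X j₁).2 k i) j
      - ∑ a, j.2 k i a * totalDeriv0 l (fun p => (X p).1 a) j.1)

/-- For the `k`-th dependent variable `w`, the function
`w_t - (d(w) w_x)_x = w_t - (d(w) w_xx + d'(w) w_x ^ 2)` on the space of second-order jets. -/
def heatExpr (k : Fin 2) (d : ℝ → ℝ) (j : Jet2) : ℝ :=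
  j.1.2 k 0 - (d (j.1.1.2 k) * j.2 k 1 1 + deriv d (j.1.1.2 k) * j.1.2 k 1 ^ 2)

/-- The points `(t, x, u, v)` with `(t, x) ∈ Ω`, `u ∈ I`, `v ∈ J`. -/
def domain (Ω : Set (Fin 2 → ℝ)) (I J : Set ℝ) : Set Base :=
  {p | p.1 ∈ Ω ∧ p.2 0 ∈ I ∧ p.2 1 ∈ J}

/-- The manifold that the system `u_t = (d₁(u) u_x)_x`, `v_t = (d₂(v) v_x)_x` determines in the
space of second-order jets over the domain. -/
def equationManifold (Ω : Set (Fin 2 → ℝ)) (I J : Set ℝ) (d₁ d₂ : ℝ → ℝ) : Set Jet2 :=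
  {j | j.1.1 ∈ domain Ω I J ∧ (∀ k i l, j.2 k i l = j.2 k l i) ∧
    heatExpr 0 d₁ j = 0 ∧ heatExpr 1 d₂ j = 0}

/-- `X` is an infinitesimal (Lie point) symmetry of the system: it is smooth on the domain and its
second prolongation annihilates the equations on the manifold that they determine. -/
def IsSymmetry (Ω : Set (Fin 2 → ℝ)) (I J : Set ℝ) (d₁ d₂ : ℝ → ℝ) (X : Operator) : Prop :=
  ContDiffOn ℝ ∞ X (domain Ω I J) ∧
  ∀ j ∈ equationManifold Ω I J d₁ d₂,
    fderiv ℝ (heatExpr 0 d₁) j (prolong2 X j) = 0 ∧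
    fderiv ℝ (heatExpr 1 d₂) j (prolong2 X j) = 0

/-- A list of basic operators: finitely many individual ones and a set `inf` of further ones,
which serves to list those that contain arbitrary functions. -/
structure BasicOperators where
  fin : List Operator
  inf : Set Operator

/-- All linear combinations of the basic operators. -/
def BasicOperators.span (O : BasicOperators) : Submodule ℝ Operator :=
  Submodule.span ℝ ({X | X ∈ O.fin} ∪ O.inf)

/-- `O` is a list of basic operators of the maximal algebra of invariance of the system: the linear
combinations of `O` are symmetries, they form a Lie algebra under the commutator, and every symmetry
is one of them; moreover the individual operators are linearly independent
(also modulo the combinations of the further ones).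
Operators are identified when they agree on the domain. -/
structure IsMaximalInvarianceAlgebra (Ω : Set (Fin 2 → ℝ)) (I J : Set ℝ) (d₁ d₂ : ℝ → ℝ)
    (O : BasicOperators) : Prop where
  symmetry : ∀ X ∈ O.span, IsSymmetry Ω I J d₁ d₂ X
  lie : ∀ X ∈ O.span, ∀ Y ∈ O.span,
    ∃ Z ∈ O.span, EqOn (VectorField.lieBracket ℝ X Y) Z (domain Ω I J)
  maximal : ∀ X, IsSymmetry Ω I J d₁ d₂ X → ∃ Y ∈ O.span, EqOn X Y (domain Ω I J)
  independent : ∀ c : Fin O.fin.length → ℝ, ∀ Z ∈ Submodule.span ℝ O.inf,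
    EqOn (∑ i, c i • O.fin.get i + Z) 0 (domain Ω I J) → c = 0

/-! The operators of the table. -/

/-- The operator `τ ∂_t + ξ ∂_x + η ∂_u + ζ ∂_v`. -/
def op (τ ξ η ζ : ℝ → ℝ → ℝ → ℝ → ℝ) : Operator := fun p =>
  (![τ (p.1 0) (p.1 1) (p.2 0) (p.2 1), ξ (p.1 0) (p.1 1) (p.2 0) (p.2 1)],
   ![η (p.1 0) (p.1 1) (p.2 0) (p.2 1), ζ (p.1 0) (p.1 1) (p.2 0) (p.2 1)])

/-- The algebra `A = ⟨∂_t, ∂_x, 2t ∂_t + x ∂_x⟩`. -/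
def opsA : List Operator :=
  [op (fun _ _ _ _ => 1) (fun _ _ _ _ => 0) (fun _ _ _ _ => 0) (fun _ _ _ _ => 0),
   op (fun _ _ _ _ => 0) (fun _ _ _ _ => 1) (fun _ _ _ _ => 0) (fun _ _ _ _ => 0),
   op (fun t _ _ _ => 2 * t) (fun _ x _ _ => x) (fun _ _ _ _ => 0) (fun _ _ _ _ => 0)]

/-- `u ∂_u` -/
def opUU : Operator :=
  op (fun _ _ _ _ => 0) (fun _ _ _ _ => 0) (fun _ _ u _ => u) (fun _ _ _ _ => 0)

/-- `v ∂_v` -/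
def opVV : Operator :=
  op (fun _ _ _ _ => 0) (fun _ _ _ _ => 0) (fun _ _ _ _ => 0) (fun _ _ _ v => v)

/-- `v ∂_u` -/
def opVU : Operator :=
  op (fun _ _ _ _ => 0) (fun _ _ _ _ => 0) (fun _ _ _ v => v) (fun _ _ _ _ => 0)

/-- `u ∂_v` -/
def opUV : Operator :=
  op (fun _ _ _ _ => 0) (fun _ _ _ _ => 0) (fun _ _ _ _ => 0) (fun _ _ u _ => u)

/-- `x² ∂_x - 3xu ∂_u - 3xv ∂_v` -/
def opConformal : Operator :=
  op (fun _ _ _ _ => 0) (fun _ x _ _ => x ^ 2) (fun _ x u _ => -3 * x * u)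
    (fun _ x _ v => -3 * x * v)

/-- `2t ∂_x - x (u/k₁ ∂_u + v/k₂ ∂_v)` -/
def opGalilei (k₁ k₂ : ℝ) : Operator :=
  op (fun _ _ _ _ => 0) (fun t _ _ _ => 2 * t) (fun _ x u _ => -x * (1 / k₁ * u))
    (fun _ x _ v => -x * (1 / k₂ * v))

/-- `4tx ∂_x + 4t² ∂_t - (1/k₁)(x² + 2k₁t) u ∂_u - (1/k₂)(x² + 2k₂t) v ∂_v` -/
def opProjective (k₁ k₂ : ℝ) : Operator :=
  op (fun t _ _ _ => 4 * t ^ 2) (fun t x _ _ => 4 * t * x)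
    (fun t x u _ => -(1 / k₁) * (x ^ 2 + 2 * k₁ * t) * u)
    (fun t x _ v => -(1 / k₂) * (x ^ 2 + 2 * k₂ * t) * v)

/-- Partial derivative with respect to `t` (`i = 0`) or `x` (`i = 1`). -/
def pderiv (i : Fin 2) (α : (Fin 2 → ℝ) → ℝ) (z : Fin 2 → ℝ) : ℝ :=
  fderiv ℝ α z (Pi.single i 1)

/-- `α` is a (smooth) solution of the linear heat equation `α_t = k α_xx` on `Ω`. -/
def IsHeatSolution (Ω : Set (Fin 2 → ℝ)) (k : ℝ) (α : (Fin 2 → ℝ) → ℝ) : Prop :=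
  ContDiffOn ℝ ∞ α Ω ∧ ∀ z ∈ Ω, pderiv 0 α z = k * pderiv 1 (pderiv 1 α) z

/-- The operators `α(t, x) ∂_u` with `α_t = k α_xx`. -/
def heatOpsU (Ω : Set (Fin 2 → ℝ)) (k : ℝ) : Set Operator :=
  {X | ∃ α, IsHeatSolution Ω k α ∧
    X = op (fun _ _ _ _ => 0) (fun _ _ _ _ => 0) (fun t x _ _ => α ![t, x]) (fun _ _ _ _ => 0)}

/-- The operators `β(t, x) ∂_v` with `β_t = k β_xx`. -/
def heatOpsV (Ω : Set (Fin 2 → ℝ)) (k : ℝ) : Set Operator :=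
  {X | ∃ β, IsHeatSolution Ω k β ∧
    X = op (fun _ _ _ _ => 0) (fun _ _ _ _ => 0) (fun _ _ _ _ => 0) (fun t x _ _ => β ![t, x])}

/-- The basic operators of the generic case. -/
def genericOps : BasicOperators := ⟨opsA, ∅⟩

/-- `SpecialCase Ω I J d₁ d₂ O`: the diffusivities `d₁` on `I` and `d₂` on `J` belong to a
non-generic case of the table, and `O` lists the basic operators given there. -/
inductive SpecialCase (Ω : Set (Fin 2 → ℝ)) (I J : Set ℝ) (d₁ d₂ : ℝ → ℝ) :
    BasicOperators → Prop
  /-- `d₁ = k₁`, and `d₂` is not constant -/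
  | case2 (k₁ : ℝ) (hk₁ : 0 < k₁) (h₁ : ∀ u ∈ I, d₁ u = k₁) (h₂ : ¬ ∃ c, ∀ v ∈ J, d₂ v = c) :
      SpecialCase Ω I J d₁ d₂ ⟨opsA ++ [opUU], heatOpsU Ω k₁⟩
  /-- `d₁` is not constant, and `d₂ = k₂` -/
  | case3 (k₂ : ℝ) (hk₂ : 0 < k₂) (h₁ : ¬ ∃ c, ∀ u ∈ I, d₁ u = c) (h₂ : ∀ v ∈ J, d₂ v = k₂) :
      SpecialCase Ω I J d₁ d₂ ⟨opsA ++ [opVV], heatOpsV Ω k₂⟩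
  /-- `d₁ = e^u`, `d₂ = e^v` -/
  | case4 (h₁ : ∀ u ∈ I, d₁ u = Real.exp u) (h₂ : ∀ v ∈ J, d₂ v = Real.exp v) :
      SpecialCase Ω I J d₁ d₂
        ⟨opsA ++ [op (fun _ _ _ _ => 0) (fun _ x _ _ => x) (fun _ _ _ _ => 2)
          (fun _ _ _ _ => 2)], ∅⟩
  /-- `d₁ = e^u`, `d₂ = v^m` -/
  | case5 (m : ℝ) (hm : m ≠ 0) (hJ : J ⊆ Ioi 0)
      (h₁ : ∀ u ∈ I, d₁ u = Real.exp u) (h₂ : ∀ v ∈ J, d₂ v = v ^ m) :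
      SpecialCase Ω I J d₁ d₂
        ⟨opsA ++ [op (fun _ _ _ _ => 0) (fun _ x _ _ => x) (fun _ _ _ _ => 2)
          (fun _ _ _ v => 2 / m * v)], ∅⟩
  /-- `d₁ = u^n`, `d₂ = e^v` -/
  | case6 (n : ℝ) (hn : n ≠ 0) (hI : I ⊆ Ioi 0)
      (h₁ : ∀ u ∈ I, d₁ u = u ^ n) (h₂ : ∀ v ∈ J, d₂ v = Real.exp v) :
      SpecialCase Ω I J d₁ d₂
        ⟨opsA ++ [op (fun _ _ _ _ => 0) (fun _ x _ _ => x) (fun _ _ u _ => 2 / n * u)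
          (fun _ _ _ _ => 2)], ∅⟩
  /-- `d₁ = u^n`, `d₂ = v^m`, not both powers being `-4/3` -/
  | case7 (n m : ℝ) (hn : n ≠ 0) (hm : m ≠ 0) (hnm : ¬ (n = -4 / 3 ∧ m = -4 / 3))
      (hI : I ⊆ Ioi 0) (hJ : J ⊆ Ioi 0)
      (h₁ : ∀ u ∈ I, d₁ u = u ^ n) (h₂ : ∀ v ∈ J, d₂ v = v ^ m) :
      SpecialCase Ω I J d₁ d₂
        ⟨opsA ++ [op (fun _ _ _ _ => 0) (fun _ x _ _ => x) (fun _ _ u _ => 2 / n * u)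
          (fun _ _ _ v => 2 / m * v)], ∅⟩
  /-- `d₁ = u^(-4/3)`, `d₂ = v^(-4/3)` -/
  | case8 (hI : I ⊆ Ioi 0) (hJ : J ⊆ Ioi 0)
      (h₁ : ∀ u ∈ I, d₁ u = u ^ (-4 / 3 : ℝ)) (h₂ : ∀ v ∈ J, d₂ v = v ^ (-4 / 3 : ℝ)) :
      SpecialCase Ω I J d₁ d₂
        ⟨opsA ++ [op (fun _ _ _ _ => 0) (fun _ x _ _ => x) (fun _ _ u _ => -3 / 2 * u)
          (fun _ _ _ v => -3 / 2 * v), opConformal], ∅⟩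
  /-- `d₁ = k₁`, `d₂ = k₂`, `k₁ ≠ k₂` -/
  | case9 (k₁ k₂ : ℝ) (hk₁ : 0 < k₁) (hk₂ : 0 < k₂) (hne : k₁ ≠ k₂)
      (h₁ : ∀ u ∈ I, d₁ u = k₁) (h₂ : ∀ v ∈ J, d₂ v = k₂) :
      SpecialCase Ω I J d₁ d₂
        ⟨opsA ++ [opUU, opVV, opGalilei k₁ k₂, opProjective k₁ k₂],
          heatOpsU Ω k₁ ∪ heatOpsV Ω k₂⟩
  /-- `d₁ = d₂ = k`: here `v ∂_u` and `u ∂_v` occur in addition -/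
  | case9_eq (k : ℝ) (hk : 0 < k) (h₁ : ∀ u ∈ I, d₁ u = k) (h₂ : ∀ v ∈ J, d₂ v = k) :
      SpecialCase Ω I J d₁ d₂
        ⟨opsA ++ [opUU, opVV, opGalilei k k, opProjective k k, opVU, opUV],
          heatOpsU Ω k ∪ heatOpsV Ω k⟩

/-! Equivalence transformations. -/

/-- A transformation `t → e₀ t + t₀`, `x → e₁ x + x₀`, `u → e₂ u + u₀`, `v → e₃ v + v₀` with nonzero
`e₀, …, e₃`; here `a = (e₀, e₁)`, `a₀ = (t₀, x₀)`, `b = (e₂, e₃)`, `b₀ = (u₀, v₀)`. -/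
structure EquivTransf where
  a : Fin 2 → ℝ
  a₀ : Fin 2 → ℝ
  b : Fin 2 → ℝ
  b₀ : Fin 2 → ℝ
  ha : ∀ i, a i ≠ 0
  hb : ∀ k, b k ≠ 0

namespace EquivTransf

/-- Action on `(t, x)`. -/
def indep (g : EquivTransf) (z : Fin 2 → ℝ) : Fin 2 → ℝ := fun i => g.a i * z i + g.a₀ i

/-- Action on the `k`-th dependent variable. -/
def dep (g : EquivTransf) (k : Fin 2) (w : ℝ) : ℝ := g.b k * w + g.b₀ k

/-- Action on `(t, x, u, v)`. -/
def base (g : EquivTransf) (p : Base) : Base := (g.indep p.1, fun k => g.dep k (p.2 k))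

/-- Prolonged action on second-order jets. -/
def jet2 (g : EquivTransf) (j : Jet2) : Jet2 :=
  ((g.base j.1.1, fun k i => g.b k * j.1.2 k i / g.a i),
    fun k i l => g.b k * j.2 k i l / (g.a i * g.a l))

/-- The operator in the old variables that `g` transforms into the operator `X` in the new ones. -/
def pullback (g : EquivTransf) (X : Operator) : Operator := fun p =>
  (fun i => (X (g.base p)).1 i / g.a i, fun k => (X (g.base p)).2 k / g.b k)

/-- The basic operators in the old variables that `g` transforms into those of `O`. -/
def pullbackOps (g : EquivTransf) (O : BasicOperators) : BasicOperators :=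
  ⟨O.fin.map g.pullback, g.pullback '' O.inf⟩

/-- `g` transforms the system with diffusivities `d₁, d₂` into that with diffusivities
`d₁', d₂'`. -/
def Carries (g : EquivTransf) (Ω : Set (Fin 2 → ℝ)) (I J : Set ℝ)
    (d₁ d₂ d₁' d₂' : ℝ → ℝ) : Prop :=
  g.jet2 '' equationManifold Ω I J d₁ d₂ =
    equationManifold (g.indep '' Ω) (g.dep 0 '' I) (g.dep 1 '' J) d₁' d₂'

end EquivTransf

/-- `g` reduces the system with diffusivities `d₁, d₂` to one from a non-generic case of the table,
with the basic operators `O`. -/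
def ReducesTo (g : EquivTransf) (Ω : Set (Fin 2 → ℝ)) (I J : Set ℝ) (d₁ d₂ : ℝ → ℝ)
    (O : BasicOperators) : Prop :=
  ∃ d₁' d₂' : ℝ → ℝ, g.Carries Ω I J d₁ d₂ d₁' d₂' ∧
    SpecialCase (g.indep '' Ω) (g.dep 0 '' I) (g.dep 1 '' J) d₁' d₂' O

end HeatSystem

end

noncomputable section

namespace HeatSystem

/-! The argument is Lie's infinitesimal method. On the manifold of the system the derivatives u_x,
v_x, u_xx, v_xx, u_tx are free, and the invariance condition for the equation with diffusivity a =
d₁(u), in the presence of b = d₂(v), is polynomial in them (`heatPolynomial`). Setting its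
coefficients to zero gives linear equations for the components τ, ξ, η of the operator, collected in
`Determining`; `Components.isSymm_iff` shows that they characterise symmetries. They are equations
in the ring of smooth functions on the domain, where the partial derivatives are commuting
derivations, so their consequences are polynomial identities. Subscripts below denote partial
derivatives.

The central equation is a′η = a(2ξ_x − τ_t). If a is not constant, its derivatives and the other
equations give τ_tt = ξ_t = ξ_xxx = 0 and 3ξ_xx + 2η_xu = 0 (`Nonconstant.determining`), and η = 0
as soon as 2ξ_x = τ_t (`Nonconstant.eq_zero_of_determining`). Suppose that both diffusivities are
nonconstant. If 2ξ_x = τ_t for every symmetry, only A is left. Otherwise, η being affine in u, both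
diffusivities satisfy d′(w)(pw + q) = 2d(w) for some p, q (`exists_affine`), so that affine
substitutions turn them into exponentials or powers (`exists_isExpOrPower`). For such diffusivities
η = (c₃ + 2c₄x)(pw + q), and the last relation becomes (3 + 2p)c₄ = 0: a second extra operator needs
p = −3/2, that is the exponent −4/3, in both equations (`IsScaling.exists_form`).

If a is a constant κ, then 2ξ_x = τ_t is forced, ξ is affine in t, and η is linear in u and v up to
a solution of the heat equation (`exists_form_of_const`, `exists_dep_form_of_const`). A nonconstant
b imposes ξ_t = 0, which removes the Galilei and projective operators. The equation η_v(b − a) = 0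
admits v∂_u and u∂_v only for equal constants.

No commutator table is computed: the determining equations are stable under brackets
(`Determining.bracket`), so closure follows from maximality. Equivalence transformations rescale the
determining equations (`Relates.determining`) and so transport the maximal algebras
(`Relates.isMaximal`). Since A does not act on u, v, while each tabulated algebra contains an
operator that does, the generic case is exactly the complement of the others. -/

open TopologicalSpace

/-! ### The ring of smooth functions on an open set and its derivations. -/

section SmoothFunctions

variable {E : Type*} [NormedAddCommGroup E] [NormedSpace ℝ E]

/-- The algebra of smooth functions on an open set. -/
def smoothFunctions (U : Opens E) : Subalgebra ℝ (U → ℝ) where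
  -- Elements are functions on U itself; F is any extension that is smooth on U. Values outside U
  -- thus play no role, and equality in the ring is agreement on the domain.
  carrier := {f | ∃ F : E → ℝ, ContDiffOn ℝ ∞ F U ∧ ∀ p : U, F p = f p}
  mul_mem' := by
    rintro f g ⟨F, hF, hFf⟩ ⟨G, hG, hGg⟩
    exact ⟨F * G, hF.mul hG, fun p => by simp [hFf, hGg]⟩
  add_mem' := by
    rintro f g ⟨F, hF, hFf⟩ ⟨G, hG, hGg⟩
    exact ⟨F + G, hF.add hG, fun p => by simp [hFf, hGg]⟩
  algebraMap_mem' c := ⟨fun _ => c, contDiffOn_const, fun p => rfl⟩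

variable {U : Opens E}

/-- The restriction of a function that is smooth on `U`. -/
def res (F : E → ℝ) (hF : ContDiffOn ℝ ∞ F U) : smoothFunctions U :=
  ⟨fun p => F p, F, hF, fun _ => rfl⟩

@[simp] lemma res_apply (F : E → ℝ) (hF : ContDiffOn ℝ ∞ F U) (p : U) :
    (res F hF).1 p = F p := rfl

lemma exists_res (f : smoothFunctions U) : ∃ F, ∃ hF : ContDiffOn ℝ ∞ F U, f = res F hF := by
  obtain ⟨F, hF, h⟩ := f.2
  exact ⟨F, hF, Subtype.ext (funext fun p => (h p).symm)⟩

lemma contDiffOn_fderiv_apply {F : E → ℝ} (hF : ContDiffOn ℝ ∞ F U) (e : E) :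
    ContDiffOn ℝ ∞ (fun p => fderiv ℝ F p e) U :=
  (hF.fderiv_of_isOpen U.2 (m := ∞) (by simp)).clm_apply contDiffOn_const

/-- An extension of a smooth function on `U` to the whole space. -/
def extension (f : smoothFunctions U) : E → ℝ := (exists_res f).choose

lemma contDiffOn_extension (f : smoothFunctions U) : ContDiffOn ℝ ∞ (extension f) U :=
  (exists_res f).choose_spec.choose

lemma res_extension (f : smoothFunctions U) : res (extension f) (contDiffOn_extension f) = f :=
  (exists_res f).choose_spec.choose_spec.symm

lemma res_eq_iff {F G : E → ℝ} {hF : ContDiffOn ℝ ∞ F U} {hG : ContDiffOn ℝ ∞ G U} :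
    res F hF = res G hG ↔ EqOn F G U := by
  refine ⟨fun h p hp => congrFun (congrArg Subtype.val h) ⟨p, hp⟩, fun h => ?_⟩
  exact Subtype.ext (funext fun p => h p.2)

lemma fderiv_eq_of_eqOn {F G : E → ℝ} (h : EqOn F G U) {p : E} (hp : p ∈ U) :
    fderiv ℝ F p = fderiv ℝ G p :=
  Filter.EventuallyEq.fderiv_eq (h.eventuallyEq_of_mem (U.2.mem_nhds hp))

/-- The derivative of a smooth function in the direction `e`, as a smooth function. -/
def dirDeriv (e : E) (f : smoothFunctions U) : smoothFunctions U :=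
  res _ (contDiffOn_fderiv_apply (contDiffOn_extension f) e)

/-- Independence of the chosen extension: U is open, so two functions that agree on U have the same
derivative at its points. -/
lemma dirDeriv_res (e : E) (F : E → ℝ) (hF : ContDiffOn ℝ ∞ F U) :
    dirDeriv e (res F hF) = res _ (contDiffOn_fderiv_apply hF e) := by
  have h := res_eq_iff.1 (res_extension (res F hF))
  exact res_eq_iff.2 fun p hp => by simp only [fderiv_eq_of_eqOn h hp]

lemma differentiableAt_of_contDiffOn {F : E → ℝ} (hF : ContDiffOn ℝ ∞ F U) {p : E} (hp : p ∈ U) :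
    DifferentiableAt ℝ F p :=
  (hF.contDiffAt (U.2.mem_nhds hp)).differentiableAt (by simp)

/-- The derivation of the algebra of smooth functions given by a direction. -/
def D (e : E) : Derivation ℝ (smoothFunctions U) (smoothFunctions U) :=
  Derivation.mk'
    { toFun := dirDeriv e
      map_add' := fun f g => by
        obtain ⟨F, hF, rfl⟩ := exists_res f
        obtain ⟨G, hG, rfl⟩ := exists_res g
        have h : res F hF + res G hG = res (F + G) (hF.add hG) := rfl
        rw [h, dirDeriv_res, dirDeriv_res, dirDeriv_res]
        refine Subtype.ext (funext fun p => ?_)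
        change fderiv ℝ (F + G) p e = fderiv ℝ F p e + fderiv ℝ G p e
        rw [fderiv_add (differentiableAt_of_contDiffOn hF p.2)
          (differentiableAt_of_contDiffOn hG p.2)]
        rfl
      map_smul' := fun c f => by
        obtain ⟨F, hF, rfl⟩ := exists_res f
        have h : c • res F hF = res (c • F) (contDiffOn_const.smul hF) := rfl
        rw [h, dirDeriv_res, dirDeriv_res]
        refine Subtype.ext (funext fun p => ?_)
        change fderiv ℝ (c • F) p e = c • fderiv ℝ F p e
        rw [fderiv_const_smul (differentiableAt_of_contDiffOn hF p.2)]
        rfl }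
    fun f g => by
        obtain ⟨F, hF, rfl⟩ := exists_res f
        obtain ⟨G, hG, rfl⟩ := exists_res g
        have h : res F hF * res G hG = res (F * G) (hF.mul hG) := rfl
        change dirDeriv e _ = res F hF * dirDeriv e _ + res G hG * dirDeriv e _
        rw [h, dirDeriv_res, dirDeriv_res, dirDeriv_res]
        refine Subtype.ext (funext fun p => ?_)
        change fderiv ℝ (F * G) p e = F p * fderiv ℝ G p e + G p * fderiv ℝ F p e
        rw [fderiv_mul (differentiableAt_of_contDiffOn hF p.2)
          (differentiableAt_of_contDiffOn hG p.2)]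
        rfl

lemma D_res (e : E) (F : E → ℝ) (hF : ContDiffOn ℝ ∞ F U) :
    D e (res F hF) = res _ (contDiffOn_fderiv_apply hF e) := dirDeriv_res e F hF

lemma D_res_apply (e : E) (F : E → ℝ) (hF : ContDiffOn ℝ ∞ F U) (p : U) :
    (D e (res F hF)).1 p = fderiv ℝ F p e := by rw [D_res]; rfl

lemma D_res_of_hasFDerivAt (e : E) (F G : E → ℝ) (hF : ContDiffOn ℝ ∞ F U)
    (hG : ContDiffOn ℝ ∞ G U) (F' : E → E →L[ℝ] ℝ) (h : ∀ p ∈ U, HasFDerivAt F (F' p) p)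
    (h' : ∀ p ∈ U, F' p e = G p) : D e (res F hF) = res G hG := by
  rw [D_res, res_eq_iff]
  intro p hp
  simp only [(h p hp).fderiv, h' p hp]

lemma D_add (e e' : E) (f : smoothFunctions U) : D (e + e') f = D e f + D e' f := by
  obtain ⟨F, hF, rfl⟩ := exists_res f
  refine Subtype.ext (funext fun p => ?_)
  change (D _ _).1 p = (D _ _).1 p + (D _ _).1 p
  simp only [D_res_apply, map_add]

lemma D_smul (c : ℝ) (e : E) (f : smoothFunctions U) : D (c • e) f = c • D e f := by
  obtain ⟨F, hF, rfl⟩ := exists_res f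
  refine Subtype.ext (funext fun p => ?_)
  change (D _ _).1 p = c * (D _ _).1 p
  simp only [D_res_apply, map_smul, smul_eq_mul]

lemma fderiv_fderiv_apply {F : E → ℝ} (hF : ContDiffOn ℝ ∞ F U) (e e' : E) {p : E} (hp : p ∈ U) :
    fderiv ℝ (fun q => fderiv ℝ F q e') p e = fderiv ℝ (fderiv ℝ F) p e e' := by
  have h : DifferentiableAt ℝ (fderiv ℝ F) p :=
    ((hF.contDiffAt (U.2.mem_nhds hp)).fderiv_right (m := ∞) (by simp)).differentiableAt (by simp)
  have h2 := (h.hasFDerivAt.clm_apply (hasFDerivAt_const e' p)).fderiv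
  rw [h2]
  simp

lemma D_comm (e e' : E) (f : smoothFunctions U) : D e (D e' f) = D e' (D e f) := by
  obtain ⟨F, hF, rfl⟩ := exists_res f
  rw [D_res e', D_res e, D_res, D_res, res_eq_iff]
  intro p hp
  simp only [fderiv_fderiv_apply hF _ _ hp]
  exact ((hF.contDiffAt (U.2.mem_nhds hp)).isSymmSndFDerivAt
    (by simpa using WithTop.coe_le_coe.2 (le_top (a := (2 : ℕ∞))))) e e'

lemma isUnit_res {F : E → ℝ} (hF : ContDiffOn ℝ ∞ F U) (h : ∀ p ∈ U, F p ≠ 0) :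
    IsUnit (res F hF) :=
  IsUnit.of_mul_eq_one (res (fun p => (F p)⁻¹) (hF.inv h))
    (Subtype.ext (funext fun p => mul_inv_cancel₀ (h p p.2)))

end SmoothFunctions

/-! ### Commuting derivations and the determining equations. -/

/-- Four commuting derivations, which play the role of the partial derivatives with respect to
`t, x, u, v`. -/
structure Frame (R : Type*) [CommRing R] [Algebra ℝ R] where
  t : Derivation ℝ R R
  x : Derivation ℝ R R
  u : Derivation ℝ R R
  v : Derivation ℝ R R
  x_t : ∀ f, x (t f) = t (x f)
  u_t : ∀ f, u (t f) = t (u f)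
  v_t : ∀ f, v (t f) = t (v f)
  u_x : ∀ f, u (x f) = x (u f)
  v_x : ∀ f, v (x f) = x (v f)
  v_u : ∀ f, v (u f) = u (v f)

section Algebra

variable {R : Type*} [CommRing R] [Algebra ℝ R]

/-- Exchange of the roles of `u` and `v`. -/
def Frame.swap (F : Frame R) : Frame R where
  t := F.t
  x := F.x
  u := F.v
  v := F.u
  x_t := F.x_t
  u_t := F.v_t
  v_t := F.u_t
  u_x := F.v_x
  v_x := F.u_x
  v_u f := (F.v_u f).symm

/-- The derivation `τ ∂_t + ξ ∂_x + η ∂_u + ζ ∂_v`. -/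
def Frame.along (F : Frame R) (τ ξ η ζ f : R) : R :=
  τ * F.t f + ξ * F.x f + η * F.u f + ζ * F.v f

lemma Frame.along_swap (F : Frame R) (τ ξ η ζ f : R) :
    F.swap.along τ ξ ζ η f = F.along τ ξ η ζ f := by
  simp only [Frame.along, Frame.swap]; ring

/-- `a` is an invertible function of `u`, and `b` is an invertible function of `v`. -/
structure Frame.Coefficients (F : Frame R) (a b : R) : Prop where
  ta : F.t a = 0
  xa : F.x a = 0
  va : F.v a = 0
  tb : F.t b = 0
  xb : F.x b = 0
  ub : F.u b = 0
  unit_a : IsUnit a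
  unit_b : IsUnit b

/-- The determining equations for the infinitesimal symmetries `τ ∂_t + ξ ∂_x + η ∂_u + ζ ∂_v`
that come from the equation `u_t = (a(u) u_x)_x`, in the presence of `v_t = (b(v) v_x)_x`. -/
structure Determining (F : Frame R) (a b τ ξ η : R) : Prop where
  τx : F.x τ = 0
  τu : F.u τ = 0
  τv : F.v τ = 0
  ξu : F.u ξ = 0
  ξv : F.v ξ = 0
  diffusion : F.u a * η = a * (2 * F.x ξ - F.t τ)
  heat : F.t η = a * F.x (F.x η)
  drift : -F.t ξ = 2 * F.u a * F.x η + 2 * a * F.x (F.u η) - a * F.x (F.x ξ)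
  ηxv : F.x (F.v η) = 0
  ηuu : F.u (F.u η) = 0
  ηuv : F.u (F.v η) = 0
  ηvv : F.v (F.v η) = 0
  coupling : F.v η * (b - a) = 0

lemma derivation_two (D : Derivation ℝ R R) : D 2 = 0 := by
  exact_mod_cast D.map_natCast 2

lemma isUnit_two : IsUnit (2 : R) := by
  have h := (IsUnit.mk0 (2 : ℝ) two_ne_zero).map (algebraMap ℝ R)
  rwa [map_ofNat (algebraMap ℝ R) 2] at h

lemma eq_zero_of_isUnit_mul {R : Type*} [CommRing R] {a f : R} (ha : IsUnit a)
    (h : a * f = 0) : f = 0 :=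
  (IsUnit.mul_right_eq_zero ha).1 h

namespace Determining

variable {F : Frame R} {a b τ ξ η ζ τ' ξ' η' ζ' : R}

/-- The determining equations in the form in which they arise as coefficients of the monomials in
the jet variables. -/
lemma of_coefficients (hab : F.Coefficients a b)
    (τx : F.x τ = 0) (τu : F.u τ = 0) (τv : F.v τ = 0) (ξu : F.u ξ = 0) (ξv : F.v ξ = 0)
    (h₁ : F.u a * η = a * (2 * F.x ξ - F.t τ)) (h₂ : F.v η * b = a * F.v η)
    (h₃ : F.t η = a * F.x (F.x η))
    (h₄ : -F.t ξ = 2 * F.u a * F.x η + 2 * a * F.x (F.u η) - a * F.x (F.x ξ))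
    (h₅ : a * F.x (F.v η) = 0)
    (h₆ : (F.u η - F.t τ) * F.u a = F.u (F.u a) * η + 2 * F.u a * F.u η - 2 * F.u a * F.x ξ
      + a * F.u (F.u η))
    (h₇ : F.u a * F.v η + a * F.u (F.v η) = 0) (h₈ : F.v η * F.v b = a * F.v (F.v η)) :
    Determining F a b τ ξ η := by
  have ha := hab.unit_a
  have e₁ := congrArg F.u h₁
  have e₂ := congrArg F.v h₁
  have e₃ := congrArg F.v h₂
  simp only [Derivation.leibniz, map_sub, smul_eq_mul, F.u_x, F.v_x, F.u_t, F.v_t, F.v_u,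
    ξu, ξv, τu, τv, hab.va, map_zero, derivation_two] at e₁ e₂ e₃
  -- In the `diffusion` equation only η can depend on v, so its v-derivative reduces to a′η_v = 0.
  have va : F.u a * F.v η = 0 := by linear_combination e₂
  have vb : a * (F.v b * F.v η) = 0 := by
    linear_combination a * e₃ + (b - a) * h₈ - F.v b * h₂
  refine ⟨τx, τu, τv, ξu, ξv, h₁, h₃, h₄, eq_zero_of_isUnit_mul ha h₅, eq_zero_of_isUnit_mul ha ?_,
    eq_zero_of_isUnit_mul ha ?_, eq_zero_of_isUnit_mul ha ?_, ?_⟩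
  -- The coefficient of u_x² and the u-derivative of the coefficient of u_xx differ by a η_uu, so
  -- this forces η to be affine in u.
  · linear_combination -h₆ - e₁
  · linear_combination h₇ - va
  · linear_combination -h₈ + eq_zero_of_isUnit_mul ha vb
  · linear_combination h₂

/-- Where η_v does not vanish, `coupling` makes a and b agree, although one depends on u and the
other on v; hence both have zero derivative there. This lemma and the next are the forms of that
remark which avoid division: they differentiate `coupling` in v and in u. -/
lemma vb (h : Determining F a b τ ξ η) (hab : F.Coefficients a b) : F.v η * F.v b = 0 := by
  have e := congrArg F.v h.coupling
  simp only [Derivation.leibniz, smul_eq_mul, map_sub, hab.va, map_zero, h.ηvv] at e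
  linear_combination e

lemma ua (h : Determining F a b τ ξ η) (hab : F.Coefficients a b) : F.v η * F.u a = 0 := by
  have e := congrArg F.u h.coupling
  simp only [Derivation.leibniz, smul_eq_mul, map_sub, hab.ub, map_zero, h.ηuv] at e
  linear_combination -e

lemma ηtv (h : Determining F a b τ ξ η) (hab : F.Coefficients a b) : F.t (F.v η) = 0 := by
  have e := congrArg F.v h.heat
  simp only [Derivation.leibniz, smul_eq_mul, F.v_t, F.v_x, h.ηxv, hab.va, map_zero] at e
  linear_combination e

/-- The coefficient of `u_x ^ 2` in the condition of invariance. -/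
lemma coefficient_uu (h : Determining F a b τ ξ η) :
    (F.u η - F.t τ) * F.u a = F.u (F.u a) * η + 2 * F.u a * F.u η - 2 * F.u a * F.x ξ
      + a * F.u (F.u η) := by
  have e₁ := congrArg F.u h.diffusion
  simp only [Derivation.leibniz, map_sub, smul_eq_mul, F.u_x, F.u_t,
    h.ξu, h.τu, map_zero, derivation_two] at e₁
  linear_combination -e₁ - a * h.ηuu

lemma zero (F : Frame R) (a b : R) : Determining F a b 0 0 0 := by
  constructor <;> simp

lemma add (h : Determining F a b τ ξ η) (h' : Determining F a b τ' ξ' η') :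
    Determining F a b (τ + τ') (ξ + ξ') (η + η') := by
  constructor <;> simp only [map_add]
  · linear_combination h.τx + h'.τx
  · linear_combination h.τu + h'.τu
  · linear_combination h.τv + h'.τv
  · linear_combination h.ξu + h'.ξu
  · linear_combination h.ξv + h'.ξv
  · linear_combination h.diffusion + h'.diffusion
  · linear_combination h.heat + h'.heat
  · linear_combination h.drift + h'.drift
  · linear_combination h.ηxv + h'.ηxv
  · linear_combination h.ηuu + h'.ηuu
  · linear_combination h.ηuv + h'.ηuv
  · linear_combination h.ηvv + h'.ηvv
  · linear_combination h.coupling + h'.coupling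

lemma smul (c : ℝ) (h : Determining F a b τ ξ η) :
    Determining F a b (c • τ) (c • ξ) (c • η) := by
  constructor <;> simp only [Derivation.map_smul] <;>
    simp only [Algebra.smul_def]
  · linear_combination algebraMap ℝ R c * h.τx
  · linear_combination algebraMap ℝ R c * h.τu
  · linear_combination algebraMap ℝ R c * h.τv
  · linear_combination algebraMap ℝ R c * h.ξu
  · linear_combination algebraMap ℝ R c * h.ξv
  · linear_combination algebraMap ℝ R c * h.diffusion
  · linear_combination algebraMap ℝ R c * h.heat
  · linear_combination algebraMap ℝ R c * h.drift
  · linear_combination algebraMap ℝ R c * h.ηxv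
  · linear_combination algebraMap ℝ R c * h.ηuu
  · linear_combination algebraMap ℝ R c * h.ηuv
  · linear_combination algebraMap ℝ R c * h.ηvv
  · linear_combination algebraMap ℝ R c * h.coupling

/-- The determining equations are preserved by the commutator. -/
lemma bracket (hab : F.Coefficients a b)
    (h : Determining F a b τ ξ η) (k : Determining F.swap b a τ ξ ζ)
    (h' : Determining F a b τ' ξ' η') (k' : Determining F.swap b a τ' ξ' ζ') :
    Determining F a b (F.along τ ξ η ζ τ' - F.along τ' ξ' η' ζ' τ)
      (F.along τ ξ η ζ ξ' - F.along τ' ξ' η' ζ' ξ)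
      (F.along τ ξ η ζ η' - F.along τ' ξ' η' ζ' η) := by
  obtain ⟨τx, τu, τv, ξu, ξv, e₁, e₂, e₃, ηxv, ηuu, ηuv, ηvv, e₄⟩ := id h
  obtain ⟨τx', τu', τv', ξu', ξv', e₁', e₂', e₃', ηxv', ηuu', ηuv', ηvv', e₄'⟩ := id h'
  have ζxu : F.x (F.u ζ) = 0 := k.ηxv
  have ζvv : F.v (F.v ζ) = 0 := k.ηuu
  have ζuv : F.u (F.v ζ) = 0 := by rw [← F.v_u]; exact k.ηuv
  have ζuu : F.u (F.u ζ) = 0 := k.ηvv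
  have f₂ : F.t ζ = b * F.x (F.x ζ) := k.heat
  have ζxu' : F.x (F.u ζ') = 0 := k'.ηxv
  have ζvv' : F.v (F.v ζ') = 0 := k'.ηuu
  have ζuv' : F.u (F.v ζ') = 0 := by rw [← F.v_u]; exact k'.ηuv
  have ζuu' : F.u (F.u ζ') = 0 := k'.ηvv
  have f₂' : F.t ζ' = b * F.x (F.x ζ') := k'.heat
  have ηtv := h.ηtv hab
  have ηtv' := h'.ηtv hab
  have ua := h.ua hab
  have ua' := h'.ua hab
  have vb := h.vb hab
  have vb' := h'.vb hab
  have uat : F.t (F.u a) = 0 := by rw [← F.u_t, hab.ta, map_zero]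
  have uax : F.x (F.u a) = 0 := by rw [← F.u_x, hab.xa, map_zero]
  -- The bracket differentiates the components once, so the verification needs the first derivatives
  -- of the determining equations of both operators. The combinations below are antisymmetric under
  -- exchanging the primed and unprimed data.
  have d₁ := congrArg F.t e₁
  have d₁' := congrArg F.t e₁'
  have d₂ := congrArg F.x e₁
  have d₂' := congrArg F.x e₁'
  have d₃ := h.coefficient_uu
  have d₃' := h'.coefficient_uu
  have d₄ := congrArg F.t e₂
  have d₄' := congrArg F.t e₂'
  have d₅ := congrArg F.x e₂
  have d₅' := congrArg F.x e₂'
  have d₆ := congrArg F.u e₂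
  have d₆' := congrArg F.u e₂'
  have d₇ := congrArg F.t e₃
  have d₇' := congrArg F.t e₃'
  have d₈ := congrArg F.x e₃
  have d₈' := congrArg F.x e₃'
  have d₉ := congrArg F.u e₃
  have d₉' := congrArg F.u e₃'
  simp only [Derivation.leibniz, map_sub, map_neg, smul_eq_mul, F.x_t, F.u_x, F.u_t,
    τx, ξu, ηuu, τx', ξu', ηuu',
    hab.xa, hab.ta, uat, uax, map_zero, map_add, derivation_two, mul_zero,
    add_zero, zero_add, sub_zero] at d₁ d₁' d₂ d₂' d₃ d₃' d₄ d₄' d₅ d₅' d₆ d₆' d₇ d₇' d₈ d₈' d₉ d₉'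
  constructor <;> simp only [Frame.along, Derivation.leibniz, map_sub, smul_eq_mul, F.x_t,
    F.u_x, F.v_x, F.u_t, F.v_t, F.v_u, τx, τu, τv, ξu, ξv, ηxv, ηuu, ηuv, ηvv, ηtv, τx', τu', τv',
    ξu', ξv', ηxv', ηuu', ηuv', ηvv', ηtv', map_zero, map_add,
    mul_zero, add_zero, zero_add,
    ζxu, ζvv, ζuv, ζuu, ζxu', ζvv', ζuv', ζuu', sub_self]
  · linear_combination τ * d₁' + ξ * d₂' - η * d₃' + (2 * F.x ξ' - F.t τ') * e₁ + ζ * ua' - (τ' *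
      d₁ + ξ' * d₂ - η' * d₃ + (2 * F.x ξ - F.t τ) * e₁' + ζ' * ua)
  · linear_combination τ * d₄' + F.t τ * e₂' + ξ * d₅' - F.x η' * e₃ + η * d₆' + F.x (F.x η') * e₁
      + F.u η' * e₂ + F.v η' * f₂ + F.x (F.x ζ) * e₄' - (τ' * d₄ + F.t τ' * e₂ + ξ' * d₅ - F.x η *
      e₃' + η' * d₆ + F.x (F.x η) * e₁' + F.u η * e₂' + F.v η * f₂' + F.x (F.x ζ') * e₄)
  · linear_combination τ * d₇' + ξ * d₈' + F.x ξ' * e₃ + 2 * F.x (F.u η') * e₁ - 2 * F.u η' * d₂ -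
      4 * F.x ξ * d₂' + F.t τ * e₃' + 2 * F.t τ * d₂' + η * d₉' - F.x (F.x ξ') * e₁ - 2 * F.x η' *
      d₃ + 2 * (2 * F.x ξ - F.t τ - F.u η) * d₂' - 2 * F.x ζ * ua' - (τ' * d₇ + ξ' * d₈ + F.x ξ *
      e₃' + 2 * F.x (F.u η) * e₁' - 2 * F.u η * d₂' - 4 * F.x ξ' * d₂ + F.t τ' * e₃ + 2 * F.t τ' *
      d₂ + η' * d₉ - F.x (F.x ξ) * e₁' - 2 * F.x η * d₃' + 2 * (2 * F.x ξ' - F.t τ' - F.u η') * d₂ -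
      2 * F.x ζ' * ua)
  -- The expression is η_v(η′_xu − ζ′_xv) − η′_v(η_xu − ζ_xv). The two drift equations of one
  -- operator have the same left side; multiplied by η_v or η′_v, which can be nonzero only where a
  -- = b and a′ = b′ = 0, they cancel these differences up to the unit 2a.
  · have g : -F.t ξ = 2 * F.v b * F.x ζ + 2 * b * F.x (F.v ζ) - b * F.x (F.x ξ) := k.drift
    have g' : -F.t ξ' = 2 * F.v b * F.x ζ' + 2 * b * F.x (F.v ζ') - b * F.x (F.x ξ') := k'.drift
    refine eq_zero_of_isUnit_mul (isUnit_two.mul hab.unit_a) ?_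
    linear_combination F.v η * (g' - e₃') - F.v η' * (g - e₃)
      + 2 * F.x ζ' * vb - 2 * F.x ζ * vb' - 2 * F.x η' * ua + 2 * F.x η * ua'
      + (2 * F.x (F.v ζ') - F.x (F.x ξ')) * e₄ - (2 * F.x (F.v ζ) - F.x (F.x ξ)) * e₄'
  · linear_combination (F.u η' - F.v ζ') * e₄ + (F.v ζ - F.u η) * e₄'

end Determining

end Algebra

/-! ### The system and the ring of functions on its domain. -/

/-- The data of a system `u_t = (d₁(u) u_x)_x`, `v_t = (d₂(v) v_x)_x`: its domain, the intervals of
the dependent variables and the diffusivities. -/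
structure HeatData where
  Ω : Set (Fin 2 → ℝ)
  K : Fin 2 → Set ℝ
  d : Fin 2 → ℝ → ℝ
  isOpen_Ω : IsOpen Ω
  isConnected_Ω : IsConnected Ω
  isOpen_K : ∀ k, IsOpen (K k)
  isConnected_K : ∀ k, IsConnected (K k)
  smooth_d : ∀ k, ContDiffOn ℝ ∞ (d k) (K k)
  pos_d : ∀ k, ∀ w ∈ K k, 0 < d k w

/-- Both equations are treated at once by letting k be the index of the equation considered and k′
the other one. For distinct indices the four vectors are a basis, which this expansion records. -/
lemma base_eq_sum {k k' : Fin 2} (hk : k ≠ k') (w : Base) :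
    w = w.1 0 • ((Pi.single 0 1, 0) : Base) + w.1 1 • ((Pi.single 1 1, 0) : Base) +
      w.2 k • ((0, Pi.single k 1) : Base) + w.2 k' • ((0, Pi.single k' 1) : Base) := by
  ext i
  · fin_cases i <;> simp
  · fin_cases i <;> fin_cases k <;> fin_cases k' <;> simp at hk ⊢

namespace HeatData

variable (S : HeatData)

lemma mem_domain {p : Base} :
    p ∈ domain S.Ω (S.K 0) (S.K 1) ↔ p.1 ∈ S.Ω ∧ ∀ k, p.2 k ∈ S.K k := by
  simp [domain, Fin.forall_fin_two]

lemma domain_eq :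
    domain S.Ω (S.K 0) (S.K 1) = S.Ω ×ˢ Set.pi Set.univ S.K := by
  ext p; simp [mem_domain]

/-- The domain of the system in the space of the variables `(t, x, u, v)`. -/
def U : Opens Base :=
  ⟨domain S.Ω (S.K 0) (S.K 1), by
    rw [domain_eq]
    exact S.isOpen_Ω.prod (isOpen_set_pi Set.finite_univ fun k _ => S.isOpen_K k)⟩

lemma mem_U {p : Base} : p ∈ S.U ↔ p.1 ∈ S.Ω ∧ ∀ k, p.2 k ∈ S.K k := S.mem_domain

lemma isConnected_U : IsConnected (S.U : Set Base) := by
  change IsConnected (domain S.Ω (S.K 0) (S.K 1))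
  rw [domain_eq]
  exact S.isConnected_Ω.prod (isConnected_univ_pi.2 S.isConnected_K)

instance : Nonempty S.U := S.isConnected_U.nonempty.to_subtype

/-- The functions that are smooth on the domain of the system. -/
abbrev R := smoothFunctions S.U

/-- The frame of the coordinates; the second dependent variable is the `k`-th one and the third is
the `k'`-th one. -/
def frame (k k' : Fin 2) : Frame S.R where
  t := D (Pi.single 0 1, 0)
  x := D (Pi.single 1 1, 0)
  u := D (0, Pi.single k 1)
  v := D (0, Pi.single k' 1)
  x_t := D_comm _ _
  u_t := D_comm _ _
  v_t := D_comm _ _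
  u_x := D_comm _ _
  v_x := D_comm _ _
  v_u := D_comm _ _

/-- The `i`-th independent variable. -/
def indepVar (i : Fin 2) : S.R := res (fun p => p.1 i) (by fun_prop)

/-- The `k`-th dependent variable. -/
def depVar (k : Fin 2) : S.R := res (fun p => p.2 k) (by fun_prop)

/-- A function of the `k`-th dependent variable. -/
def ofDep (k : Fin 2) (f : ℝ → ℝ) (hf : ContDiffOn ℝ ∞ f (S.K k)) : S.R :=
  res (fun p => f (p.2 k)) (hf.comp (by fun_prop) fun p hp => (S.mem_U.1 hp).2 k)

/-- The diffusivity of the `k`-th equation. -/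
def diffusivity (k : Fin 2) : S.R := S.ofDep k (S.d k) (S.smooth_d k)

lemma D_indepVar (e : Base) (i : Fin 2) : D e (S.indepVar i) = algebraMap ℝ S.R (e.1 i) := by
  refine D_res_of_hasFDerivAt e _ (fun _ => e.1 i) _ contDiffOn_const
    (fun _ => (ContinuousLinearMap.proj i).comp (ContinuousLinearMap.fst ℝ _ _))
    (fun p _ => ((ContinuousLinearMap.proj i).comp
      (ContinuousLinearMap.fst ℝ (Fin 2 → ℝ) (Fin 2 → ℝ))).hasFDerivAt) (fun _ _ => rfl)

lemma D_depVar (e : Base) (k : Fin 2) : D e (S.depVar k) = algebraMap ℝ S.R (e.2 k) := by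
  refine D_res_of_hasFDerivAt e _ (fun _ => e.2 k) _ contDiffOn_const
    (fun _ => (ContinuousLinearMap.proj k).comp (ContinuousLinearMap.snd ℝ _ _))
    (fun p _ => ((ContinuousLinearMap.proj k).comp
      (ContinuousLinearMap.snd ℝ (Fin 2 → ℝ) (Fin 2 → ℝ))).hasFDerivAt) (fun _ _ => rfl)

lemma contDiffOn_deriv (k : Fin 2) {f : ℝ → ℝ} (hf : ContDiffOn ℝ ∞ f (S.K k)) :
    ContDiffOn ℝ ∞ (deriv f) (S.K k) :=
  ((contDiffOn_infty_iff_deriv_of_isOpen (S.isOpen_K k)).1 hf).2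

lemma D_ofDep (e : Base) (k : Fin 2) (f : ℝ → ℝ) (hf : ContDiffOn ℝ ∞ f (S.K k)) :
    D e (S.ofDep k f hf) =
      algebraMap ℝ S.R (e.2 k) * S.ofDep k (deriv f) (S.contDiffOn_deriv k hf) := by
  refine D_res_of_hasFDerivAt e _ (fun p => e.2 k * deriv f (p.2 k)) _
    (contDiffOn_const.mul ((S.contDiffOn_deriv k hf).comp (by fun_prop)
      fun p hp => (S.mem_U.1 hp).2 k))
    (fun p => deriv f (p.2 k) •
      (ContinuousLinearMap.proj k).comp (ContinuousLinearMap.snd ℝ (Fin 2 → ℝ) (Fin 2 → ℝ)))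
    (fun p hp => ?_) (fun _ _ => ?_)
  · have hd : HasDerivAt f (deriv f (p.2 k)) (p.2 k) :=
      ((hf.contDiffAt ((S.isOpen_K k).mem_nhds ((S.mem_U.1 hp).2 k))).differentiableAt
        (by simp)).hasDerivAt
    exact hd.comp_hasFDerivAt p (f := fun q : Base => q.2 k)
      (((ContinuousLinearMap.proj k).comp
        (ContinuousLinearMap.snd ℝ (Fin 2 → ℝ) (Fin 2 → ℝ))).hasFDerivAt)
  · simp [mul_comm]

lemma isUnit_diffusivity (k : Fin 2) : IsUnit (S.diffusivity k) := by
  unfold diffusivity ofDep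
  exact isUnit_res _ fun p hp => (S.pos_d _ _ ((S.mem_U.1 hp).2 _)).ne'

lemma coefficients {k k' : Fin 2} (hk : k ≠ k') :
    (S.frame k k').Coefficients (S.diffusivity k) (S.diffusivity k') := by
  refine ⟨?_, ?_, ?_, ?_, ?_, ?_, ?_, ?_⟩
  iterate 6 simp [frame, diffusivity, D_ofDep, hk, hk.symm]
  · exact S.isUnit_diffusivity k
  · exact S.isUnit_diffusivity k'

/-- The functions on a connected domain all of whose derivatives vanish are constant. -/
lemma exists_eq_algebraMap {k k' : Fin 2} (hk : k ≠ k') {f : S.R} (ht : (S.frame k k').t f = 0)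
    (hx : (S.frame k k').x f = 0) (hu : (S.frame k k').u f = 0) (hv : (S.frame k k').v f = 0) :
    ∃ c : ℝ, f = algebraMap ℝ S.R c := by
  obtain ⟨F, hF, rfl⟩ := exists_res f
  have h0 : ∀ p (hp : p ∈ S.U), fderiv ℝ F p = 0 := fun p hp => by
    have e₁ : fderiv ℝ F p (Pi.single 0 1, 0) = 0 := by
      rw [← D_res_apply _ F hF ⟨p, hp⟩]; exact congrFun (congrArg Subtype.val ht) ⟨p, hp⟩
    have e₂ : fderiv ℝ F p (Pi.single 1 1, 0) = 0 := by
      rw [← D_res_apply _ F hF ⟨p, hp⟩]; exact congrFun (congrArg Subtype.val hx) ⟨p, hp⟩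
    have e₃ : fderiv ℝ F p (0, Pi.single k 1) = 0 := by
      rw [← D_res_apply _ F hF ⟨p, hp⟩]; exact congrFun (congrArg Subtype.val hu) ⟨p, hp⟩
    have e₄ : fderiv ℝ F p (0, Pi.single k' 1) = 0 := by
      rw [← D_res_apply _ F hF ⟨p, hp⟩]; exact congrFun (congrArg Subtype.val hv) ⟨p, hp⟩
    refine ContinuousLinearMap.ext fun w => ?_
    rw [base_eq_sum hk w]
    simp only [map_add, map_smul, e₁, e₂, e₃, e₄, smul_zero, add_zero,
      _root_.zero_apply]
  obtain ⟨c, hc⟩ := S.U.2.exists_is_const_of_fderiv_eq_zero S.isConnected_U.isPreconnected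
    (fun p hp => (differentiableAt_of_contDiffOn hF hp).differentiableWithinAt) h0
  exact ⟨c, Subtype.ext (funext fun p => hc p p.2)⟩

/-- A function whose derivative with respect to the `k`-th dependent variable vanishes does not
depend on that variable. -/
lemma apply_eq_of_D_eq_zero {k : Fin 2} {f : S.R} (hf : D (0, Pi.single k 1) f = 0) {p q : S.U}
    (h₁ : p.1.1 = q.1.1) (h₂ : ∀ i, i ≠ k → p.1.2 i = q.1.2 i) : f.1 p = f.1 q := by
  obtain ⟨F, hF, rfl⟩ := exists_res f
  let c : ℝ → Base := fun s => (p.1.1, Function.update p.1.2 k s)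
  have hc : ∀ s ∈ S.K k, c s ∈ S.U := fun s hs => by
    refine S.mem_U.2 ⟨(S.mem_U.1 p.2).1, fun i => ?_⟩
    rcases eq_or_ne i k with rfl | hi
    · simpa [c] using hs
    · simpa [c, hi] using (S.mem_U.1 p.2).2 i
  have hd : ∀ s ∈ S.K k, HasDerivAt (fun s => F (c s)) 0 s := fun s hs => by
    have e : HasDerivAt c (0, Pi.single k 1) s :=
      (hasDerivAt_const s _).prodMk (hasDerivAt_update _ k s)
    have h := (differentiableAt_of_contDiffOn hF (hc s hs)).hasFDerivAt.comp_hasDerivAt s e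
    rw [← D_res_apply _ F hF ⟨_, hc s hs⟩, hf] at h
    exact h
  have h := (S.isOpen_K k).is_const_of_deriv_eq_zero (S.isConnected_K k).isPreconnected
    (fun s hs => (hd s hs).differentiableAt.differentiableWithinAt) (fun s hs => (hd s hs).deriv)
    ((S.mem_U.1 p.2).2 k) ((S.mem_U.1 q.2).2 k)
  have e₁ : c (p.1.2 k) = p := by simp [c]
  have e₂ : c (q.1.2 k) = q := by
    refine Prod.ext h₁ (funext fun i => ?_)
    rcases eq_or_ne i k with rfl | hi
    · simp [c]
    · simpa [c, hi] using h₂ i hi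
  simpa [e₁, e₂] using h

end HeatData

/-! ### Total derivatives and prolongations on jets. -/

section Jets

variable {U : Opens Base}

/-- The direction of the total derivative `D_i` at a first-order jet. -/
def direction (j : Jet1) (i : Fin 2) : Base := (Pi.single i 1, fun k => j.2 k i)

lemma hasFDerivAt_direction (i : Fin 2) (j : Jet1) :
    HasFDerivAt (fun j => direction j i)
      ((0 : Jet1 →L[ℝ] (Fin 2 → ℝ)).prod (ContinuousLinearMap.pi fun k =>
        (ContinuousLinearMap.proj i).comp ((ContinuousLinearMap.proj k).comp
          (ContinuousLinearMap.snd ℝ Base (Fin 2 → Fin 2 → ℝ))))) j :=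
  (hasFDerivAt_const _ _).prodMk (ContinuousLinearMap.hasFDerivAt (ContinuousLinearMap.pi fun k =>
        (ContinuousLinearMap.proj i).comp ((ContinuousLinearMap.proj k).comp
          (ContinuousLinearMap.snd ℝ Base (Fin 2 → Fin 2 → ℝ)))))

/-- A total derivative is dF at the base point, evaluated on a direction that is affine in the jet.
The product rule therefore gives a Hessian term and a term in which dF meets the variation of the
direction. -/
lemma hasFDerivAt_totalDeriv0 {F : Base → ℝ} (hF : ContDiffOn ℝ ∞ F U) (i : Fin 2) {j : Jet1}
    (hj : j.1 ∈ U) : DifferentiableAt ℝ (totalDeriv0 i F) j ∧ ∀ h,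
      fderiv ℝ (totalDeriv0 i F) j h = fderiv ℝ (fderiv ℝ F) j.1 h.1 (direction j i) +
        fderiv ℝ F j.1 (0, fun k => h.2 k i) := by
  have h1 : DifferentiableAt ℝ (fderiv ℝ F) j.1 :=
    ((hF.contDiffAt (U.2.mem_nhds hj)).fderiv_right (m := ∞) (by simp)).differentiableAt (by simp)
  have h2 := h1.hasFDerivAt.comp j hasFDerivAt_fst
  have h3 : HasFDerivAt (totalDeriv0 i F) _ j := h2.clm_apply (hasFDerivAt_direction i j)
  refine ⟨h3.differentiableAt, fun h => ?_⟩
  rw [h3.fderiv]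
  simp only [_root_.add_apply, ContinuousLinearMap.comp_apply,
    ContinuousLinearMap.flip_apply, Function.comp]
  rw [add_comm]
  rfl

lemma D_D_res_apply {F : Base → ℝ} (hF : ContDiffOn ℝ ∞ F U) (e e' : Base) (p : U) :
    (D e (D e' (res F hF))).1 p = fderiv ℝ (fderiv ℝ F) p e e' := by
  rw [D_res e', D_res_apply, fderiv_fderiv_apply hF _ _ p.2]

/-- The second total derivative of a smooth function at a jet. -/
def secondTotal (f : smoothFunctions U) (p : U) (j : Jet2) : ℝ :=
  (D (direction j.1 1) (D (direction j.1 1) f)).1 p + (D (0, fun k => j.2 k 1 1) f).1 p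

/-- Freezing the direction (1; u_x, v_x) makes D_x a derivation with constant coefficients. What
freezing loses is the variation of the direction, the vertical vector (u_xx, v_xx); this is the
second summand of `secondTotal`. -/
lemma fderiv_totalDeriv0 {F : Base → ℝ} (hF : ContDiffOn ℝ ∞ F U) (p : U) {j : Jet2}
    (hj : j.1.1 = p) :
    totalDeriv1 1 (totalDeriv0 1 F) j = secondTotal (res F hF) p j := by
  have hp : j.1.1 ∈ U := hj ▸ p.2
  rw [totalDeriv1, (hasFDerivAt_totalDeriv0 hF 1 hp).2, secondTotal, D_D_res_apply, D_res_apply, hj]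
  rfl

lemma contDiffOn_fst_apply {X : Operator} (hX : ContDiffOn ℝ ∞ X U) (i : Fin 2) :
    ContDiffOn ℝ ∞ (fun p => (X p).1 i) U :=
  ((contDiff_apply ℝ ℝ i).comp contDiff_fst).comp_contDiffOn hX

lemma contDiffOn_snd_apply {X : Operator} (hX : ContDiffOn ℝ ∞ X U) (i : Fin 2) :
    ContDiffOn ℝ ∞ (fun p => (X p).2 i) U :=
  ((contDiff_apply ℝ ℝ i).comp contDiff_snd).comp_contDiffOn hX

lemma prolong1_apply {X : Operator} {τ ξ η : smoothFunctions U} (k i : Fin 2) (p : U) {j : Jet1}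
    (hj : j.1 = p) (hτ : ∀ p : U, (X p).1 0 = τ.1 p) (hξ : ∀ p : U, (X p).1 1 = ξ.1 p)
    (hη : ∀ p : U, (X p).2 k = η.1 p) :
    (prolong1 X j).2 k i = (D (direction j i) η).1 p - (j.2 k 0 * (D (direction j i) τ).1 p +
      j.2 k 1 * (D (direction j i) ξ).1 p) := by
  obtain ⟨T, hT, rfl⟩ := exists_res τ
  obtain ⟨Ξ, hΞ, rfl⟩ := exists_res ξ
  obtain ⟨H, hH, rfl⟩ := exists_res η
  simp only [prolong1, Fin.sum_univ_two, totalDeriv0, hj, D_res_apply]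
  rw [fderiv_eq_of_eqOn (U := U) (F := fun p => (X p).2 k) (G := H) (fun p hp => hη ⟨p, hp⟩) p.2,
    fderiv_eq_of_eqOn (U := U) (F := fun p => (X p).1 0) (G := T) (fun p hp => hτ ⟨p, hp⟩) p.2,
    fderiv_eq_of_eqOn (U := U) (F := fun p => (X p).1 1) (G := Ξ) (fun p hp => hξ ⟨p, hp⟩) p.2]
  rfl

/-- Only the xx-coefficient is needed, because u_xx is the only second derivative in the equation.
The mixed derivatives u_tx and u_xt are kept apart, since symmetry of the jet is not assumed here.
-/
lemma prolong2_apply {X : Operator} {τ ξ η : smoothFunctions U} (k : Fin 2) (p : U) {j : Jet2}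
    (hj : j.1.1 = p) (hτ : ∀ p : U, (X p).1 0 = τ.1 p) (hξ : ∀ p : U, (X p).1 1 = ξ.1 p)
    (hη : ∀ p : U, (X p).2 k = η.1 p) :
    (prolong2 X j).2 k 1 1 = secondTotal η p j
      - (j.1.2 k 0 * secondTotal τ p j + j.2 k 0 1 * (D (direction j.1 1) τ).1 p
        + (j.1.2 k 1 * secondTotal ξ p j + j.2 k 1 1 * (D (direction j.1 1) ξ).1 p))
      - (j.2 k 1 0 * (D (direction j.1 1) τ).1 p + j.2 k 1 1 * (D (direction j.1 1) ξ).1 p) := by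
  obtain ⟨T, hT, rfl⟩ := exists_res τ
  obtain ⟨Ξ, hΞ, rfl⟩ := exists_res ξ
  obtain ⟨H, hH, rfl⟩ := exists_res η
  have hp : j.1.1 ∈ U := hj ▸ p.2
  have eT : ∀ q ∈ U, fderiv ℝ (fun p => (X p).1 0) q = fderiv ℝ T q := fun q hq =>
    fderiv_eq_of_eqOn (fun p hp => hτ ⟨p, hp⟩) hq
  have eΞ : ∀ q ∈ U, fderiv ℝ (fun p => (X p).1 1) q = fderiv ℝ Ξ q := fun q hq =>
    fderiv_eq_of_eqOn (fun p hp => hξ ⟨p, hp⟩) hq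
  have eH : ∀ q ∈ U, fderiv ℝ (fun p => (X p).2 k) q = fderiv ℝ H q := fun q hq =>
    fderiv_eq_of_eqOn (fun p hp => hη ⟨p, hp⟩) hq
  -- The first prolongation gets differentiated, so its formula in terms of T, Ξ, H is needed on a
  -- neighbourhood of the jet.
  have hev : (fun j₁ => (prolong1 X j₁).2 k 1) =ᶠ[nhds j.1] fun j₁ => totalDeriv0 1 H j₁ -
      (j₁.2 k 0 * totalDeriv0 1 T j₁ + j₁.2 k 1 * totalDeriv0 1 Ξ j₁) := by
    filter_upwards [continuousAt_fst.preimage_mem_nhds (U.2.mem_nhds hp)] with q hq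
    simp only [prolong1, Fin.sum_univ_two, totalDeriv0, eT _ hq, eΞ _ hq, eH _ hq]
  have hc : ∀ i : Fin 2, HasFDerivAt (fun j₁ : Jet1 => j₁.2 k i)
      ((ContinuousLinearMap.proj i).comp ((ContinuousLinearMap.proj k).comp
          (ContinuousLinearMap.snd ℝ Base (Fin 2 → Fin 2 → ℝ)))) j.1 := fun i =>
    ((ContinuousLinearMap.proj i).comp ((ContinuousLinearMap.proj k).comp
          (ContinuousLinearMap.snd ℝ Base (Fin 2 → Fin 2 → ℝ)))).hasFDerivAt
  have h := ((hasFDerivAt_totalDeriv0 hH 1 hp).1.hasFDerivAt.sub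
    (((hc 0).mul (hasFDerivAt_totalDeriv0 hT 1 hp).1.hasFDerivAt).add
      ((hc 1).mul (hasFDerivAt_totalDeriv0 hΞ 1 hp).1.hasFDerivAt))).fderiv
  have e : totalDeriv1 1 (fun j₁ => (prolong1 X j₁).2 k 1) j = totalDeriv1 1 (totalDeriv0 1 H) j -
      (j.1.2 k 0 * totalDeriv1 1 (totalDeriv0 1 T) j + j.2 k 0 1 * totalDeriv0 1 T j.1 +
        (j.1.2 k 1 * totalDeriv1 1 (totalDeriv0 1 Ξ) j + j.2 k 1 1 * totalDeriv0 1 Ξ j.1)) := by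
    rw [totalDeriv1, hev.fderiv_eq]
    erw [h]
    simp [totalDeriv1]
    ring
  simp only [prolong2, e, fderiv_totalDeriv0 hH p hj, fderiv_totalDeriv0 hT p hj,
    fderiv_totalDeriv0 hΞ p hj, Fin.sum_univ_two]
  simp only [totalDeriv0, D_res_apply, hj, eT _ p.2, eΞ _ p.2]
  rfl

lemma fderiv_heatExpr (k : Fin 2) {d : ℝ → ℝ} {s : Set ℝ} (hs : IsOpen s)
    (hd : ContDiffOn ℝ ∞ d s) {j : Jet2} (hj : j.1.1.2 k ∈ s) (w : Jet2) :
    fderiv ℝ (heatExpr k d) j w = w.1.2 k 0 - (d (j.1.1.2 k) * w.2 k 1 1 +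
      deriv d (j.1.1.2 k) * w.1.1.2 k * j.2 k 1 1 +
      deriv (deriv d) (j.1.1.2 k) * w.1.1.2 k * j.1.2 k 1 ^ 2 +
      deriv d (j.1.1.2 k) * (2 * j.1.2 k 1 * w.1.2 k 1)) := by
  have c₀ := ((ContinuousLinearMap.proj (R := ℝ) (φ := fun _ : Fin 2 => ℝ) k).comp
    ((ContinuousLinearMap.snd ℝ (Fin 2 → ℝ) (Fin 2 → ℝ)).comp
    ((ContinuousLinearMap.fst ℝ Base (Fin 2 → Fin 2 → ℝ)).comp
      (ContinuousLinearMap.fst ℝ Jet1 (Fin 2 → Fin 2 → Fin 2 → ℝ))))).hasFDerivAt (x := j)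
  have c₁ := fun i : Fin 2 => ((ContinuousLinearMap.proj (R := ℝ) (φ := fun _ : Fin 2 => ℝ) i).comp
    ((ContinuousLinearMap.proj (R := ℝ) (φ := fun _ : Fin 2 => Fin 2 → ℝ) k).comp
    ((ContinuousLinearMap.snd ℝ Base (Fin 2 → Fin 2 → ℝ)).comp
      (ContinuousLinearMap.fst ℝ Jet1 (Fin 2 → Fin 2 → Fin 2 → ℝ))))).hasFDerivAt (x := j)
  have c₂ := ((ContinuousLinearMap.proj (R := ℝ) (φ := fun _ : Fin 2 => ℝ) 1).comp
    ((ContinuousLinearMap.proj (R := ℝ) (φ := fun _ : Fin 2 => Fin 2 → ℝ) 1).comp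
    ((ContinuousLinearMap.proj (R := ℝ) (φ := fun _ : Fin 2 => Fin 2 → Fin 2 → ℝ) k).comp
    (ContinuousLinearMap.snd ℝ Jet1 (Fin 2 → Fin 2 → Fin 2 → ℝ))))).hasFDerivAt (x := j)
  have hd' := ((contDiffOn_infty_iff_deriv_of_isOpen hs).1 hd).2
  have e₀ : HasDerivAt d (deriv d (j.1.1.2 k)) (j.1.1.2 k) :=
    ((hd.contDiffAt (hs.mem_nhds hj)).differentiableAt (by simp)).hasDerivAt
  have e₁ : HasDerivAt (deriv d) (deriv (deriv d) (j.1.1.2 k)) (j.1.1.2 k) :=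
    ((hd'.contDiffAt (hs.mem_nhds hj)).differentiableAt (by simp)).hasDerivAt
  have h := (c₁ 0).sub (((e₀.comp_hasFDerivAt j c₀).mul c₂).add
    ((e₁.comp_hasFDerivAt j c₀).mul ((c₁ 1).pow 2)))
  have h' : HasFDerivAt (heatExpr k d) _ j := h
  rw [h'.fderiv]
  simp
  ring

end Jets

/-! ### The invariance condition as a polynomial in the jet variables. -/

section HeatPolynomial

variable {U : Opens Base} (F : Frame (smoothFunctions U)) (a τ ξ η : smoothFunctions U)

/-- The value at `p` of `D_x f`, where `D_x` is the total derivative at a jet with `u_x = P` and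
`v_x = Q`. -/
def totalX (f : smoothFunctions U) (p : U) (P Q : ℝ) : ℝ :=
  (F.x f).1 p + P * (F.u f).1 p + Q * (F.v f).1 p

/-- The value at `p` of `D_t f`, where `D_t` is the total derivative at a jet with `u_t = P` and
`v_t = Q`. -/
def totalT (f : smoothFunctions U) (p : U) (P Q : ℝ) : ℝ :=
  (F.t f).1 p + P * (F.u f).1 p + Q * (F.v f).1 p

/-- The value at `p` of `D_x D_x f` at a jet with `u_x = P`, `v_x = Q`, `u_xx = r`, `v_xx = s`. -/
def totalXX (f : smoothFunctions U) (p : U) (P Q r s : ℝ) : ℝ :=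
  (F.x (F.x f)).1 p + 2 * P * (F.x (F.u f)).1 p + 2 * Q * (F.x (F.v f)).1 p +
    P ^ 2 * (F.u (F.u f)).1 p + 2 * P * Q * (F.u (F.v f)).1 p + Q ^ 2 * (F.v (F.v f)).1 p +
    r * (F.u f).1 p + s * (F.v f).1 p

/-- The value of the second prolongation of `τ ∂_t + ξ ∂_x + η ∂_u + …` on the expression
`u_t - (a(u) u_x)_x` at a jet with `u_t = y`, `v_t = z`, `u_x = P`, `v_x = Q`, `u_xx = r`,
`v_xx = s`, `u_tx = m`, `u_xt = n`. -/
def heatPolynomial (p : U) (y z P Q r s m n : ℝ) : ℝ :=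
  (totalT F η p y z - (y * totalT F τ p y z + P * totalT F ξ p y z)) -
    (a.1 p * (totalXX F η p P Q r s
      - (y * totalXX F τ p P Q r s + m * totalX F τ p P Q
        + (P * totalXX F ξ p P Q r s + r * totalX F ξ p P Q))
      - (n * totalX F τ p P Q + r * totalX F ξ p P Q))
    + (F.u a).1 p * η.1 p * r + (F.u (F.u a)).1 p * η.1 p * P ^ 2
    + (F.u a).1 p * (2 * P * (totalX F η p P Q -
      (y * totalX F τ p P Q + P * totalX F ξ p P Q))))

variable {F a τ ξ η} {b : smoothFunctions U}

/-- The free jet variables take arbitrary real values, so every coefficient of the polynomial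
vanishes. Each one is isolated by a finite difference of evaluations at the values 0, 1, −1. -/
lemma Determining.of_heatPolynomial (hab : F.Coefficients a b)
    (h : ∀ (p : U) (P Q r s m : ℝ), heatPolynomial F a τ ξ η p (a.1 p * r + (F.u a).1 p * P ^ 2)
      (b.1 p * s + (F.v b).1 p * Q ^ 2) P Q r s m m = 0) :
    Determining F a b τ ξ η := by
  have ha : ∀ p, a.1 p ≠ 0 := fun p => by
    obtain ⟨c, hc⟩ := hab.unit_a.exists_right_inv
    have h' : a.1 p * c.1 p = 1 := congrFun (congrArg Subtype.val hc) p
    exact left_ne_zero_of_mul_eq_one h'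
  have ext0 : ∀ {f g : smoothFunctions U}, (∀ p, f.1 p = g.1 p) → f = g := fun h =>
    Subtype.ext (funext h)
  -- The variable m stands for both u_tx and u_xt, so its coefficient is 2a times the total
  -- derivative D_x τ.
  have h1 : ∀ p P Q, (F.x τ).1 p + P * (F.u τ).1 p + Q * (F.v τ).1 p = 0 := fun p P Q => by
    have e₁ := h p P Q 0 0 1
    have e₀ := h p P Q 0 0 0
    simp only [heatPolynomial, totalX] at e₀ e₁
    refine (mul_eq_zero.1 ?_).resolve_left (ha p)
    linear_combination (1 / 2) * e₁ - (1 / 2) * e₀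
  have τx : F.x τ = 0 := ext0 fun p => by simpa using h1 p 0 0
  have τu : F.u τ = 0 := ext0 fun p => by simpa [τx] using h1 p 1 0
  have τv : F.v τ = 0 := ext0 fun p => by simpa [τx] using h1 p 0 1
  have z0 : ∀ p, (0 : smoothFunctions U).1 p = 0 := fun p => rfl
  simp only [heatPolynomial, totalX, totalXX, totalT, τx, τu, τv, map_zero, z0, mul_zero, add_zero,
    zero_add] at h
  have ξu : F.u ξ = 0 := ext0 fun p => by
    refine (mul_eq_zero.1 ?_).resolve_left (ha p)
    have e₁ := h p 1 0 1 0 0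
    have e₂ := h p (-1) 0 1 0 0
    have e₃ := h p 1 0 0 0 0
    have e₄ := h p (-1) 0 0 0 0
    -- This difference isolates u_x u_xx: it is odd in P and takes the increment in r. The
    -- coefficient is 2aξ_u, whence the factor 1/4; the next block does the same for v_x u_xx.
    linear_combination (1 / 4) * (e₁ - e₂ - e₃ + e₄)
  have ξv : F.v ξ = 0 := ext0 fun p => by
    refine (mul_eq_zero.1 ?_).resolve_left (ha p)
    have e₁ := h p 0 1 1 0 0
    have e₂ := h p 0 (-1) 1 0 0
    have e₃ := h p 0 1 0 0 0
    have e₄ := h p 0 (-1) 0 0 0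
    linear_combination (1 / 4) * (e₁ - e₂ - e₃ + e₄)
  simp only [ξu, ξv, map_zero, z0, mul_zero, add_zero] at h
  refine Determining.of_coefficients hab τx τu τv ξu ξv ?_ ?_ ?_ ?_ ?_ ?_ ?_ ?_ <;>
    refine ext0 fun p => ?_
  · change (F.u a).1 p * η.1 p = a.1 p * (2 * (F.x ξ).1 p - (F.t τ).1 p)
    have e₁ := h p 0 0 1 0 0
    have e₂ := h p 0 0 0 0 0
    linear_combination e₂ - e₁
  · change (F.v η).1 p * b.1 p = a.1 p * (F.v η).1 p
    have e₁ := h p 0 0 0 1 0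
    have e₂ := h p 0 0 0 0 0
    linear_combination e₁ - e₂
  · change (F.t η).1 p = a.1 p * (F.x (F.x η)).1 p
    have e₂ := h p 0 0 0 0 0
    linear_combination e₂
  · change -(F.t ξ).1 p = 2 * (F.u a).1 p * (F.x η).1 p + 2 * a.1 p * (F.x (F.u η)).1 p
      - a.1 p * (F.x (F.x ξ)).1 p
    have e₁ := h p 1 0 0 0 0
    have e₂ := h p (-1) 0 0 0 0
    linear_combination (1 / 2) * (e₁ - e₂)
  · change a.1 p * (F.x (F.v η)).1 p = 0
    have e₁ := h p 0 1 0 0 0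
    have e₂ := h p 0 (-1) 0 0 0
    linear_combination (1 / 4) * (e₂ - e₁)
  · change ((F.u η).1 p - (F.t τ).1 p) * (F.u a).1 p = (F.u (F.u a)).1 p * η.1 p
      + 2 * (F.u a).1 p * (F.u η).1 p - 2 * (F.u a).1 p * (F.x ξ).1 p + a.1 p * (F.u (F.u η)).1 p
    have e₁ := h p 1 0 0 0 0
    have e₂ := h p (-1) 0 0 0 0
    have e₃ := h p 0 0 0 0 0
    linear_combination (1 / 2) * (e₁ + e₂) - e₃
  · change (F.u a).1 p * (F.v η).1 p + a.1 p * (F.u (F.v η)).1 p = 0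
    have e₁ := h p 1 1 0 0 0
    have e₂ := h p 1 0 0 0 0
    have e₃ := h p 0 1 0 0 0
    have e₄ := h p 0 0 0 0 0
    linear_combination (1 / 2) * (e₂ + e₃ - e₁ - e₄)
  · change (F.v η).1 p * (F.v b).1 p = a.1 p * (F.v (F.v η)).1 p
    have e₁ := h p 0 1 0 0 0
    have e₂ := h p 0 (-1) 0 0 0
    have e₃ := h p 0 0 0 0 0
    linear_combination (1 / 2) * (e₁ + e₂) - e₃

lemma Determining.heatPolynomial_eq_zero (hab : F.Coefficients a b)
    (h : Determining F a b τ ξ η) (p : U) (P Q r s m n : ℝ) :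
    heatPolynomial F a τ ξ η p (a.1 p * r + (F.u a).1 p * P ^ 2)
      (b.1 p * s + (F.v b).1 p * Q ^ 2) P Q r s m n = 0 := by
  have z0 : (0 : smoothFunctions U).1 p = 0 := rfl
  have val : ∀ {f g : smoothFunctions U}, f = g → f.1 p = g.1 p := fun h => h ▸ rfl
  simp only [heatPolynomial, totalX, totalXX, totalT, h.τx, h.τu, h.τv, h.ξu, h.ξv, h.ηxv, h.ηuu,
    h.ηuv, h.ηvv, map_zero, z0, mul_zero, add_zero, zero_add]
  have e₁ : (F.u a).1 p * η.1 p = a.1 p * (2 * (F.x ξ).1 p - (F.t τ).1 p) := val h.diffusion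
  have e₂ : (F.t η).1 p = a.1 p * (F.x (F.x η)).1 p := val h.heat
  have e₃ : -(F.t ξ).1 p = 2 * (F.u a).1 p * (F.x η).1 p + 2 * a.1 p * (F.x (F.u η)).1 p
      - a.1 p * (F.x (F.x ξ)).1 p := val h.drift
  have e₄ : ((F.u η).1 p - (F.t τ).1 p) * (F.u a).1 p = (F.u (F.u a)).1 p * η.1 p
      + 2 * (F.u a).1 p * (F.u η).1 p - 2 * (F.u a).1 p * (F.x ξ).1 p
      + a.1 p * (F.u (F.u η)).1 p := val h.coefficient_uu
  have e₅ : (F.v η).1 p * (b.1 p - a.1 p) = 0 := val h.coupling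
  have e₆ : (F.v η).1 p * (F.v b).1 p = 0 := val (h.vb hab)
  have e₇ : (F.v η).1 p * (F.u a).1 p = 0 := val (h.ua hab)
  have e₈ : (F.u (F.u η)).1 p = 0 := val h.ηuu
  -- Each determining equation is weighted by the monomial whose coefficient it governs.
  linear_combination -r * e₁ + e₂ + P * e₃ + P ^ 2 * e₄ + s * e₅ + Q ^ 2 * e₆ - 2 * P * Q * e₇
    + P ^ 2 * a.1 p * e₈

end HeatPolynomial

/-! ### Symmetries are the solutions of the determining equations. -/

namespace HeatData

variable (S : HeatData)

lemma D_direction {k k' : Fin 2} (hk : k ≠ k') (j : Jet1) (i : Fin 2) (f : S.R) :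
    D (direction j i) f = D (Pi.single i 1, 0) f + j.2 k i • (S.frame k k').u f
      + j.2 k' i • (S.frame k k').v f := by
  have h : direction j i = (Pi.single i 1, 0) + j.2 k i • ((0, Pi.single k 1) : Base) +
      j.2 k' i • ((0, Pi.single k' 1) : Base) := by
    rw [base_eq_sum hk (direction j i)]
    fin_cases i <;> simp [direction]
  rw [h, D_add, D_add, D_smul, D_smul]
  rfl

lemma D_snd {k k' : Fin 2} (hk : k ≠ k') (w : Fin 2 → ℝ) (f : S.R) :
    D (0, w) f = w k • (S.frame k k').u f + w k' • (S.frame k k').v f := by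
  have h : ((0, w) : Base) = w k • ((0, Pi.single k 1) : Base) +
      w k' • ((0, Pi.single k' 1) : Base) := by
    conv_lhs => rw [base_eq_sum hk (0, w)]
    simp
  rw [h, D_add, D_smul, D_smul]
  rfl

lemma totalX_eq {k k' : Fin 2} (hk : k ≠ k') (j : Jet1) (f : S.R) (p : S.U) :
    (D (direction j 1) f).1 p = totalX (S.frame k k') f p (j.2 k 1) (j.2 k' 1) := by
  rw [S.D_direction hk]; rfl

lemma totalT_eq {k k' : Fin 2} (hk : k ≠ k') (j : Jet1) (f : S.R) (p : S.U) :
    (D (direction j 0) f).1 p = totalT (S.frame k k') f p (j.2 k 0) (j.2 k' 0) := by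
  rw [S.D_direction hk]; rfl

lemma totalXX_eq {k k' : Fin 2} (hk : k ≠ k') (j : Jet2) (f : S.R) (p : S.U) :
    secondTotal f p j = totalXX (S.frame k k') f p (j.1.2 k 1) (j.1.2 k' 1) (j.2 k 1 1)
      (j.2 k' 1 1) := by
  have hx : ∀ f : S.R, D (direction j.1 1) f = (S.frame k k').x f
      + j.1.2 k 1 • (S.frame k k').u f + j.1.2 k' 1 • (S.frame k k').v f := fun f =>
    S.D_direction hk j.1 1 f
  rw [secondTotal, hx, hx, S.D_snd hk]
  simp only [map_add, Derivation.map_smul, (S.frame k k').u_x, (S.frame k k').v_x,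
    (S.frame k k').v_u, totalXX, AddMemClass.coe_add, SetLike.val_smul, Pi.add_apply,
    Pi.smul_apply, smul_eq_mul]
  ring

lemma u_diffusivity (k k' : Fin 2) : (S.frame k k').u (S.diffusivity k) =
    S.ofDep k (deriv (S.d k)) (S.contDiffOn_deriv k (S.smooth_d k)) := by
  simp [frame, diffusivity, D_ofDep]

lemma uu_diffusivity (k k' : Fin 2) : (S.frame k k').u ((S.frame k k').u (S.diffusivity k)) =
    S.ofDep k (deriv (deriv (S.d k)))
      (S.contDiffOn_deriv k (S.contDiffOn_deriv k (S.smooth_d k))) := by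
  rw [u_diffusivity]
  simp [frame, D_ofDep]

/-- The bridge from the analytic definition of invariance to the polynomial. The jet need not
satisfy the equations nor be symmetric; u_t and v_t are eliminated only afterwards. -/
lemma fderiv_heatExpr_prolong2 {k k' : Fin 2} (hk : k ≠ k') {X : Operator} {τ ξ η : S.R}
    (hτ : ∀ p : S.U, (X p).1 0 = τ.1 p) (hξ : ∀ p : S.U, (X p).1 1 = ξ.1 p)
    (hη : ∀ p : S.U, (X p).2 k = η.1 p) (p : S.U) {j : Jet2} (hj : j.1.1 = p) :
    fderiv ℝ (heatExpr k (S.d k)) j (prolong2 X j) =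
      heatPolynomial (S.frame k k') (S.diffusivity k) τ ξ η p (j.1.2 k 0) (j.1.2 k' 0)
        (j.1.2 k 1) (j.1.2 k' 1) (j.2 k 1 1) (j.2 k' 1 1) (j.2 k 0 1) (j.2 k 1 0) := by
  rw [fderiv_heatExpr k (S.isOpen_K k) (S.smooth_d k) (by rw [hj]; exact (S.mem_U.1 p.2).2 k),
    prolong2_apply k p hj hτ hξ hη]
  change (prolong1 X j.1).2 k 0 - (_ + _ * (X j.1.1).2 k * _ + _ * (X j.1.1).2 k * _ +
    _ * (_ * (prolong1 X j.1).2 k 1)) = _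
  rw [prolong1_apply k 0 p hj hτ hξ hη, prolong1_apply k 1 p hj hτ hξ hη, hj, hη p]
  simp only [S.totalX_eq hk, S.totalT_eq hk, S.totalXX_eq hk]
  rw [heatPolynomial, uu_diffusivity, u_diffusivity]
  rfl

/-- A jet over `p` that satisfies the equations, with prescribed values of the parametric
derivatives. -/
def solutionJet (k k' : Fin 2) (p : Base) (P Q r s m : ℝ) : Jet2 :=
  ((p, fun i => if i = k then ![S.d k (p.2 k) * r + deriv (S.d k) (p.2 k) * P ^ 2, P]
      else ![S.d k' (p.2 k') * s + deriv (S.d k') (p.2 k') * Q ^ 2, Q]),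
    fun i => if i = k then ![![0, m], ![m, r]] else ![![0, 0], ![0, s]])

lemma mem_equationManifold {j : Jet2} :
    j ∈ equationManifold S.Ω (S.K 0) (S.K 1) (S.d 0) (S.d 1) ↔
      j.1.1 ∈ S.U ∧ (∀ k i l, j.2 k i l = j.2 k l i) ∧ ∀ k, heatExpr k (S.d k) j = 0 := by
  rw [Fin.forall_fin_two (p := fun k => heatExpr k (S.d k) j = 0)]; rfl

lemma eq_or_eq_of_ne {k k' : Fin 2} (hk : k ≠ k') (i : Fin 2) : i = k ∨ i = k' := by omega

lemma solutionJet_mem {k k' : Fin 2} (hk : k ≠ k') (p : S.U) (P Q r s m : ℝ) :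
    S.solutionJet k k' p P Q r s m ∈ equationManifold S.Ω (S.K 0) (S.K 1) (S.d 0) (S.d 1) := by
  refine S.mem_equationManifold.2 ⟨p.2, fun i l l' => ?_, fun i => ?_⟩
  · rcases eq_or_eq_of_ne hk i with rfl | rfl <;> fin_cases l <;> fin_cases l' <;>
      simp [solutionJet, hk.symm]
  · rcases eq_or_eq_of_ne hk i with rfl | rfl <;> simp [solutionJet, heatExpr, hk.symm]

/-- The components of a smooth operator. -/
structure Components (X : Operator) (τ ξ : S.R) (η : Fin 2 → S.R) : Prop where
  t : ∀ p : S.U, (X p).1 0 = τ.1 p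
  x : ∀ p : S.U, (X p).1 1 = ξ.1 p
  dep : ∀ k, ∀ p : S.U, (X p).2 k = (η k).1 p

/-- The operator is an infinitesimal symmetry of the system. -/
def IsSymm (X : Operator) : Prop := IsSymmetry S.Ω (S.K 0) (S.K 1) (S.d 0) (S.d 1) X

variable {S}

lemma Components.contDiffOn {X : Operator} {τ ξ : S.R} {η : Fin 2 → S.R}
    (h : S.Components X τ ξ η) : ContDiffOn ℝ ∞ X S.U := by
  have key : ∀ {f : Base → ℝ} {g : S.R}, (∀ p : S.U, f p = g.1 p) → ContDiffOn ℝ ∞ f S.U := by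
    intro f g hfg
    obtain ⟨G, hG, rfl⟩ := exists_res g
    exact hG.congr fun p hp => hfg ⟨p, hp⟩
  refine ContDiffOn.prodMk (contDiffOn_pi.2 fun i => ?_) (contDiffOn_pi.2 fun k => key (h.dep k))
  fin_cases i
  · exact key h.t
  · exact key h.x

lemma exists_components {X : Operator} (hX : ContDiffOn ℝ ∞ X S.U) :
    ∃ τ ξ η, S.Components X τ ξ η :=
  ⟨res _ (contDiffOn_fst_apply hX 0), res _ (contDiffOn_fst_apply hX 1),
    fun k => res _ (contDiffOn_snd_apply hX k), fun _ => rfl, fun _ => rfl, fun _ _ => rfl⟩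

/-- The infinitesimal symmetries are the solutions of the determining equations. -/
lemma Components.isSymm_iff {X : Operator} {τ ξ : S.R} {η : Fin 2 → S.R}
    (h : S.Components X τ ξ η) : S.IsSymm X ↔ ∀ k k', k ≠ k' →
      Determining (S.frame k k') (S.diffusivity k) (S.diffusivity k') τ ξ (η k) := by
  constructor
  · rintro ⟨-, hs⟩ k k' hk
    refine Determining.of_heatPolynomial (S.coefficients hk) fun p P Q r s m => ?_
    -- These jets realise all values of the parametric derivatives u_x, v_x, u_xx, v_xx, u_tx over
    -- every point of the domain, which gives the polynomial identity in full.
    have hm := S.solutionJet_mem hk p P Q r s m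
    have e : ∀ i, fderiv ℝ (heatExpr i (S.d i)) (S.solutionJet k k' p P Q r s m)
        (prolong2 X (S.solutionJet k k' p P Q r s m)) = 0 :=
      Fin.forall_fin_two.2 (hs _ hm)
    have e := e k
    rw [S.fderiv_heatExpr_prolong2 hk h.t h.x (h.dep k) p rfl] at e
    have hv : (S.frame k k').v (S.diffusivity k') =
        S.ofDep k' (deriv (S.d k')) (S.contDiffOn_deriv k' (S.smooth_d k')) :=
      S.u_diffusivity k' k
    rw [u_diffusivity, hv]
    simp only [solutionJet, if_true, hk.symm, if_false, Matrix.cons_val_zero,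
      Matrix.cons_val_one] at e
    exact e
  · intro hd
    refine ⟨h.contDiffOn, fun j hj => ?_⟩
    obtain ⟨hp, hsym, he⟩ := S.mem_equationManifold.1 hj
    have key : ∀ k, fderiv ℝ (heatExpr k (S.d k)) j (prolong2 X j) = 0 := fun k => by
      obtain ⟨k', hk⟩ : ∃ k', k ≠ k' := (exists_ne k).imp fun _ h => h.symm
      have e := (hd k k' hk).heatPolynomial_eq_zero (S.coefficients hk) ⟨j.1.1, hp⟩ (j.1.2 k 1)
        (j.1.2 k' 1) (j.2 k 1 1) (j.2 k' 1 1) (j.2 k 0 1) (j.2 k 1 0)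
      rw [S.fderiv_heatExpr_prolong2 hk h.t h.x (h.dep k) ⟨j.1.1, hp⟩ rfl]
      have hv : (S.frame k k').v (S.diffusivity k') =
          S.ofDep k' (deriv (S.d k')) (S.contDiffOn_deriv k' (S.smooth_d k')) :=
        S.u_diffusivity k' k
      rw [hv, u_diffusivity] at e
      -- On the manifold the two equations express u_t and v_t through the parametric derivatives.
      rw [sub_eq_zero.1 (he k), sub_eq_zero.1 (he k')]
      exact e
    exact ⟨key 0, key 1⟩

end HeatData

/-! ### Commutators and the space of symmetries. -/

namespace HeatData

variable {S S' : HeatData}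

lemma D_eq_along (τ ξ f : S.R) (η : Fin 2 → S.R) {X : Operator} (h : S.Components X τ ξ η)
    (p : S.U) : (D (X p) f).1 p = ((S.frame 0 1).along τ ξ (η 0) (η 1) f).1 p := by
  rw [base_eq_sum (k := 0) (k' := 1) (by decide) (X p), D_add, D_add, D_add, D_smul, D_smul, D_smul,
    D_smul, h.t, h.x, h.dep, h.dep]
  rfl

lemma Components.lieBracket {X Y : Operator} {τ ξ τ' ξ' : S.R} {η η' : Fin 2 → S.R}
    (h : S.Components X τ ξ η) (h' : S.Components Y τ' ξ' η') :
    S.Components (VectorField.lieBracket ℝ X Y)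
      ((S.frame 0 1).along τ ξ (η 0) (η 1) τ' - (S.frame 0 1).along τ' ξ' (η' 0) (η' 1) τ)
      ((S.frame 0 1).along τ ξ (η 0) (η 1) ξ' - (S.frame 0 1).along τ' ξ' (η' 0) (η' 1) ξ)
      fun k => (S.frame 0 1).along τ ξ (η 0) (η 1) (η' k) -
        (S.frame 0 1).along τ' ξ' (η' 0) (η' 1) (η k) := by
  -- A component of a field is a linear functional of it, and a linear functional commutes with
  -- differentiation; this reduces the bracket to derivations of the components.
  have key : ∀ {X : Operator}, ContDiffOn ℝ ∞ X S.U → ∀ (L : Base →L[ℝ] ℝ) {f : S.R},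
      (∀ p : S.U, L (X p) = f.1 p) → ∀ (p : S.U) (w : Base),
      L (fderiv ℝ X p w) = (D w f).1 p := by
    intro X hX L f hf p w
    have hd : DifferentiableAt ℝ X p :=
      (hX.contDiffAt (S.U.2.mem_nhds p.2)).differentiableAt (by simp)
    have e : f = res (fun q => L (X q)) (L.contDiff.comp_contDiffOn hX) :=
      Subtype.ext (funext fun q => (hf q).symm)
    rw [e, D_res_apply]
    exact congrArg (fun A : Base →L[ℝ] ℝ => A w) (L.hasFDerivAt.comp p.1 hd.hasFDerivAt).fderiv.symm
  have hX := h.contDiffOn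
  have hY := h'.contDiffOn
  have both : ∀ (L : Base →L[ℝ] ℝ) {f f' : S.R}, (∀ p : S.U, L (X p) = f.1 p) →
      (∀ p : S.U, L (Y p) = f'.1 p) → ∀ p : S.U, L (VectorField.lieBracket ℝ X Y p) =
        ((S.frame 0 1).along τ ξ (η 0) (η 1) f' -
          (S.frame 0 1).along τ' ξ' (η' 0) (η' 1) f).1 p := by
    intro L f f' hf hf' p
    rw [VectorField.lieBracket, map_sub, key hX L hf, key hY L hf', D_eq_along τ ξ f' η h,
      D_eq_along τ' ξ' f η' h']
    rfl
  exact ⟨both ((ContinuousLinearMap.proj 0).comp (ContinuousLinearMap.fst ℝ _ _)) h.t h'.t,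
    both ((ContinuousLinearMap.proj 1).comp (ContinuousLinearMap.fst ℝ _ _)) h.x h'.x,
    fun k => both ((ContinuousLinearMap.proj k).comp (ContinuousLinearMap.snd ℝ _ _))
      (h.dep k) (h'.dep k)⟩

/-- The commutator of infinitesimal symmetries is an infinitesimal symmetry. -/
lemma IsSymm.lieBracket {X Y : Operator} (hX : S.IsSymm X) (hY : S.IsSymm Y) :
    S.IsSymm (VectorField.lieBracket ℝ X Y) := by
  obtain ⟨τ, ξ, η, h⟩ := exists_components hX.1
  obtain ⟨τ', ξ', η', h'⟩ := exists_components hY.1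
  rw [h.isSymm_iff] at hX
  rw [h'.isSymm_iff] at hY
  rw [(h.lieBracket h').isSymm_iff]
  have e₀₁ : (0 : Fin 2) ≠ 1 := by decide
  have e : ∀ k k' : Fin 2, k ≠ k' → (k = 0 ∧ k' = 1) ∨ (k = 1 ∧ k' = 0) := by omega
  intro k k' hk
  obtain ⟨rfl, rfl⟩ | ⟨rfl, rfl⟩ := e k k' hk
  · exact Determining.bracket (S.coefficients e₀₁) (hX 0 1 e₀₁) (hX 1 0 e₀₁.symm) (hY 0 1 e₀₁)
      (hY 1 0 e₀₁.symm)
  · simp only [← Frame.along_swap (S.frame 0 1)]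
    exact Determining.bracket (S.coefficients e₀₁.symm) (hX 1 0 e₀₁.symm) (hX 0 1 e₀₁)
      (hY 1 0 e₀₁.symm) (hY 0 1 e₀₁)

/-- The symmetries of a system form a subspace. -/
def symmetries (S : HeatData) : Submodule ℝ Operator where
  carrier := {X | S.IsSymm X}
  zero_mem' := by
    have h : S.Components 0 0 0 0 := ⟨fun _ => rfl, fun _ => rfl, fun _ _ => rfl⟩
    exact h.isSymm_iff.2 fun k k' _ => Determining.zero _ _ _
  add_mem' := by
    rintro X Y hX hY
    obtain ⟨τ, ξ, η, h⟩ := exists_components hX.1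
    obtain ⟨τ', ξ', η', h'⟩ := exists_components hY.1
    have hs : S.Components (X + Y) (τ + τ') (ξ + ξ') (η + η') :=
      ⟨fun p => congrArg₂ (· + ·) (h.t p) (h'.t p), fun p => congrArg₂ (· + ·) (h.x p) (h'.x p),
        fun k p => congrArg₂ (· + ·) (h.dep k p) (h'.dep k p)⟩
    exact hs.isSymm_iff.2 fun k k' hk =>
      (h.isSymm_iff.1 hX k k' hk).add (h'.isSymm_iff.1 hY k k' hk)
  smul_mem' := by
    rintro c X hX
    obtain ⟨τ, ξ, η, h⟩ := exists_components hX.1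
    have hs : S.Components (c • X) (c • τ) (c • ξ) (c • η) :=
      ⟨fun p => congrArg (c * ·) (h.t p), fun p => congrArg (c * ·) (h.x p),
        fun k p => congrArg (c * ·) (h.dep k p)⟩
    exact hs.isSymm_iff.2 fun k k' hk => (h.isSymm_iff.1 hX k k' hk).smul c

/-- `O` lists basic operators of the maximal algebra of invariance of the system. -/
def IsMaximal (S : HeatData) (O : BasicOperators) : Prop :=
  IsMaximalInvarianceAlgebra S.Ω (S.K 0) (S.K 1) (S.d 0) (S.d 1) O

/-- The Lie algebra condition comes for free: the bracket of two symmetries is again a symmetry, and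
the maximality condition places it in the span up to agreement on the domain. -/
lemma isMaximal_of {O : BasicOperators} (hf : ∀ X ∈ O.fin, S.IsSymm X)
    (hi : ∀ X ∈ O.inf, S.IsSymm X)
    (hm : ∀ X, S.IsSymm X → ∃ Y ∈ O.span, EqOn X Y S.U)
    (hl : ∀ c : Fin O.fin.length → ℝ, ∀ Z ∈ Submodule.span ℝ O.inf,
      EqOn (∑ i, c i • O.fin.get i + Z) 0 S.U → c = 0) : S.IsMaximal O := by
  have hs : ∀ X ∈ O.span, S.IsSymm X := fun X hX =>
    (Submodule.span_le (p := S.symmetries)).2 (union_subset hf hi) hX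
  exact ⟨hs, fun X hX Y hY => hm _ ((hs X hX).lieBracket (hs Y hY)), hm, hl⟩

end HeatData

/-! Equivalence transformations. -/

namespace EquivTransf

variable (g : EquivTransf)

/-- The inverse transformation. -/
def inv : EquivTransf where
  a i := (g.a i)⁻¹
  a₀ i := -(g.a₀ i) / g.a i
  b k := (g.b k)⁻¹
  b₀ k := -(g.b₀ k) / g.b k
  ha i := inv_ne_zero (g.ha i)
  hb k := inv_ne_zero (g.hb k)

lemma inv_indep (z : Fin 2 → ℝ) : g.inv.indep (g.indep z) = z := by
  ext i; have := g.ha i; simp only [inv, indep]; field_simp; ring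

lemma indep_inv (z : Fin 2 → ℝ) : g.indep (g.inv.indep z) = z := by
  ext i; have := g.ha i; simp only [inv, indep]; field_simp; ring

lemma inv_dep (k : Fin 2) (w : ℝ) : g.inv.dep k (g.dep k w) = w := by
  have := g.hb k; simp only [inv, dep]; field_simp; ring

lemma dep_inv (k : Fin 2) (w : ℝ) : g.dep k (g.inv.dep k w) = w := by
  have := g.hb k; simp only [inv, dep]; field_simp; ring

lemma inv_base (p : Base) : g.inv.base (g.base p) = p :=
  Prod.ext (g.inv_indep _) (funext fun k => g.inv_dep k _)

lemma base_inv (p : Base) : g.base (g.inv.base p) = p :=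
  Prod.ext (g.indep_inv _) (funext fun k => g.dep_inv k _)

/-- The linear part of the action on `(t, x, u, v)`. -/
def linear : Base →L[ℝ] Base :=
  (ContinuousLinearMap.pi fun i => g.a i •
    (ContinuousLinearMap.proj i).comp (ContinuousLinearMap.fst ℝ (Fin 2 → ℝ) (Fin 2 → ℝ))).prod
  (ContinuousLinearMap.pi fun k => g.b k •
    (ContinuousLinearMap.proj k).comp (ContinuousLinearMap.snd ℝ (Fin 2 → ℝ) (Fin 2 → ℝ)))

lemma hasFDerivAt_base (p : Base) : HasFDerivAt g.base g.linear p :=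
  g.linear.hasFDerivAt.add_const (g.a₀, g.b₀)

lemma contDiff_base : ContDiff ℝ ∞ g.base :=
  ContDiff.add (g := fun _ => ((g.a₀, g.b₀) : Base)) g.linear.contDiff contDiff_const

/-- The action on operators, as a linear map. -/
def pullbackLinear : Operator →ₗ[ℝ] Operator where
  toFun := g.pullback
  map_add' X Y := by
    funext p
    exact Prod.ext (funext fun i => add_div _ _ _) (funext fun i => add_div _ _ _)
  map_smul' c X := by
    funext p
    exact Prod.ext (funext fun i => mul_div_assoc _ _ _) (funext fun i => mul_div_assoc _ _ _)

lemma pullback_inv_apply (X : Operator) (p : Base) :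
    g.inv.pullback X (g.base p) = g.linear (X p) := by
  have h : ∀ q, g.inv.pullback X q = g.linear (X (g.inv.base q)) := fun q => by
    refine Prod.ext (funext fun i => ?_) (funext fun k => ?_)
    · change _ / (g.a i)⁻¹ = g.a i * _
      rw [div_inv_eq_mul, mul_comm]
      rfl
    · change _ / (g.b k)⁻¹ = g.b k * _
      rw [div_inv_eq_mul, mul_comm]
      rfl
  rw [h, inv_base]

lemma linear_pullback (X : Operator) (p : Base) : g.linear (g.pullback X p) = X (g.base p) := by
  refine Prod.ext (funext fun i => ?_) (funext fun k => ?_)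
  · exact mul_div_cancel₀ _ (g.ha i)
  · exact mul_div_cancel₀ _ (g.hb k)

lemma linear_injective : Function.Injective g.linear := by
  intro p q h
  refine Prod.ext (funext fun i => ?_) (funext fun k => ?_)
  · exact mul_left_cancel₀ (g.ha i) (congrFun (congrArg Prod.fst h) i)
  · exact mul_left_cancel₀ (g.hb k) (congrFun (congrArg Prod.snd h) k)

/-- `g` transforms the system `S` into the system `S'`. -/
structure Relates (g : EquivTransf) (S S' : HeatData) : Prop where
  mem_iff : ∀ p, g.base p ∈ S'.U ↔ p ∈ S.U
  d_eq : ∀ k, ∀ w ∈ S.K k, S'.d k (g.dep k w) = g.a 1 ^ 2 / g.a 0 * S.d k w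

variable {g} {S S' : HeatData}

/-- The domain is a product and is nonempty, so a single value of one dependent variable can be
tested by inserting it into a point of the new domain. -/
lemma Relates.mem_K (h : g.Relates S S') {k : Fin 2} {w : ℝ} (hw : g.dep k w ∈ S'.K k) :
    w ∈ S.K k := by
  obtain ⟨⟨q, hq⟩⟩ := (inferInstance : Nonempty S'.U)
  have h1 : ((q.1, Function.update q.2 k (g.dep k w)) : Base) ∈ S'.U := by
    refine S'.mem_U.2 ⟨(S'.mem_U.1 hq).1, fun i => ?_⟩
    rcases eq_or_ne i k with rfl | hi
    · simpa using hw
    · simpa [hi] using (S'.mem_U.1 hq).2 i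
  rw [← g.base_inv (_, _), h.mem_iff] at h1
  have h2 := (S.mem_U.1 h1).2 k
  simpa [base, g.inv_dep] using h2

lemma Relates.inv (h : g.Relates S S') : g.inv.Relates S' S where
  mem_iff p := by rw [← h.mem_iff, base_inv]
  d_eq k w hw := by
    have h1 : g.inv.dep k w ∈ S.K k := h.mem_K (by rwa [dep_inv])
    have h2 := h.d_eq k _ h1
    have h3 := g.ha 0
    have h4 := g.ha 1
    rw [dep_inv] at h2
    rw [h2]
    simp only [EquivTransf.inv]
    field_simp

/-- Functions on the new domain as functions on the old one. -/
def Relates.pull (h : g.Relates S S') (f : S'.R) : S.R :=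
  ⟨fun p => f.1 ⟨g.base p, (h.mem_iff p).2 p.2⟩, by
    obtain ⟨F, hF, hf⟩ := f.2
    exact ⟨F ∘ g.base, hF.comp g.contDiff_base.contDiffOn fun p hp => (h.mem_iff p).2 hp,
      fun p => hf ⟨g.base p, (h.mem_iff p).2 p.2⟩⟩⟩

lemma Relates.D_pull (h : g.Relates S S') (e : Base) (f : S'.R) :
    D e (h.pull f) = h.pull (D (g.linear e) f) := by
  obtain ⟨F, hF, rfl⟩ := exists_res f
  have e₁ : h.pull (res F hF) = res (F ∘ g.base)
      (hF.comp g.contDiff_base.contDiffOn fun p hp => (h.mem_iff p).2 hp) := rfl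
  refine Subtype.ext (funext fun p => ?_)
  rw [e₁, D_res_apply]
  change _ = (D (g.linear e) (res F hF)).1 _
  rw [D_res_apply]
  exact congrArg (fun A : Base →L[ℝ] ℝ => A e) ((differentiableAt_of_contDiffOn hF
    ((h.mem_iff p).2 p.2)).hasFDerivAt.comp p.1 (g.hasFDerivAt_base p)).fderiv

lemma Relates.t_pull (h : g.Relates S S') (k k' : Fin 2) (f : S'.R) :
    (S.frame k k').t (h.pull f) = g.a 0 • h.pull ((S'.frame k k').t f) := by
  have e : g.linear (Pi.single 0 1, 0) = g.a 0 • ((Pi.single 0 1, 0) : Base) := by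
    refine Prod.ext (funext fun i => ?_) (funext fun k => ?_)
    · fin_cases i <;> simp [linear]
    · simp [linear]
  change D _ _ = _
  rw [h.D_pull, e, D_smul]
  rfl

lemma Relates.x_pull (h : g.Relates S S') (k k' : Fin 2) (f : S'.R) :
    (S.frame k k').x (h.pull f) = g.a 1 • h.pull ((S'.frame k k').x f) := by
  have e : g.linear (Pi.single 1 1, 0) = g.a 1 • ((Pi.single 1 1, 0) : Base) := by
    refine Prod.ext (funext fun i => ?_) (funext fun k => ?_)
    · fin_cases i <;> simp [linear]
    · simp [linear]
  change D _ _ = _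
  rw [h.D_pull, e, D_smul]
  rfl

lemma Relates.u_pull (h : g.Relates S S') (k k' : Fin 2) (f : S'.R) :
    (S.frame k k').u (h.pull f) = g.b k • h.pull ((S'.frame k k').u f) := by
  have e : g.linear (0, Pi.single k 1) = g.b k • ((0, Pi.single k 1) : Base) := by
    refine Prod.ext (funext fun i => ?_) (funext fun i => ?_)
    · simp [linear]
    · rcases eq_or_ne i k with rfl | hi <;> simp [linear, *]
  change D _ _ = _
  rw [h.D_pull, e, D_smul]
  rfl

lemma Relates.v_pull (h : g.Relates S S') (k k' : Fin 2) (f : S'.R) :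
    (S.frame k k').v (h.pull f) = g.b k' • h.pull ((S'.frame k k').v f) :=
  h.u_pull k' k f

lemma Relates.diffusivity_eq (h : g.Relates S S') (k : Fin 2) :
    S.diffusivity k = (g.a 0 / g.a 1 ^ 2) • h.pull (S'.diffusivity k) := by
  refine Subtype.ext (funext fun p => ?_)
  change S.d k (p.1.2 k) = g.a 0 / g.a 1 ^ 2 * S'.d k (g.dep k (p.1.2 k))
  have h3 := g.ha 0
  have h4 := g.ha 1
  rw [h.d_eq k _ ((S.mem_U.1 p.2).2 k)]
  field_simp

/-- Pulling back multiplies the partial derivatives by e₀, e₁ and the b's, the components by the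
inverses, and the diffusivities by e₀/e₁². Each determining equation is homogeneous for these
weights and only acquires a nonzero factor. -/
lemma Relates.determining (h : g.Relates S S') {k k' : Fin 2} {τ ξ η : S'.R}
    (hd : Determining (S'.frame k k') (S'.diffusivity k) (S'.diffusivity k') τ ξ η) :
    Determining (S.frame k k') (S.diffusivity k) (S.diffusivity k') ((g.a 0)⁻¹ • h.pull τ)
      ((g.a 1)⁻¹ • h.pull ξ) ((g.b k)⁻¹ • h.pull η) := by
  have h₀ := g.ha 0
  have h₁ := g.ha 1
  have h₂ := g.hb k
  have h₃ := g.hb k'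
  have z : h.pull 0 = 0 := rfl
  have val : ∀ {f g : S'.R}, f = g → ∀ p, f.1 p = g.1 p := fun h p => h ▸ rfl
  rw [h.diffusivity_eq, h.diffusivity_eq]
  constructor <;> simp only [Derivation.map_smul, h.t_pull, h.x_pull, h.u_pull, h.v_pull, hd.τx,
    hd.τu, hd.τv, hd.ξu, hd.ξv, hd.ηxv, hd.ηuu, hd.ηuv, hd.ηvv, z, smul_zero]
  all_goals
    refine Subtype.ext (funext fun p => ?_)
    set q : S'.U := ⟨g.base p, (h.mem_iff p).2 p.2⟩ with hq
  · have e : ((S'.frame k k').u (S'.diffusivity k)).1 q * η.1 q = (S'.diffusivity k).1 q *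
      (2 * ((S'.frame k k').x ξ).1 q - ((S'.frame k k').t τ).1 q) := val hd.diffusion q
    change g.a 0 / g.a 1 ^ 2 * (g.b k * ((S'.frame k k').u (S'.diffusivity k)).1 q) *
      ((g.b k)⁻¹ * η.1 q) = g.a 0 / g.a 1 ^ 2 * (S'.diffusivity k).1 q *
      (2 * ((g.a 1)⁻¹ * (g.a 1 * ((S'.frame k k').x ξ).1 q)) -
        (g.a 0)⁻¹ * (g.a 0 * ((S'.frame k k').t τ).1 q))
    field_simp
    linear_combination e
  · have e : ((S'.frame k k').t η).1 q = (S'.diffusivity k).1 q *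
      ((S'.frame k k').x ((S'.frame k k').x η)).1 q := val hd.heat q
    change (g.b k)⁻¹ * (g.a 0 * ((S'.frame k k').t η).1 q) =
      g.a 0 / g.a 1 ^ 2 * (S'.diffusivity k).1 q *
      ((g.b k)⁻¹ * (g.a 1 * (g.a 1 * ((S'.frame k k').x ((S'.frame k k').x η)).1 q)))
    field_simp
    linear_combination e
  · have e : -((S'.frame k k').t ξ).1 q =
      2 * ((S'.frame k k').u (S'.diffusivity k)).1 q * ((S'.frame k k').x η).1 q +
      2 * (S'.diffusivity k).1 q * ((S'.frame k k').x ((S'.frame k k').u η)).1 q -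
      (S'.diffusivity k).1 q * ((S'.frame k k').x ((S'.frame k k').x ξ)).1 q := val hd.drift q
    change -((g.a 1)⁻¹ * (g.a 0 * ((S'.frame k k').t ξ).1 q)) =
      2 * (g.a 0 / g.a 1 ^ 2 * (g.b k * ((S'.frame k k').u (S'.diffusivity k)).1 q)) *
        ((g.b k)⁻¹ * (g.a 1 * ((S'.frame k k').x η).1 q)) +
      2 * (g.a 0 / g.a 1 ^ 2 * (S'.diffusivity k).1 q) *
        ((g.b k)⁻¹ * (g.b k * (g.a 1 * ((S'.frame k k').x ((S'.frame k k').u η)).1 q))) -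
      g.a 0 / g.a 1 ^ 2 * (S'.diffusivity k).1 q *
        ((g.a 1)⁻¹ * (g.a 1 * (g.a 1 * ((S'.frame k k').x ((S'.frame k k').x ξ)).1 q)))
    field_simp
    linear_combination e
  · have e : ((S'.frame k k').v η).1 q *
      ((S'.diffusivity k').1 q - (S'.diffusivity k).1 q) = 0 := val hd.coupling q
    change (g.b k)⁻¹ * (g.b k' * ((S'.frame k k').v η).1 q) *
      (g.a 0 / g.a 1 ^ 2 * (S'.diffusivity k').1 q -
        g.a 0 / g.a 1 ^ 2 * (S'.diffusivity k).1 q) = 0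
    linear_combination (g.b k)⁻¹ * g.b k' * (g.a 0 / g.a 1 ^ 2) * e

lemma Relates.pullback_isSymm (h : g.Relates S S') {X : Operator} (hX : S'.IsSymm X) :
    S.IsSymm (g.pullback X) := by
  obtain ⟨τ, ξ, η, hc⟩ := HeatData.exists_components hX.1
  have hc' : S.Components (g.pullback X) ((g.a 0)⁻¹ • h.pull τ) ((g.a 1)⁻¹ • h.pull ξ)
      fun k => (g.b k)⁻¹ • h.pull (η k) :=
    ⟨fun p => (div_eq_inv_mul _ _).trans
        (congrArg (_ * ·) (hc.t ⟨g.base p, (h.mem_iff p).2 p.2⟩)),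
      fun p => (div_eq_inv_mul _ _).trans
        (congrArg (_ * ·) (hc.x ⟨g.base p, (h.mem_iff p).2 p.2⟩)),
      fun k p => (div_eq_inv_mul _ _).trans
        (congrArg (_ * ·) (hc.dep k ⟨g.base p, (h.mem_iff p).2 p.2⟩))⟩
  exact hc'.isSymm_iff.2 fun k k' hk => h.determining (hc.isSymm_iff.1 hX k k' hk)

lemma span_pullbackOps (g : EquivTransf) (O : BasicOperators) :
    (g.pullbackOps O).span = O.span.map g.pullbackLinear := by
  rw [BasicOperators.span, BasicOperators.span, Submodule.map_span, image_union]
  congr 2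
  ext X
  simp [pullbackOps, pullbackLinear]

/-- Equivalence transformations carry the maximal algebra of invariance along. -/
lemma Relates.isMaximal (h : g.Relates S S') {O : BasicOperators} (hO : S'.IsMaximal O) :
    S.IsMaximal (g.pullbackOps O) := by
  have hsym : ∀ X ∈ (g.pullbackOps O).span, S.IsSymm X := by
    rw [span_pullbackOps]
    rintro _ ⟨X, hX, rfl⟩
    exact h.pullback_isSymm (hO.symmetry X hX)
  refine HeatData.isMaximal_of (fun X hX => hsym X (Submodule.subset_span (Or.inl hX)))
    (fun X hX => hsym X (Submodule.subset_span (Or.inr hX))) (fun X hX => ?_) fun c Z hZ he => ?_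
  -- A symmetry is moved to the new variables by the inverse transformation, expressed there by the
  -- listed operators, and moved back.
  · obtain ⟨Y, hY, e⟩ := hO.maximal _ (h.inv.pullback_isSymm hX)
    refine ⟨g.pullback Y, ?_, fun p hp => ?_⟩
    · rw [span_pullbackOps]
      exact ⟨Y, hY, rfl⟩
    · apply g.linear_injective
      rw [linear_pullback, ← e ((h.mem_iff p).2 hp), pullback_inv_apply]
  · have hlen : (g.pullbackOps O).fin.length = O.fin.length := List.length_map _
    obtain ⟨Z', hZ', rfl⟩ : ∃ Z' ∈ Submodule.span ℝ O.inf, g.pullbackLinear Z' = Z := by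
      have e : (g.pullbackOps O).inf = g.pullbackLinear '' O.inf := rfl
      rwa [e, ← Submodule.map_span] at hZ
    have e : ∑ i, c i • (g.pullbackOps O).fin.get i + g.pullbackLinear Z' =
        g.pullbackLinear (∑ i, c (Fin.cast hlen.symm i) • O.fin.get i + Z') := by
      rw [map_add, map_sum]
      congr 1
      refine Fintype.sum_equiv (finCongr hlen) _ _ fun i => ?_
      have hi : (g.pullbackOps O).fin.get i = g.pullback (O.fin.get (Fin.cast hlen i)) :=
        List.getElem_map _
      rw [hi, map_smul]
      rfl
    have h0 := hO.independent (fun i => c (Fin.cast hlen.symm i)) Z' hZ' fun q hq => by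
      have hp : g.inv.base q ∈ S.U := (h.mem_iff _).1 (by rwa [base_inv])
      have h1 := he hp
      rw [e] at h1
      have h2 := congrArg g.linear h1
      change g.linear (g.pullback _ _) = g.linear 0 at h2
      rwa [linear_pullback, base_inv, map_zero] at h2
    funext i
    exact congrFun h0 (Fin.cast hlen i)

end EquivTransf

namespace HeatData

variable {S : HeatData}

/-! Components of operators. -/

lemma Components.add {X X' : Operator} {τ ξ τ' ξ' : S.R} {η η' : Fin 2 → S.R}
    (h : S.Components X τ ξ η) (h' : S.Components X' τ' ξ' η') :
    S.Components (X + X') (τ + τ') (ξ + ξ') (η + η') :=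
  ⟨fun p => congrArg₂ (· + ·) (h.t p) (h'.t p), fun p => congrArg₂ (· + ·) (h.x p) (h'.x p),
    fun k p => congrArg₂ (· + ·) (h.dep k p) (h'.dep k p)⟩

lemma Components.smul {X : Operator} {τ ξ : S.R} {η : Fin 2 → S.R}
    (h : S.Components X τ ξ η) (c : ℝ) : S.Components (c • X) (c • τ) (c • ξ) (c • η) :=
  ⟨fun p => congrArg (c * ·) (h.t p), fun p => congrArg (c * ·) (h.x p),
    fun k p => congrArg (c * ·) (h.dep k p)⟩

lemma Components.zero : S.Components 0 0 0 0 := ⟨fun _ => rfl, fun _ => rfl, fun _ _ => rfl⟩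

lemma Components.eq_zero {X : Operator} {τ ξ : S.R} {η : Fin 2 → S.R}
    (h : S.Components X τ ξ η) (h0 : EqOn X 0 S.U) : τ = 0 ∧ ξ = 0 ∧ ∀ k, η k = 0 := by
  refine ⟨?_, ?_, fun k => ?_⟩ <;> refine Subtype.ext (funext fun p => ?_)
  · rw [← h.t p, h0 p.2]; rfl
  · rw [← h.x p, h0 p.2]; rfl
  · rw [← h.dep k p, h0 p.2]; rfl

lemma Components.eqOn {X Y : Operator} {τ ξ τ' ξ' : S.R} {η η' : Fin 2 → S.R}
    (h : S.Components X τ ξ η) (h' : S.Components Y τ' ξ' η') (hτ : τ = τ') (hξ : ξ = ξ')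
    (hη : ∀ k, η k = η' k) : EqOn X Y S.U := by
  subst hτ hξ
  intro p hp
  refine Prod.ext (funext fun i => ?_) (funext fun k => ?_)
  · fin_cases i
    · exact (h.t ⟨p, hp⟩).trans (h'.t ⟨p, hp⟩).symm
    · exact (h.x ⟨p, hp⟩).trans (h'.x ⟨p, hp⟩).symm
  · rw [h.dep k ⟨p, hp⟩, h'.dep k ⟨p, hp⟩, hη k]

/-! Derivatives of the coordinates. -/

variable (S) in
lemma t_indepVar (k k' i : Fin 2) :
    (S.frame k k').t (S.indepVar i) = if i = 0 then 1 else 0 := by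
  change D _ _ = _
  rw [D_indepVar]; fin_cases i <;> simp

variable (S) in
lemma x_indepVar (k k' i : Fin 2) :
    (S.frame k k').x (S.indepVar i) = if i = 1 then 1 else 0 := by
  change D _ _ = _
  rw [D_indepVar]; fin_cases i <;> simp

variable (S) in
lemma u_indepVar (k k' i : Fin 2) : (S.frame k k').u (S.indepVar i) = 0 := by
  change D _ _ = _
  rw [D_indepVar]; simp

variable (S) in
lemma v_indepVar (k k' i : Fin 2) : (S.frame k k').v (S.indepVar i) = 0 := S.u_indepVar k' k i

variable (S) in
lemma t_depVar (k k' l : Fin 2) : (S.frame k k').t (S.depVar l) = 0 := by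
  change D _ _ = _
  rw [D_depVar]; simp

variable (S) in
lemma x_depVar (k k' l : Fin 2) : (S.frame k k').x (S.depVar l) = 0 := by
  change D _ _ = _
  rw [D_depVar]; simp

variable (S) in
lemma u_depVar (k k' l : Fin 2) :
    (S.frame k k').u (S.depVar l) = if l = k then 1 else 0 := by
  change D _ _ = _
  rw [D_depVar]; rcases eq_or_ne l k with rfl | h <;> simp [*]

variable (S) in
lemma v_depVar (k k' l : Fin 2) :
    (S.frame k k').v (S.depVar l) = if l = k' then 1 else 0 := S.u_depVar k' k l

/-! Consequences of the determining equations. -/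

variable (S) in
/-- The diffusivity of the `k`-th equation is not constant. -/
def Nonconstant (k : Fin 2) : Prop := ∃ w ∈ S.K k, deriv (S.d k) w ≠ 0

lemma nonconstant_of_not {k : Fin 2} (h : ¬ ∃ c, ∀ w ∈ S.K k, S.d k w = c) : S.Nonconstant k := by
  by_contra hc
  refine h ((S.isOpen_K k).exists_is_const_of_deriv_eq_zero (S.isConnected_K k).isPreconnected
    ((S.smooth_d k).differentiableOn (by simp)) fun w hw => ?_)
  by_contra h0
  exact hc ⟨w, hw, h0⟩

/-- The point that differs from `p` in the `k`-th dependent variable only. -/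
def move (p : S.U) (k : Fin 2) {w : ℝ} (hw : w ∈ S.K k) : S.U :=
  ⟨(p.1.1, Function.update p.1.2 k w), S.mem_U.2 ⟨(S.mem_U.1 p.2).1, fun i => by
    rcases eq_or_ne i k with rfl | hi
    · simpa using hw
    · simpa [hi] using (S.mem_U.1 p.2).2 i⟩⟩

lemma apply_move {k k' : Fin 2} {f : S.R} (hf : (S.frame k k').u f = 0) (p : S.U) {w : ℝ}
    (hw : w ∈ S.K k) : f.1 (move p k hw) = f.1 p :=
  S.apply_eq_of_D_eq_zero hf rfl fun i hi => by simp [move, hi]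

/-- The factor f does not depend on the k-th variable, so at any point that variable may be moved to
a value where the derivative of the diffusivity is nonzero. This replaces division by a′, which may
have zeros. -/
lemma Nonconstant.eq_zero {k k' : Fin 2} (hn : S.Nonconstant k) {f : S.R}
    (hf : (S.frame k k').u f = 0) (h : (S.frame k k').u (S.diffusivity k) * f = 0) : f = 0 := by
  obtain ⟨w, hw, hw0⟩ := hn
  refine Subtype.ext (funext fun p => ?_)
  have e : ((S.frame k k').u (S.diffusivity k)).1 (move p k hw) * f.1 (move p k hw) = 0 :=
    congrFun (congrArg Subtype.val h) (move p k hw)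
  rw [u_diffusivity, apply_move hf] at e
  have e' : deriv (S.d k) w * f.1 p = 0 := by
    simpa [ofDep, move] using e
  exact (mul_eq_zero.1 e').resolve_left hw0

/-- The ring of functions has zero divisors but is reduced, so a repeated factor may be dropped. -/
lemma eq_zero_of_mul_mul_self {a f : S.R} (h : a * (a * f) = 0) : a * f = 0 := by
  refine Subtype.ext (funext fun p => ?_)
  have e : a.1 p * (a.1 p * f.1 p) = 0 := congrFun (congrArg Subtype.val h) p
  change a.1 p * f.1 p = 0
  rcases mul_eq_zero.1 e with h | h
  · rw [h, zero_mul]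
  · exact h

section Solve

variable {k k' : Fin 2} {τ ξ η : S.R}

/-- Differentiating a′η = a(2ξ_x − τ_t) in x and inserting the result into `drift` gives −ξ_t =
a(3ξ_xx + 2η_xu). Only a depends on u here, so nonconstancy makes both sides vanish. The heat
equation, differentiated in u, then reads 2η_tu = aξ_xxx, which gives ξ_xxx = 0 in the same way.
Finally the t-derivative of the first equation leaves aτ_tt = 0. -/
lemma Nonconstant.determining (hk : k ≠ k') (hn : S.Nonconstant k)
    (h : Determining (S.frame k k') (S.diffusivity k) (S.diffusivity k') τ ξ η) :
    (S.frame k k').t ((S.frame k k').t τ) = 0 ∧ (S.frame k k').t ξ = 0 ∧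
    (S.frame k k').x ((S.frame k k').x ((S.frame k k').x ξ)) = 0 ∧
    3 * (S.frame k k').x ((S.frame k k').x ξ) + 2 * (S.frame k k').x ((S.frame k k').u η) = 0 := by
  have hab := S.coefficients hk
  have hz : ∀ {f}, (S.frame k k').u f = 0 → (S.frame k k').u (S.diffusivity k) * f = 0 → f = 0 :=
    fun hf h => hn.eq_zero hf h
  generalize S.frame k k' = F at *
  generalize S.diffusivity k = a at *
  generalize S.diffusivity k' = b at *
  have uat : F.t (F.u a) = 0 := by rw [← F.u_t, hab.ta, map_zero]
  have uax : F.x (F.u a) = 0 := by rw [← F.u_x, hab.xa, map_zero]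
  have d₁ := congrArg F.t h.diffusion
  have d₂ := congrArg F.x h.diffusion
  have d₃ := congrArg F.x d₂
  simp only [Derivation.leibniz, smul_eq_mul, map_sub, F.x_t, h.τx, hab.xa, hab.ta, uat, uax,
    derivation_two, map_zero, mul_zero, add_zero, sub_zero] at d₁ d₂ d₃
  have e : -F.t ξ = a * (3 * F.x (F.x ξ) + 2 * F.x (F.u η)) := by
    linear_combination h.drift + 2 * d₂
  have e₁ := congrArg F.u e
  simp only [Derivation.leibniz, smul_eq_mul, map_add, map_neg, F.u_t, F.u_x, h.ξu, h.ηuu,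
    derivation_two, map_zero, mul_zero, add_zero, neg_zero] at e₁
  have c₁ : 3 * F.x (F.x ξ) + 2 * F.x (F.u η) = 0 := by
    refine hz ?_ ?_
    · have h3 : F.u 3 = 0 := by exact_mod_cast F.u.map_natCast 3
      simp [F.u_x, h.ξu, h.ηuu, derivation_two, h3]
    · have h3 : F.u 3 = 0 := by exact_mod_cast F.u.map_natCast 3
      rw [h3] at e₁
      linear_combination -e₁
  have c₂ : F.t ξ = 0 := by linear_combination -e - a * c₁
  have c₁' := congrArg F.x c₁
  have h3 : F.x 3 = 0 := by exact_mod_cast F.x.map_natCast 3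
  have d₄ := congrArg F.u h.heat
  simp only [Derivation.leibniz, smul_eq_mul, map_add, F.u_t, F.u_x, h3, derivation_two, map_zero,
    mul_zero, add_zero] at c₁' d₄
  have d₅ : 2 * F.t (F.u η) = a * F.x (F.x (F.x ξ)) := by
    linear_combination 2 * d₄ + 2 * d₃ + a * c₁'
  have d₆ := congrArg F.u d₅
  simp only [Derivation.leibniz, smul_eq_mul, F.u_t, F.u_x, h.ξu, h.ηuu, derivation_two, map_zero,
    mul_zero, add_zero, zero_add] at d₆
  have c₃ : F.x (F.x (F.x ξ)) = 0 := by
    refine hz ?_ ?_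
    · simp [F.u_x, h.ξu]
    · linear_combination -d₆
  refine ⟨?_, c₂, c₃, c₁⟩
  refine eq_zero_of_isUnit_mul hab.unit_a ?_
  have d₇ : F.t (F.x ξ) = 0 := by rw [← F.x_t, c₂, map_zero]
  linear_combination d₁ - F.u a * h.heat - a * d₃ + 2 * a * d₇ - 2 * a ^ 2 * c₃

/-- Here a′η = 0. Differentiating in u and multiplying by a′ gives a′²η_u = 0, so η_u = 0, because
η_u is independent of u. Then η itself is independent of u, and the same argument applies to it. -/
lemma Nonconstant.eq_zero_of_determining (hn : S.Nonconstant k)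
    (h : Determining (S.frame k k') (S.diffusivity k) (S.diffusivity k') τ ξ η)
    (hl : 2 * (S.frame k k').x ξ - (S.frame k k').t τ = 0) : η = 0 := by
  have e : (S.frame k k').u (S.diffusivity k) * η = 0 := by rw [h.diffusion, hl, mul_zero]
  have e₁ := congrArg (S.frame k k').u e
  simp only [Derivation.leibniz, smul_eq_mul, map_zero] at e₁
  have c : (S.frame k k').u (S.diffusivity k) * (S.frame k k').u η = 0 := by
    refine eq_zero_of_mul_mul_self ?_
    linear_combination (S.frame k k').u (S.diffusivity k) * e₁ -
      (S.frame k k').u ((S.frame k k').u (S.diffusivity k)) * e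
  exact hn.eq_zero (hn.eq_zero h.ηuu c) e

/-- Since η_v a′ = 0 and η_v b′ = 0, with η_v independent of u and of v, a single nonconstant
diffusivity suffices. -/
lemma Nonconstant.v_eq_zero (hk : k ≠ k') (hn : S.Nonconstant k ∨ S.Nonconstant k')
    (h : Determining (S.frame k k') (S.diffusivity k) (S.diffusivity k') τ ξ η) :
    (S.frame k k').v η = 0 := by
  rcases hn with hn | hn
  · refine hn.eq_zero h.ηuv ?_
    rw [mul_comm]; exact h.ua (S.coefficients hk)
  · refine hn.eq_zero (k' := k) h.ηvv ?_
    rw [mul_comm]; exact h.vb (S.coefficients hk)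

/-- The x-derivative of 2ξ_x = τ_t gives ξ_xx = 0; with ξ_t = 0 the function ξ_x is a constant, and
the domain being connected both components integrate to those of A. -/
lemma eq_of_uniform (hk : k ≠ k')
    (h : Determining (S.frame k k') (S.diffusivity k) (S.diffusivity k') τ ξ η)
    (hξt : (S.frame k k').t ξ = 0)
    (hl : 2 * (S.frame k k').x ξ - (S.frame k k').t τ = 0) :
    ∃ c₀ c₁ c₂ : ℝ, τ = algebraMap ℝ S.R c₀ + algebraMap ℝ S.R c₂ * (2 * S.indepVar 0) ∧
      ξ = algebraMap ℝ S.R c₁ + algebraMap ℝ S.R c₂ * S.indepVar 1 := by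
  have hxt := (S.frame k k').x_t
  have hut := (S.frame k k').u_t
  have hvt := (S.frame k k').v_t
  have hux := (S.frame k k').u_x
  have hvx := (S.frame k k').v_x
  have hxx : (S.frame k k').x ((S.frame k k').x ξ) = 0 := by
    have e := congrArg (S.frame k k').x hl
    simp only [map_sub, Derivation.leibniz, smul_eq_mul, derivation_two, hxt, h.τx, map_zero,
      mul_zero, add_zero, sub_zero] at e
    exact eq_zero_of_isUnit_mul isUnit_two e
  obtain ⟨c₂, h₂⟩ := S.exists_eq_algebraMap hk (f := (S.frame k k').x ξ)
    (by rw [← hxt, hξt, map_zero]) hxx (by rw [hux, h.ξu, map_zero]) (by rw [hvx, h.ξv, map_zero])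
  obtain ⟨c₁, h₁⟩ := S.exists_eq_algebraMap hk (f := ξ - algebraMap ℝ S.R c₂ * S.indepVar 1)
    (by simp [hξt, t_indepVar]) (by simp [h₂, x_indepVar]) (by simp [h.ξu, u_indepVar])
    (by simp [h.ξv, v_indepVar])
  obtain ⟨c₀, h₀⟩ := S.exists_eq_algebraMap hk (f := τ - algebraMap ℝ S.R c₂ * (2 * S.indepVar 0))
    (by
      simp [t_indepVar, derivation_two]
      linear_combination -hl + 2 * h₂)
    (by simp [h.τx, x_indepVar, derivation_two]) (by simp [h.τu, u_indepVar, derivation_two])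
    (by simp [h.τv, v_indepVar, derivation_two])
  exact ⟨c₀, c₁, c₂, by linear_combination h₀, by linear_combination h₁⟩

/-- If some symmetry changes the ratio of the scales of `x²` and `t`, then the diffusivities are
exponentials or powers of affine functions. -/
lemma exists_affine (h : Determining (S.frame k k') (S.diffusivity k) (S.diffusivity k') τ ξ η)
    (hl : 2 * (S.frame k k').x ξ - (S.frame k k').t τ ≠ 0) :
    ∃ p q : ℝ, ∀ w ∈ S.K k, deriv (S.d k) w * (p * w + q) = 2 * S.d k w := by
  obtain ⟨p, hp⟩ : ∃ p, (2 * (S.frame k k').x ξ - (S.frame k k').t τ).1 p ≠ 0 := by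
    by_contra hc
    push Not at hc
    exact hl (Subtype.ext (funext hc))
  set l := (2 * (S.frame k k').x ξ - (S.frame k k').t τ) with hldef
  have lu : (S.frame k k').u l = 0 := by
    simp [hldef, (S.frame k k').u_x, (S.frame k k').u_t, h.ξu, h.τu, derivation_two]
  have ηu : (S.frame k k').u (η - (S.frame k k').u η * S.depVar k) = 0 := by
    simp [h.ηuu, u_depVar]
  -- With all other variables frozen at a point where l = 2ξ_x − τ_t ≠ 0, η is an affine function of
  -- w. Dividing a′η = a·l by l/2 yields p and q.
  refine ⟨2 * ((S.frame k k').u η).1 p / l.1 p,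
    2 * (η - (S.frame k k').u η * S.depVar k).1 p / l.1 p, fun w hw => ?_⟩
  have e : ((S.frame k k').u (S.diffusivity k)).1 (move p k hw) * η.1 (move p k hw) =
      (S.diffusivity k).1 (move p k hw) * l.1 (move p k hw) :=
    congrFun (congrArg Subtype.val h.diffusion) (move p k hw)
  have e₁ := apply_move ηu p hw
  have e₂ := apply_move h.ηuu p hw
  rw [apply_move lu, u_diffusivity] at e
  have hw' : (S.depVar k).1 (move p k hw) = w := by simp [depVar, move]
  have e₁' : η.1 (move p k hw) - ((S.frame k k').u η).1 (move p k hw) *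
    (S.depVar k).1 (move p k hw) = (η - (S.frame k k').u η * S.depVar k).1 p := e₁
  rw [hw', e₂] at e₁'
  have e' : deriv (S.d k) w * η.1 (move p k hw) = S.d k w * l.1 p := by
    simpa [ofDep, move, diffusivity] using e
  field_simp
  rw [← e₁']
  linear_combination e'

end Solve

end HeatData

/-! The operators of the table, in a form that treats the dependent variables alike. -/

/-- `∂_t` -/
def opTime : Operator :=
  op (fun _ _ _ _ => 1) (fun _ _ _ _ => 0) (fun _ _ _ _ => 0) (fun _ _ _ _ => 0)

/-- `∂_x` -/
def opSpace : Operator :=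
  op (fun _ _ _ _ => 0) (fun _ _ _ _ => 1) (fun _ _ _ _ => 0) (fun _ _ _ _ => 0)

/-- `2t ∂_t + x ∂_x` -/
def opDilation : Operator :=
  op (fun t _ _ _ => 2 * t) (fun _ x _ _ => x) (fun _ _ _ _ => 0) (fun _ _ _ _ => 0)

lemma opsA_eq : opsA = [opTime, opSpace, opDilation] := rfl

/-- `x ∂_x + (p₀ u + q₀) ∂_u + (p₁ v + q₁) ∂_v` -/
def opScaling (p q : Fin 2 → ℝ) : Operator :=
  op (fun _ _ _ _ => 0) (fun _ x _ _ => x) (fun _ _ u _ => p 0 * u + q 0)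
    (fun _ _ _ v => p 1 * v + q 1)

/-- The operator `w ∂_{w'}`, where `w` is the `l`-th and `w'` the `k`-th dependent variable. -/
def opLinear (k l : Fin 2) : Operator := fun p => (0, Pi.single k (p.2 l))

/-- The operators `α(t, x) ∂_w` with `α_t = κ α_xx`, where `w` is the `k`-th dependent variable. -/
def heatOps (k : Fin 2) (Ω : Set (Fin 2 → ℝ)) (κ : ℝ) : Set Operator :=
  {X | ∃ α, IsHeatSolution Ω κ α ∧ X = fun p => (0, Pi.single k (α p.1))}

lemma opUU_eq : opUU = opLinear 0 0 := by
  funext p; ext i <;> fin_cases i <;> simp [opUU, opLinear, op]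

lemma opVV_eq : opVV = opLinear 1 1 := by
  funext p; ext i <;> fin_cases i <;> simp [opVV, opLinear, op]

lemma opVU_eq : opVU = opLinear 0 1 := by
  funext p; ext i <;> fin_cases i <;> simp [opVU, opLinear, op]

lemma opUV_eq : opUV = opLinear 1 0 := by
  funext p; ext i <;> fin_cases i <;> simp [opUV, opLinear, op]

lemma eta_two (z : Fin 2 → ℝ) : ![z 0, z 1] = z := by ext i; fin_cases i <;> rfl

lemma heatOpsU_eq (Ω : Set (Fin 2 → ℝ)) (κ : ℝ) : heatOpsU Ω κ = heatOps 0 Ω κ := by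
  ext X
  refine exists_congr fun α => and_congr_right fun _ => ?_
  rw [show (op (fun _ _ _ _ => 0) (fun _ _ _ _ => 0) (fun t x _ _ => α ![t, x])
    (fun _ _ _ _ => 0)) = fun p => (0, Pi.single 0 (α p.1)) from ?_]
  funext p; ext i <;> fin_cases i <;> simp [op, eta_two]

lemma heatOpsV_eq (Ω : Set (Fin 2 → ℝ)) (κ : ℝ) : heatOpsV Ω κ = heatOps 1 Ω κ := by
  ext X
  refine exists_congr fun α => and_congr_right fun _ => ?_
  rw [show (op (fun _ _ _ _ => 0) (fun _ _ _ _ => 0) (fun _ _ _ _ => 0)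
    (fun t x _ _ => α ![t, x])) = fun p => (0, Pi.single 1 (α p.1)) from ?_]
  funext p; ext i <;> fin_cases i <;> simp [op, eta_two]

lemma BasicOperators.mem_span_of_mem_fin {O : BasicOperators} {X : Operator} (h : X ∈ O.fin) :
    X ∈ O.span := Submodule.subset_span (Or.inl h)

lemma BasicOperators.mem_span_of_mem_inf {O : BasicOperators} {X : Operator} (h : X ∈ O.inf) :
    X ∈ O.span := Submodule.subset_span (Or.inr h)

lemma derivation_ofNat {R : Type*} [CommRing R] [Algebra ℝ R] (D : Derivation ℝ R R) (n : ℕ)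
    [n.AtLeastTwo] : D (ofNat(n) : R) = 0 := D.map_natCast n

namespace HeatData

variable {S : HeatData}

local notation "C" => algebraMap ℝ S.R

lemma components_time : S.Components opTime 1 0 0 :=
  ⟨fun _ => rfl, fun _ => rfl, fun k _ => by fin_cases k <;> rfl⟩

lemma components_space : S.Components opSpace 0 1 0 :=
  ⟨fun _ => rfl, fun _ => rfl, fun k _ => by fin_cases k <;> rfl⟩

lemma components_dilation :
    S.Components opDilation (2 * S.indepVar 0) (S.indepVar 1) 0 :=
  ⟨fun _ => rfl, fun _ => rfl, fun k _ => by fin_cases k <;> rfl⟩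

lemma components_scaling (p q : Fin 2 → ℝ) : S.Components (opScaling p q) 0 (S.indepVar 1)
    fun k => C (p k) * S.depVar k + C (q k) :=
  ⟨fun _ => rfl, fun _ => rfl, fun k _ => by fin_cases k <;> rfl⟩

lemma components_conformal : S.Components opConformal 0 (S.indepVar 1 ^ 2)
    fun k => -3 * S.indepVar 1 * S.depVar k :=
  ⟨fun _ => rfl, fun _ => rfl, fun k _ => by fin_cases k <;> rfl⟩

lemma components_galilei (κ : Fin 2 → ℝ) : S.Components (opGalilei (κ 0) (κ 1)) 0
    (2 * S.indepVar 0) fun k => -S.indepVar 1 * (C (1 / κ k) * S.depVar k) :=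
  ⟨fun _ => rfl, fun _ => rfl, fun k _ => by fin_cases k <;> rfl⟩

lemma components_projective (κ : Fin 2 → ℝ) : S.Components (opProjective (κ 0) (κ 1))
    (4 * S.indepVar 0 ^ 2) (4 * S.indepVar 0 * S.indepVar 1)
    fun k => -C (1 / κ k) * (S.indepVar 1 ^ 2 + 2 * C (κ k) * S.indepVar 0) * S.depVar k :=
  ⟨fun _ => rfl, fun _ => rfl, fun k _ => by fin_cases k <;> rfl⟩

lemma components_single (k : Fin 2) {f : Base → ℝ} {g : S.R} (h : ∀ p : S.U, f p = g.1 p) :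
    S.Components (fun p => (0, Pi.single k (f p))) 0 0 (Pi.single k g) :=
  ⟨fun _ => rfl, fun _ => rfl, fun l p => by
    rcases eq_or_ne l k with rfl | hl
    · simpa using h p
    · simp [hl]⟩

lemma components_linear (k l : Fin 2) :
    S.Components (opLinear k l) 0 0 (Pi.single k (S.depVar l)) :=
  components_single k fun _ => rfl

/-! Functions of `(t, x)`. -/

lemma pderiv_slice {F : Base → ℝ} (hF : ContDiffOn ℝ ∞ F S.U) {q : S.U} {z : Fin 2 → ℝ}
    (hz : z ∈ S.Ω) (i : Fin 2) :
    pderiv i (fun z => F (z, q.1.2)) z = fderiv ℝ F (z, q.1.2) (Pi.single i 1, 0) := by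
  have hp : (z, q.1.2) ∈ S.U := S.mem_U.2 ⟨hz, (S.mem_U.1 q.2).2⟩
  have h := HasFDerivAt.comp (g := F) (f := fun z => (z, q.1.2)) z
    (differentiableAt_of_contDiffOn hF hp).hasFDerivAt (hasFDerivAt_prodMk_left z q.1.2)
  exact congrArg (fun A : (Fin 2 → ℝ) →L[ℝ] ℝ => A (Pi.single i 1)) h.fderiv

/-- The solutions of the linear heat equation, as functions on the domain of the system. -/
lemma exists_isHeatSolution {k k' : Fin 2} (hk : k ≠ k') {f : S.R} {κ : ℝ}
    (hu : (S.frame k k').u f = 0)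
    (hv : (S.frame k k').v f = 0)
    (h : (S.frame k k').t f = C κ * (S.frame k k').x ((S.frame k k').x f)) :
    ∃ α, IsHeatSolution S.Ω κ α ∧ ∀ p : S.U, α p.1.1 = f.1 p := by
  obtain ⟨q⟩ := (inferInstance : Nonempty S.U)
  obtain ⟨F, hF, rfl⟩ := exists_res f
  have hmem : ∀ z ∈ S.Ω, (z, q.1.2) ∈ S.U := fun z hz => S.mem_U.2 ⟨hz, (S.mem_U.1 q.2).2⟩
  -- The solution on Ω is the slice of f at one fixed value of the dependent variables; the choice
  -- is immaterial because f does not depend on them.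
  refine ⟨fun z => F (z, q.1.2), ⟨hF.comp (by fun_prop) hmem, fun z hz => ?_⟩, fun p => ?_⟩
  · have e : ((S.frame k k').t (res F hF)).1 ⟨_, hmem z hz⟩ =
        κ * ((S.frame k k').x ((S.frame k k').x (res F hF))).1 ⟨_, hmem z hz⟩ :=
      congrFun (congrArg Subtype.val h) ⟨_, hmem z hz⟩
    have e₁ : (S.frame k k').x (res F hF) = res _ (contDiffOn_fderiv_apply hF _) := D_res _ F hF
    have e₂ : EqOn (pderiv 1 fun z => F (z, q.1.2))
        (fun z => fderiv ℝ F (z, q.1.2) (Pi.single 1 1, 0)) S.Ω :=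
      fun z hz => pderiv_slice hF hz 1
    rw [pderiv_slice hF hz]
    rw [pderiv, fderiv_eq_of_eqOn (U := ⟨S.Ω, S.isOpen_Ω⟩) e₂ hz]
    change _ = κ * pderiv 1 _ z
    rw [pderiv_slice (F := fun p => fderiv ℝ F p (Pi.single 1 1, 0))
      (contDiffOn_fderiv_apply hF _) hz]
    rw [e₁] at e
    change (D _ (res F hF)).1 _ = κ * (D _ (res _ _)).1 _ at e
    rwa [D_res_apply, D_res_apply] at e
  · have hq : (p.1.1, q.1.2) ∈ S.U := hmem _ (S.mem_U.1 p.2).1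
    have hm : (p.1.1, Function.update q.1.2 k (p.1.2 k)) ∈ S.U :=
      (move ⟨_, hq⟩ k ((S.mem_U.1 p.2).2 k)).2
    -- The two dependent variables are moved one at a time, each within its interval.
    have e₁ := S.apply_eq_of_D_eq_zero (p := ⟨_, hq⟩) (q := ⟨_, hm⟩) hu rfl
      fun i hi => by simp [hi]
    have e₂ := S.apply_eq_of_D_eq_zero (p := ⟨_, hm⟩) (q := p) hv rfl fun i hi => by
      obtain rfl := (eq_or_eq_of_ne hk i).resolve_right hi
      simp
    exact e₁.trans e₂

lemma exists_components_heat (k : Fin 2) {κ : ℝ} {α : (Fin 2 → ℝ) → ℝ}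
    (h : IsHeatSolution S.Ω κ α) :
    ∃ f : S.R, S.Components (fun p => (0, Pi.single k (α p.1))) 0 0 (Pi.single k f) ∧
      ∀ l l', (S.frame l l').u f = 0 ∧ (S.frame l l').v f = 0 ∧
        (S.frame l l').t f = C κ * (S.frame l l').x ((S.frame l l').x f) := by
  have hfst : MapsTo Prod.fst (S.U : Set Base) S.Ω := fun p hp => (S.mem_U.1 hp).1
  have lift : ∀ {β : (Fin 2 → ℝ) → ℝ}, ContDiffOn ℝ ∞ β S.Ω →
      ContDiffOn ℝ ∞ (fun p : Base => β p.1) S.U := fun hβ => hβ.comp contDiffOn_fst hfst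
  have smooth : ∀ {β : (Fin 2 → ℝ) → ℝ}, ContDiffOn ℝ ∞ β S.Ω → ∀ e : Fin 2 → ℝ,
      ContDiffOn ℝ ∞ (fun z => fderiv ℝ β z e) S.Ω := fun hβ e =>
    contDiffOn_fderiv_apply (U := ⟨S.Ω, S.isOpen_Ω⟩) hβ e
  have key : ∀ {β : (Fin 2 → ℝ) → ℝ} (hβ : ContDiffOn ℝ ∞ β S.Ω) (e : Base),
      D e (res (U := S.U) (fun p => β p.1) (lift hβ)) =
        res (fun p => fderiv ℝ β p.1 e.1) (lift (smooth hβ e.1)) := by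
    intro β hβ e
    refine D_res_of_hasFDerivAt e _ _ _ _ (fun p => (fderiv ℝ β p.1).comp
      (ContinuousLinearMap.fst ℝ _ _)) (fun p hp => ?_) fun p hp => rfl
    exact (differentiableAt_of_contDiffOn (U := ⟨S.Ω, S.isOpen_Ω⟩) hβ
      (hfst hp)).hasFDerivAt.comp p hasFDerivAt_fst
  refine ⟨res (fun p => α p.1) (lift h.1), components_single k fun _ => rfl,
    fun l l' => ⟨?_, ?_, ?_⟩⟩
  · change D _ _ = _
    rw [key h.1]
    exact Subtype.ext (funext fun p => map_zero _)
  · change D _ _ = _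
    rw [key h.1]
    exact Subtype.ext (funext fun p => map_zero _)
  · change D _ _ = _ * D _ (D _ _)
    rw [key h.1, key h.1, key (smooth h.1 _)]
    exact Subtype.ext (funext fun p => h.2 _ (hfst p.2))

lemma C_mul_inv {κ : ℝ} (hκ : κ ≠ 0) : C κ * C (1 / κ) = 1 := by
  rw [← map_mul, mul_one_div_cancel hκ, map_one]

/-! Verification of the determining equations. -/

lemma isSymm_time : S.IsSymm opTime :=
  components_time.isSymm_iff.2 fun k k' _ => by constructor <;> simp

lemma isSymm_space : S.IsSymm opSpace :=
  components_space.isSymm_iff.2 fun k k' _ => by constructor <;> simp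

lemma isSymm_dilation : S.IsSymm opDilation :=
  components_dilation.isSymm_iff.2 fun k k' _ => by
    constructor <;> simp [t_indepVar, x_indepVar, u_indepVar, v_indepVar, derivation_ofNat]

lemma forall_mem_opsA {X : Operator} (hX : X ∈ opsA) : S.IsSymm X := by
  rw [opsA_eq] at hX
  simp only [List.mem_cons, List.not_mem_nil, or_false] at hX
  rcases hX with rfl | rfl | rfl
  exacts [isSymm_time, isSymm_space, isSymm_dilation]

variable (S) in
/-- The logarithmic derivatives of the diffusivities are `2 / (pₖ w + qₖ)`. -/
def IsScaling (p q : Fin 2 → ℝ) : Prop :=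
  ∀ k, ∀ w ∈ S.K k, deriv (S.d k) w * (p k * w + q k) = 2 * S.d k w

lemma IsScaling.mul_eq {p q : Fin 2 → ℝ} (h : S.IsScaling p q) (k k' : Fin 2) :
    (S.frame k k').u (S.diffusivity k) * (C (p k) * S.depVar k + C (q k)) =
      2 * S.diffusivity k := by
  rw [u_diffusivity]
  exact Subtype.ext (funext fun z => h k _ ((S.mem_U.1 z.2).2 k))

lemma IsScaling.isSymm {p q : Fin 2 → ℝ} (h : S.IsScaling p q) : S.IsSymm (opScaling p q) :=
  (components_scaling p q).isSymm_iff.2 fun k k' hk => by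
    have e := h.mul_eq k k'
    constructor <;> simp [t_indepVar, x_indepVar, u_indepVar, v_indepVar, t_depVar, x_depVar,
      u_depVar, v_depVar, hk]
    linear_combination e

/-- For ξ = x² and η = −3xw the constant −3/2 serves twice: it gives a′η = 4ax = 2aξ_x, and it makes
3ξ_xx + 2η_xw = 6 − 6 vanish, as `drift` requires. -/
lemma IsScaling.isSymm_conformal (h : S.IsScaling (fun _ => -3 / 2) 0) :
    S.IsSymm opConformal :=
  components_conformal.isSymm_iff.2 fun k k' hk => by
    have e := h.mul_eq k k'
    have e₁ : C (-3 / 2) * 2 = -3 := by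
      rw [← map_ofNat C 2, ← map_mul, ← map_ofNat C 3, ← map_neg]
      norm_num
    simp only [Pi.zero_apply, map_zero, add_zero] at e
    constructor <;> simp [t_indepVar, x_indepVar, u_indepVar, v_indepVar, t_depVar, x_depVar,
      u_depVar, v_depVar, hk, derivation_ofNat]
    · linear_combination 2 * S.indepVar 1 * e -
        (S.frame k k').u (S.diffusivity k) * S.indepVar 1 * S.depVar k * e₁
    · linear_combination 2 * (S.frame k k').u (S.diffusivity k) * S.depVar k * e₁ - 4 * e

lemma diffusivity_eq_const {k : Fin 2} {κ : ℝ} (h : ∀ w ∈ S.K k, S.d k w = κ) :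
    S.diffusivity k = C κ :=
  Subtype.ext (funext fun z => h _ ((S.mem_U.1 z.2).2 k))

lemma isSymm_single {k k' : Fin 2} (hk : k ≠ k') {X : Operator} {f : S.R}
    (hX : S.Components X 0 0 (Pi.single k f))
    (h : Determining (S.frame k k') (S.diffusivity k) (S.diffusivity k') 0 0 f) : S.IsSymm X :=
  hX.isSymm_iff.2 fun l l' hl => by
    rcases eq_or_eq_of_ne hk l with rfl | rfl
    · obtain rfl := (eq_or_eq_of_ne hk l').resolve_left hl.symm
      simpa using h
    · simpa [hk.symm] using Determining.zero _ _ _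

lemma isSymm_linear_self {k : Fin 2} {κ : ℝ} (h : ∀ w ∈ S.K k, S.d k w = κ) :
    S.IsSymm (opLinear k k) := by
  obtain ⟨k', hk⟩ := exists_ne k
  refine isSymm_single hk.symm (components_linear k k) ?_
  rw [diffusivity_eq_const h]
  constructor <;> simp [t_depVar, x_depVar, u_depVar, v_depVar, hk.symm]

lemma isSymm_linear {k k' : Fin 2} {κ : ℝ} (hk : k ≠ k') (h : ∀ w ∈ S.K k, S.d k w = κ)
    (h' : ∀ w ∈ S.K k', S.d k' w = κ) : S.IsSymm (opLinear k k') := by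
  refine isSymm_single hk (components_linear k k') ?_
  rw [diffusivity_eq_const h, diffusivity_eq_const h']
  constructor <;> simp [t_depVar, x_depVar, u_depVar, v_depVar, hk.symm]

lemma isSymm_heat {k : Fin 2} {κ : ℝ} (h : ∀ w ∈ S.K k, S.d k w = κ) {X : Operator}
    (hX : X ∈ heatOps k S.Ω κ) : S.IsSymm X := by
  obtain ⟨α, hα, rfl⟩ := hX
  obtain ⟨f, hf, hd⟩ := exists_components_heat k hα
  obtain ⟨k', hk⟩ := exists_ne k
  refine isSymm_single hk.symm hf ?_
  rw [diffusivity_eq_const h]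
  have := hd k k'
  constructor <;> simp [this]

lemma isSymm_galilei {κ : Fin 2 → ℝ} (h0 : ∀ k, κ k ≠ 0) (h : ∀ k, ∀ w ∈ S.K k, S.d k w = κ k) :
    S.IsSymm (opGalilei (κ 0) (κ 1)) :=
  (components_galilei κ).isSymm_iff.2 fun k k' hk => by
    rw [diffusivity_eq_const (h k), diffusivity_eq_const (h k')]
    have e := C_mul_inv (S := S) (h0 k)
    rw [one_div] at e
    constructor <;> simp [t_indepVar, x_indepVar, u_indepVar, v_indepVar, t_depVar, x_depVar,
      u_depVar, v_depVar, hk, derivation_ofNat]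
    linear_combination 2 * e

lemma isSymm_projective {κ : Fin 2 → ℝ} (h0 : ∀ k, κ k ≠ 0)
    (h : ∀ k, ∀ w ∈ S.K k, S.d k w = κ k) : S.IsSymm (opProjective (κ 0) (κ 1)) :=
  (components_projective κ).isSymm_iff.2 fun k k' hk => by
    rw [diffusivity_eq_const (h k), diffusivity_eq_const (h k')]
    have e := C_mul_inv (S := S) (h0 k)
    rw [one_div] at e
    constructor <;> simp [t_indepVar, x_indepVar, u_indepVar, v_indepVar, t_depVar, x_depVar,
      u_depVar, v_depVar, hk, derivation_ofNat]
    · ring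
    · ring
    · linear_combination 4 * S.indepVar 1 * e

lemma algebraMap_eq_zero {c : ℝ} (h : C c = 0) : c = 0 := by
  obtain ⟨p⟩ := (inferInstance : Nonempty S.U)
  exact congrFun (congrArg Subtype.val h) p

/-- Differentiating twice isolates the leading coefficient, so openness and nonemptiness of the
domain suffice. All independence proofs read off the τ and ξ components through this lemma. -/
lemma quadratic_eq_zero (i : Fin 2) {a b c : ℝ}
    (h : C a + C b * S.indepVar i + C c * S.indepVar i ^ 2 = 0) : a = 0 ∧ b = 0 ∧ c = 0 := by
  have h₁ := congrArg (D (Pi.single i 1, 0)) h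
  simp only [map_add, Derivation.leibniz, Derivation.leibniz_pow, Derivation.map_algebraMap,
    D_indepVar, Pi.single_eq_same, map_one, smul_eq_mul, map_zero, mul_zero, add_zero,
    zero_add, mul_one, nsmul_eq_mul, Nat.cast_ofNat, Nat.add_one_sub_one, pow_one] at h₁
  have h₂ := congrArg (D (Pi.single i 1, 0)) h₁
  simp only [map_add, Derivation.leibniz, Derivation.map_algebraMap, derivation_ofNat,
    D_indepVar, Pi.single_eq_same, map_one, smul_eq_mul, map_zero, mul_zero, add_zero,
    zero_add, mul_one] at h₂
  have hc : c = 0 := algebraMap_eq_zero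
    (eq_zero_of_isUnit_mul isUnit_two (by linear_combination h₂))
  subst hc
  simp only [map_zero, zero_mul, add_zero] at h₁
  have hb : b = 0 := algebraMap_eq_zero h₁
  subst hb
  exact ⟨algebraMap_eq_zero (S := S) (by simpa using h), rfl, rfl⟩

/-! Systems with exponential or power diffusivities. -/

/-- The right side 2d of the scaling relation is positive, so d′ vanishes nowhere. -/
lemma IsScaling.nonconstant {p q : Fin 2 → ℝ} (h : S.IsScaling p q) (k : Fin 2) :
    S.Nonconstant k := by
  obtain ⟨w, hw⟩ := (S.isConnected_K k).nonempty
  refine ⟨w, hw, fun h0 => ?_⟩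
  have := h k w hw
  have := S.pos_d k w hw
  simp_all

lemma exists_polynomial {k k' : Fin 2} (hk : k ≠ k') {τ ξ η : S.R}
    (h : Determining (S.frame k k') (S.diffusivity k) (S.diffusivity k') τ ξ η)
    (hτ : (S.frame k k').t ((S.frame k k').t τ) = 0) (hξt : (S.frame k k').t ξ = 0)
    (hξx : (S.frame k k').x ((S.frame k k').x ((S.frame k k').x ξ)) = 0) :
    ∃ c₀ c₁ b₀ b₁ b₂ : ℝ, τ = C c₀ + C c₁ * (2 * S.indepVar 0) ∧
      ξ = C b₀ + C b₁ * S.indepVar 1 + C b₂ * S.indepVar 1 ^ 2 := by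
  have hxt := (S.frame k k').x_t
  have hut := (S.frame k k').u_t
  have hvt := (S.frame k k').v_t
  have hux := (S.frame k k').u_x
  have hvx := (S.frame k k').v_x
  have half : ∀ c : ℝ, C (c / 2) * 2 = C c := fun c => by
    rw [← map_ofNat C 2, ← map_mul, div_mul_cancel₀ _ two_ne_zero]
  obtain ⟨c, hc⟩ := S.exists_eq_algebraMap hk (f := (S.frame k k').x ((S.frame k k').x ξ))
    (by rw [← hxt, ← hxt, hξt, map_zero, map_zero]) hξx
    (by rw [hux, hux, h.ξu, map_zero, map_zero]) (by rw [hvx, hvx, h.ξv, map_zero, map_zero])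
  obtain ⟨b₁, h₁⟩ := S.exists_eq_algebraMap hk
    (f := (S.frame k k').x ξ - C c * S.indepVar 1)
    (by simp [← hxt, hξt, t_indepVar]) (by simp [hc, x_indepVar])
    (by simp [hux, h.ξu, u_indepVar]) (by simp [hvx, h.ξv, v_indepVar])
  obtain ⟨b₀, h₀⟩ := S.exists_eq_algebraMap hk
    (f := ξ - C b₁ * S.indepVar 1 - C (c / 2) * S.indepVar 1 ^ 2)
    (by simp [hξt, t_indepVar])
    (by
      simp only [map_sub, Derivation.leibniz, Derivation.leibniz_pow, Derivation.map_algebraMap,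
        x_indepVar, if_true, smul_eq_mul, mul_zero, add_zero, mul_one, nsmul_eq_mul,
        Nat.cast_ofNat, Nat.add_one_sub_one, pow_one]
      linear_combination h₁ - S.indepVar 1 * half c)
    (by simp [h.ξu, u_indepVar]) (by simp [h.ξv, v_indepVar])
  obtain ⟨c₁, e₁⟩ := S.exists_eq_algebraMap hk (f := (S.frame k k').t τ) hτ
    (by rw [hxt, h.τx, map_zero]) (by rw [hut, h.τu, map_zero]) (by rw [hvt, h.τv, map_zero])
  obtain ⟨c₀, e₀⟩ := S.exists_eq_algebraMap hk (f := τ - C c₁ * S.indepVar 0)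
    (by simp [e₁, t_indepVar]) (by simp [h.τx, x_indepVar]) (by simp [h.τu, u_indepVar])
    (by simp [h.τv, v_indepVar])
  exact ⟨c₀, c₁ / 2, b₀, b₁, c / 2, by linear_combination e₀ - S.indepVar 0 * half c₁,
    by linear_combination h₀⟩

/-- The relation a′(pw + q) = 2a turns the diffusion equation into η = (ξ_x − τ_t/2)(pw + q), where
ξ is quadratic in x and τ affine in t. The relation 3ξ_xx + 2η_xw = 0 then becomes (3 + 2p)c₄ = 0.
The constants c₃, c₄ are common to both equations since τ and ξ are. -/
lemma IsScaling.exists_form {p q : Fin 2 → ℝ} (h : S.IsScaling p q) {τ ξ : S.R} {η : Fin 2 → S.R}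
    (hd : ∀ k k', k ≠ k' →
      Determining (S.frame k k') (S.diffusivity k) (S.diffusivity k') τ ξ (η k)) :
    ∃ c₀ c₁ c₂ c₃ c₄ : ℝ, τ = C c₀ + C c₂ * (2 * S.indepVar 0) ∧
      ξ = C c₁ + C c₂ * S.indepVar 1 + C c₃ * S.indepVar 1 + C c₄ * S.indepVar 1 ^ 2 ∧
      (∀ k, η k = (C c₃ + 2 * C c₄ * S.indepVar 1) * (C (p k) * S.depVar k + C (q k))) ∧
      ∀ k, (3 + 2 * p k) * c₄ = 0 := by
  have h₀₁ : (0 : Fin 2) ≠ 1 := by decide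
  obtain ⟨hττ, hξt, hξxxx, -⟩ := (h.nonconstant 0).determining h₀₁ (hd 0 1 h₀₁)
  obtain ⟨c₀, c₂, c₁, b, c₄, rfl, rfl⟩ := exists_polynomial h₀₁ (hd 0 1 h₀₁) hττ hξt hξxxx
  have hη : ∀ k, η k = (C (b - c₂) + 2 * C c₄ * S.indepVar 1) *
      (C (p k) * S.depVar k + C (q k)) := fun k => by
    obtain ⟨k', hk⟩ := exists_ne k
    have e := h.mul_eq k k'
    have e₁ := (hd k k' hk.symm).diffusion
    simp only [map_add, Derivation.leibniz, Derivation.leibniz_pow, Derivation.map_algebraMap,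
      x_indepVar, t_indepVar, if_true, smul_eq_mul, mul_zero, add_zero, zero_add, mul_one,
      nsmul_eq_mul, Nat.cast_ofNat, Nat.add_one_sub_one, pow_one, derivation_ofNat] at e₁
    refine sub_eq_zero.1 (eq_zero_of_isUnit_mul isUnit_two
      (eq_zero_of_isUnit_mul (S.isUnit_diffusivity k) ?_))
    rw [map_sub]
    linear_combination (C (p k) * S.depVar k + C (q k)) * e₁ - η k * e
  refine ⟨c₀, c₁, c₂, b - c₂, c₄, rfl, by rw [map_sub]; ring, hη, fun k => ?_⟩
  obtain ⟨k', hk⟩ := exists_ne k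
  obtain ⟨-, -, -, e⟩ := (h.nonconstant k).determining hk.symm (hd k k' hk.symm)
  rw [hη k] at e
  simp only [map_add, Derivation.leibniz, Derivation.leibniz_pow, Derivation.map_algebraMap,
    x_indepVar, u_indepVar, u_depVar, if_true, smul_eq_mul, mul_zero, add_zero, zero_add,
    mul_one, nsmul_eq_mul, Nat.cast_ofNat, Nat.add_one_sub_one, pow_one, derivation_ofNat] at e
  refine algebraMap_eq_zero (S := S) (eq_zero_of_isUnit_mul isUnit_two ?_)
  rw [map_mul, map_add, map_mul, map_ofNat, map_ofNat]
  linear_combination e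

/-- The combinations of `∂_t`, `∂_x`, `2t ∂_t + x ∂_x`. -/
lemma components_opsA (c₀ c₁ c₂ : ℝ) :
    S.Components (c₀ • opTime + c₁ • opSpace + c₂ • opDilation)
      (C c₀ + C c₂ * (2 * S.indepVar 0)) (C c₁ + C c₂ * S.indepVar 1) 0 := by
  have h := ((components_time (S := S).smul c₀).add (components_space.smul c₁)).add
    (components_dilation.smul c₂)
  simpa [Algebra.smul_def] using h

lemma IsScaling.isMaximal {p q : Fin 2 → ℝ} (h : S.IsScaling p q)
    (hp : ¬ (p 0 = -3 / 2 ∧ p 1 = -3 / 2)) : S.IsMaximal ⟨opsA ++ [opScaling p q], ∅⟩ := by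
  refine isMaximal_of (fun X hX => ?_) (by simp) (fun X hX => ?_) fun (c : Fin 4 → ℝ) Z hZ he => ?_
  · rcases List.mem_append.1 hX with hX | hX
    · exact forall_mem_opsA hX
    · rw [List.mem_singleton.1 hX]; exact h.isSymm
  · obtain ⟨τ, ξ, η, hc⟩ := exists_components hX.1
    obtain ⟨c₀, c₁, c₂, c₃, c₄, hτ, hξ, hη, h4⟩ := h.exists_form (hc.isSymm_iff.1 hX)
    have h4 : c₄ = 0 := by
      by_contra h0
      refine hp ⟨?_, ?_⟩
      · linarith [(mul_eq_zero.1 (h4 0)).resolve_right h0]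
      · linarith [(mul_eq_zero.1 (h4 1)).resolve_right h0]
    subst h4
    refine ⟨c₀ • opTime + c₁ • opSpace + c₂ • opDilation + c₃ • opScaling p q, ?_, ?_⟩
    · refine Submodule.add_mem _ (Submodule.add_mem _ (Submodule.add_mem _ ?_ ?_) ?_) ?_ <;>
        refine Submodule.smul_mem _ _ (BasicOperators.mem_span_of_mem_fin ?_) <;> simp [opsA_eq]
    · refine hc.eqOn ((components_opsA c₀ c₁ c₂).add ((components_scaling p q).smul c₃))
        ?_ ?_ fun k => ?_
      · simp [hτ, Algebra.smul_def]
      · simp [hξ, Algebra.smul_def]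
      · simp [hη, Algebra.smul_def]
  · obtain rfl : Z = 0 := by simpa using hZ
    have e : ∑ i : Fin 4, c i • (opsA ++ [opScaling p q]).get i = c 0 • opTime + c 1 • opSpace +
      c 2 • opDilation + c 3 • opScaling p q := Fin.sum_univ_four _
    have he : EqOn (∑ i : Fin 4, c i • (opsA ++ [opScaling p q]).get i + 0) 0 S.U := he
    rw [add_zero, e] at he
    obtain ⟨hτ, hξ, hη⟩ := ((components_opsA (c 0) (c 1) (c 2)).add
      ((components_scaling p q).smul (c 3))).eq_zero he
    have hη : c 3 • (C (p 0) * S.depVar 0 + C (q 0)) = 0 := (zero_add _).symm.trans (hη 0)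
    rw [Algebra.smul_def] at hη
    simp only [Algebra.smul_def, mul_zero, add_zero] at hτ hξ
    obtain ⟨h0, h2, -⟩ := quadratic_eq_zero (S := S) 0 (a := c 0) (b := 2 * c 2) (c := 0)
      (by rw [map_mul, map_ofNat, map_zero]; linear_combination hτ)
    obtain ⟨h1, -, -⟩ := quadratic_eq_zero (S := S) 1 (a := c 1) (b := c 2 + c 3) (c := 0)
      (by rw [map_add, map_zero]; linear_combination hξ)
    -- The factor pu + q is cancelled by multiplying with a′, which turns it into the unit 2a.
    have h3 : c 3 = 0 := algebraMap_eq_zero (S := S) (eq_zero_of_isUnit_mul isUnit_two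
      (eq_zero_of_isUnit_mul (S.isUnit_diffusivity 0) (by
        linear_combination (S.frame 0 1).u (S.diffusivity 0) * hη - C (c 3) * h.mul_eq 0 1)))
    funext i
    fin_cases i
    exacts [h0, h1, (mul_eq_zero.1 h2).resolve_left two_ne_zero, h3]

lemma IsScaling.isMaximal_conformal (h : S.IsScaling (fun _ => -3 / 2) 0) :
    S.IsMaximal ⟨opsA ++ [opScaling (fun _ => -3 / 2) 0, opConformal], ∅⟩ := by
  refine isMaximal_of (fun X hX => ?_) (by simp) (fun X hX => ?_) fun (c : Fin 5 → ℝ) Z hZ he => ?_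
  · rcases List.mem_append.1 hX with hX | hX
    · exact forall_mem_opsA hX
    · simp only [List.mem_cons, List.not_mem_nil, or_false] at hX
      rcases hX with rfl | rfl
      exacts [h.isSymm, h.isSymm_conformal]
  · obtain ⟨τ, ξ, η, hc⟩ := exists_components hX.1
    obtain ⟨c₀, c₁, c₂, c₃, c₄, hτ, hξ, hη, -⟩ := h.exists_form (hc.isSymm_iff.1 hX)
    refine ⟨c₀ • opTime + c₁ • opSpace + c₂ • opDilation + c₃ • opScaling (fun _ => -3 / 2) 0 +
      c₄ • opConformal, ?_, ?_⟩
    · refine Submodule.add_mem _ (Submodule.add_mem _ (Submodule.add_mem _ (Submodule.add_mem _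
        ?_ ?_) ?_) ?_) ?_ <;>
        refine Submodule.smul_mem _ _ (BasicOperators.mem_span_of_mem_fin ?_) <;> simp [opsA_eq]
    · refine hc.eqOn (((components_opsA c₀ c₁ c₂).add ((components_scaling _ _).smul c₃)).add
        (components_conformal.smul c₄)) ?_ ?_ fun k => ?_
      · simp [hτ]
      · simp [hξ, Algebra.smul_def]
      · rw [hη k]
        have e₁ : C (-3 / 2) * 2 = -3 := by
          rw [← map_ofNat C 2, ← map_mul, ← map_ofNat C 3, ← map_neg]
          norm_num
        change _ = (0 : S.R) + c₃ • (C (-3 / 2) * S.depVar k + C 0) +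
          c₄ • (-3 * S.indepVar 1 * S.depVar k)
        simp only [Algebra.smul_def, Pi.zero_apply, map_zero]
        linear_combination C c₄ * S.indepVar 1 * S.depVar k * e₁
  · obtain rfl : Z = 0 := by simpa using hZ
    have e : ∑ i : Fin 5, c i • (opsA ++ [opScaling (fun _ => -3 / 2) 0, opConformal]).get i =
      c 0 • opTime + c 1 • opSpace + c 2 • opDilation + c 3 • opScaling (fun _ => -3 / 2) 0 +
        c 4 • opConformal := Fin.sum_univ_five _
    have he : EqOn (∑ i : Fin 5, c i •
      (opsA ++ [opScaling (fun _ => -3 / 2) 0, opConformal]).get i + 0) 0 S.U := he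
    rw [add_zero, e] at he
    obtain ⟨hτ, hξ, hη⟩ := (((components_opsA (c 0) (c 1) (c 2)).add
      ((components_scaling _ _).smul (c 3))).add (components_conformal.smul (c 4))).eq_zero he
    have hη : (0 : S.R) + c 3 • (C (-3 / 2) * S.depVar 0 + C 0) +
      c 4 • (-3 * S.indepVar 1 * S.depVar 0) = 0 := hη 0
    simp only [Algebra.smul_def, mul_zero, add_zero] at hτ hξ hη
    obtain ⟨h0, h2, -⟩ := quadratic_eq_zero (S := S) 0 (a := c 0) (b := 2 * c 2) (c := 0)
      (by rw [map_mul, map_ofNat, map_zero]; linear_combination hτ)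
    obtain ⟨h1, h23, h4⟩ := quadratic_eq_zero (S := S) 1 (a := c 1) (b := c 2 + c 3) (c := c 4)
      (by rw [map_add]; linear_combination hξ)
    have h2 := (mul_eq_zero.1 h2).resolve_left two_ne_zero
    rw [h2, zero_add] at h23
    funext i
    fin_cases i
    exacts [h0, h1, h2, h23, h4]

/-! Systems with a linear equation. -/

section Linear

variable {k k' : Fin 2} {κ : ℝ} {b τ ξ η : S.R}

-- With a = κ the diffusion equation reads 2ξ_x = τ_t, so ξ_xx = 0. The drift equation −ξ_t = 2κη_xu
-- and the heat equation for η give −ξ_tt = 2κ²η_xxxu = −κξ_txx = 0. Hence ξ is affine in t and in x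
-- separately, and τ follows by integration.
set_option maxHeartbeats 1000000 in
lemma exists_form_of_const (hk : k ≠ k') (hκ : κ ≠ 0)
    (h : Determining (S.frame k k') (C κ) b τ ξ η) :
    ∃ c₀ c₁ c₂ c₃ c₄ : ℝ,
      τ = C c₀ + C c₂ * (2 * S.indepVar 0) + C c₄ * (4 * S.indepVar 0 ^ 2) ∧
      ξ = C c₁ + C c₂ * S.indepVar 1 + C c₃ * (2 * S.indepVar 0) +
        C c₄ * (4 * S.indepVar 0 * S.indepVar 1) := by
  have hxt := (S.frame k k').x_t
  have hut := (S.frame k k').u_t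
  have hvt := (S.frame k k').v_t
  have hux := (S.frame k k').u_x
  have hvx := (S.frame k k').v_x
  have hu : IsUnit (C κ) := (IsUnit.mk0 κ hκ).map C
  have hl : 2 * (S.frame k k').x ξ - (S.frame k k').t τ = 0 :=
    eq_zero_of_isUnit_mul hu (by rw [← h.diffusion, Derivation.map_algebraMap, zero_mul])
  have hxx : (S.frame k k').x ((S.frame k k').x ξ) = 0 := by
    have e := congrArg (S.frame k k').x hl
    simp only [map_sub, Derivation.leibniz, smul_eq_mul, derivation_two, hxt, h.τx, map_zero,
      mul_zero, add_zero, sub_zero] at e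
    exact eq_zero_of_isUnit_mul isUnit_two e
  have hd : -(S.frame k k').t ξ = 2 * C κ * (S.frame k k').x ((S.frame k k').u η) := by
    have e := h.drift
    rwa [Derivation.map_algebraMap, hxx, mul_zero, mul_zero, zero_mul, zero_add, sub_zero] at e
  have htt : (S.frame k k').t ((S.frame k k').t ξ) = 0 := by
    have e₁ := congrArg (S.frame k k').t hd
    have e₂ := congrArg (S.frame k k').x (congrArg (S.frame k k').x hd)
    have e₃ := congrArg (S.frame k k').x (congrArg (S.frame k k').u h.heat)
    simp only [map_neg, Derivation.leibniz, smul_eq_mul, derivation_two, hxt, hux, hut, hxx,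
      map_zero, mul_zero, add_zero, Derivation.map_algebraMap, neg_zero] at e₁ e₂ e₃
    linear_combination -e₁ + C κ * e₂ - 2 * C κ * e₃
  have cancel : ∀ (n : ℕ) [n.AtLeastTwo] (c : ℝ), C (c / n) * ofNat(n) = C c := fun n _ c => by
    have hn : (n : ℝ) ≠ 0 := Nat.cast_ne_zero.2 (by have := Nat.AtLeastTwo.one_lt (n := n); omega)
    rw [← map_ofNat C n, ← map_mul]
    exact congrArg C (div_mul_cancel₀ c hn)
  obtain ⟨c₄, h₄⟩ := S.exists_eq_algebraMap hk (f := (S.frame k k').t ((S.frame k k').x ξ))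
    (by rw [← hxt, ← hxt, htt, map_zero]) (by rw [hxt, hxx, map_zero])
    (by rw [hut, hux, h.ξu, map_zero, map_zero]) (by rw [hvt, hvx, h.ξv, map_zero, map_zero])
  obtain ⟨c₃, h₃⟩ := S.exists_eq_algebraMap hk (f := (S.frame k k').t ξ - C c₄ * S.indepVar 1)
    (by simp [htt, t_indepVar]) (by simp [hxt, h₄, x_indepVar])
    (by simp [hut, h.ξu, u_indepVar]) (by simp [hvt, h.ξv, v_indepVar])
  obtain ⟨c₂, h₂⟩ := S.exists_eq_algebraMap hk (f := (S.frame k k').x ξ - C c₄ * S.indepVar 0)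
    (by simp [h₄, t_indepVar]) (by simp [hxx, x_indepVar])
    (by simp [hux, h.ξu, u_indepVar]) (by simp [hvx, h.ξv, v_indepVar])
  obtain ⟨c₁, h₁⟩ : ∃ c, ξ - C c₂ * S.indepVar 1 -
      C c₃ * S.indepVar 0 - C c₄ * (S.indepVar 0 * S.indepVar 1) = C c := by
    apply S.exists_eq_algebraMap hk <;> simp only [map_sub, Derivation.leibniz,
      Derivation.map_algebraMap, t_indepVar, x_indepVar, u_indepVar, v_indepVar, h.ξu, h.ξv,
      smul_eq_mul, mul_zero, add_zero, zero_add, mul_one, if_true, one_ne_zero, zero_ne_one,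
      if_false, sub_zero, sub_self]
    · linear_combination h₃
    · linear_combination h₂
  obtain ⟨c₀, h₀⟩ : ∃ c, τ - C c₂ * (2 * S.indepVar 0) - C c₄ * S.indepVar 0 ^ 2 = C c := by
    apply S.exists_eq_algebraMap hk <;> simp only [map_sub, Derivation.leibniz,
      Derivation.leibniz_pow, Derivation.map_algebraMap, t_indepVar, x_indepVar, u_indepVar,
      v_indepVar, h.τx, h.τu, h.τv, smul_eq_mul, mul_zero, add_zero, mul_one, derivation_ofNat,
      if_true, zero_ne_one, if_false, sub_self, nsmul_eq_mul, Nat.cast_ofNat,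
      Nat.add_one_sub_one, pow_one]
    linear_combination -hl + 2 * h₂
  -- The divisors 2 and 4 match the normalisations 2t∂_x and 4tx∂_x + 4t²∂_t of the Galilei and
  -- projective operators.
  refine ⟨c₀, c₁, c₂, c₃ / (2 : ℕ), c₄ / (4 : ℕ), ?_, ?_⟩
  · linear_combination h₀ - S.indepVar 0 ^ 2 * cancel 4 c₄
  · linear_combination h₁ - S.indepVar 0 * cancel 2 c₃ - S.indepVar 0 * S.indepVar 1 * cancel 4 c₄

/-- The drift equation determines η_xu, and the u-derivative of the heat equation gives η_tu = −2c₄;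
so η_u is a known polynomial in t, x up to a constant, while η_v is constant. The subtracted terms
satisfy the heat equation, as does η, so the remainder is a solution that depends on t, x alone. -/
lemma exists_dep_form_of_const (hk : k ≠ k') (hκ : κ ≠ 0)
    (h : Determining (S.frame k k') (C κ) (S.diffusivity k') τ ξ η)
    (hη : (S.frame k k').t ((S.frame k k').v η) = 0) {c₁ c₂ c₃ c₄ : ℝ}
    (hξ : ξ = C c₁ + C c₂ * S.indepVar 1 + C c₃ * (2 * S.indepVar 0) +
        C c₄ * (4 * S.indepVar 0 * S.indepVar 1)) :
    ∃ c₅ c₆ : ℝ, ∃ f : S.R, η = C c₅ * S.depVar k + C c₆ * S.depVar k' +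
        C c₃ * (-S.indepVar 1 * (C (1 / κ) * S.depVar k)) +
        C c₄ * (-C (1 / κ) * (S.indepVar 1 ^ 2 + 2 * C κ * S.indepVar 0) * S.depVar k) + f ∧
      (S.frame k k').u f = 0 ∧ (S.frame k k').v f = 0 ∧
      (S.frame k k').t f = C κ * (S.frame k k').x ((S.frame k k').x f) ∧
      (S.frame k k').v η = C c₆ := by
  have hxt := (S.frame k k').x_t
  have hut := (S.frame k k').u_t
  have hux := (S.frame k k').u_x
  have hvu := (S.frame k k').v_u
  have inv := C_mul_inv (S := S) hκ
  have hd : (S.frame k k').x ((S.frame k k').u η) =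
      -C (1 / κ) * (C c₃ + 2 * C c₄ * S.indepVar 1) := by
    have e := h.drift
    rw [hξ] at e
    simp only [map_add, Derivation.leibniz, Derivation.map_algebraMap, x_indepVar, t_indepVar,
      smul_eq_mul, mul_zero, add_zero, zero_add, mul_one, derivation_ofNat, zero_mul,
      if_true, one_ne_zero, zero_ne_one, if_false, sub_zero] at e
    refine sub_eq_zero.1 (eq_zero_of_isUnit_mul isUnit_two ?_)
    linear_combination -2 * inv * (S.frame k k').x ((S.frame k k').u η) - C (1 / κ) * e
  have ht : (S.frame k k').t ((S.frame k k').u η) = -2 * C c₄ := by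
    have e₁ := congrArg (S.frame k k').u h.heat
    have e₂ := congrArg (S.frame k k').x hd
    simp only [map_add, map_neg, Derivation.leibniz, Derivation.map_algebraMap, x_indepVar, hut,
      hux, smul_eq_mul, mul_zero, add_zero, zero_add, mul_one, derivation_ofNat,
      if_true, neg_zero] at e₁ e₂
    linear_combination e₁ + C κ * e₂ - 2 * C c₄ * inv
  obtain ⟨c₅, h₅⟩ := S.exists_eq_algebraMap hk (f := (S.frame k k').u η +
      C (1 / κ) * (C c₃ * S.indepVar 1 + C c₄ * S.indepVar 1 ^ 2) + C c₄ * (2 * S.indepVar 0))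
    (by
      simp only [map_add, Derivation.leibniz, Derivation.leibniz_pow, Derivation.map_algebraMap,
        t_indepVar, smul_eq_mul, mul_zero, add_zero, mul_one, derivation_ofNat,
        if_true, one_ne_zero, if_false, ht, nsmul_zero]
      ring)
    (by
      simp only [map_add, Derivation.leibniz, Derivation.leibniz_pow, Derivation.map_algebraMap,
        x_indepVar, smul_eq_mul, mul_zero, add_zero, mul_one, derivation_ofNat,
        if_true, zero_ne_one, if_false, hd, nsmul_eq_mul, Nat.cast_ofNat, Nat.add_one_sub_one,
        pow_one]
      ring)
    (by simp [h.ηuu, u_indepVar, derivation_ofNat])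
    (by simp [hvu, h.ηuv, v_indepVar, derivation_ofNat])
  obtain ⟨c₆, h₆⟩ := S.exists_eq_algebraMap hk (f := (S.frame k k').v η) hη h.ηxv h.ηuv h.ηvv
  refine ⟨c₅, c₆, η - (C c₅ * S.depVar k + C c₆ * S.depVar k' +
    C c₃ * (-S.indepVar 1 * (C (1 / κ) * S.depVar k)) +
    C c₄ * (-C (1 / κ) * (S.indepVar 1 ^ 2 + 2 * C κ * S.indepVar 0) * S.depVar k)),
    (add_sub_cancel _ _).symm, ?_, ?_, ?_, h₆⟩
  · simp only [map_add, map_sub, map_neg, Derivation.leibniz, Derivation.leibniz_pow,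
      Derivation.map_algebraMap, u_indepVar, u_depVar, smul_eq_mul, mul_zero, add_zero,
      mul_one, derivation_ofNat, if_true, hk.symm, if_false, nsmul_zero, neg_zero]
    linear_combination h₅ + 2 * C c₄ * S.indepVar 0 * inv
  · simp only [map_add, map_sub, map_neg, Derivation.leibniz, Derivation.leibniz_pow,
      Derivation.map_algebraMap, v_indepVar, v_depVar, smul_eq_mul, mul_zero, add_zero, zero_add,
      mul_one, derivation_ofNat, if_true, hk, if_false, nsmul_zero, neg_zero]
    linear_combination h₆
  · simp only [map_add, map_sub, map_neg, Derivation.leibniz, Derivation.leibniz_pow,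
      Derivation.map_algebraMap, t_indepVar, t_depVar, x_indepVar, x_depVar, smul_eq_mul, mul_zero,
      add_zero, zero_add, mul_one, derivation_ofNat, if_true, if_false, neg_zero,
      one_ne_zero, zero_ne_one, nsmul_eq_mul, Nat.cast_ofNat, Nat.add_one_sub_one,
      pow_one, h.heat, Derivation.map_one_eq_zero]
    ring

end Linear

/-- The combinations of the operators `α(t, x) ∂_u` and `β(t, x) ∂_v`. -/
lemma exists_components_of_mem_span {T : Set Operator}
    (hT : ∀ X ∈ T, ∃ k κ, X ∈ heatOps k S.Ω κ) {Z : Operator} (hZ : Z ∈ Submodule.span ℝ T) :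
    ∃ η : Fin 2 → S.R, S.Components Z 0 0 η ∧ ∀ k l l', (S.frame l l').u (η k) = 0 := by
  induction hZ using Submodule.span_induction with
  | mem X hX =>
    obtain ⟨k, κ, α, hα, rfl⟩ := hT X hX
    obtain ⟨f, hf, hd⟩ := exists_components_heat k hα
    refine ⟨_, hf, fun i l l' => ?_⟩
    rcases eq_or_ne i k with rfl | hi
    · simpa using (hd l l').1
    · simp [hi]
  | zero => exact ⟨0, Components.zero, fun k l l' => map_zero _⟩
  | add X Y _ _ hX hY =>
    obtain ⟨η, h, e⟩ := hX
    obtain ⟨η', h', e'⟩ := hY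
    exact ⟨η + η', by simpa using h.add h', fun k l l' => by simp [e, e']⟩
  | smul c X _ hX =>
    obtain ⟨η, h, e⟩ := hX
    exact ⟨c • η, by simpa using h.smul c, fun k l l' => by simp [e]⟩

/-- Independence modulo α∂_u: such an α is killed by differentiation in the dependent variable,
whereas the linear term is not. -/
lemma eq_zero_of_linear {c : ℝ} {f : S.R} (k : Fin 2) (hf : ∀ l l', (S.frame l l').u f = 0)
    (h : C c * S.depVar k + f = 0) : c = 0 := by
  have e := congrArg (S.frame k k).u h
  simp only [map_add, Derivation.leibniz, Derivation.map_algebraMap, u_depVar, if_true, hf,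
    smul_eq_mul, mul_one, mul_zero, add_zero, map_zero] at e
  exact algebraMap_eq_zero e

/-- One of the equations is linear. -/
lemma isMaximal_of_const_of_nonconstant {k k' : Fin 2} (hk : k ≠ k') {κ : ℝ} (hκ : κ ≠ 0)
    (h : ∀ w ∈ S.K k, S.d k w = κ) (h' : S.Nonconstant k') :
    S.IsMaximal ⟨opsA ++ [opLinear k k], heatOps k S.Ω κ⟩ := by
  refine isMaximal_of (fun X hX => ?_) (fun X hX => isSymm_heat h hX) (fun X hX => ?_)
    fun (c : Fin 4 → ℝ) Z hZ he => ?_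
  · rcases List.mem_append.1 hX with hX | hX
    · exact forall_mem_opsA hX
    · rw [List.mem_singleton.1 hX]; exact isSymm_linear_self h
  · obtain ⟨τ, ξ, η, hc⟩ := exists_components hX.1
    have hd := hc.isSymm_iff.1 hX k k' hk
    have hd' := hc.isSymm_iff.1 hX k' k hk.symm
    have ht := hd.ηtv (S.coefficients hk)
    -- The nonconstant equation contributes ξ_t = 0, which later kills c₃ and c₄, the Galilei and
    -- projective parts.
    have hξt := (h'.determining hk.symm hd').2.1
    have hv := Nonconstant.v_eq_zero hk (Or.inr h') hd
    rw [diffusivity_eq_const h] at hd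
    obtain ⟨c₀, c₁, c₂, c₃, c₄, hτ, hξ⟩ := exists_form_of_const hk hκ hd
    obtain ⟨c₅, c₆, f, hη, hfu, hfv, hf, hv'⟩ := exists_dep_form_of_const hk hκ hd ht hξ
    obtain rfl : c₆ = 0 := algebraMap_eq_zero (S := S) (by rw [← hv', hv])
    -- The linear equation forces 2ξ_x = τ_t, and then the nonlinear equation leaves no component
    -- along its own variable.
    have hη' : η k' = 0 := h'.eq_zero_of_determining hd' (by
      have e := hd.diffusion
      rw [Derivation.map_algebraMap, zero_mul] at e
      exact eq_zero_of_isUnit_mul ((IsUnit.mk0 κ hκ).map C) e.symm)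
    have h₃₄ : C (2 * c₃) + C (4 * c₄) * S.indepVar 1 + C 0 * S.indepVar 1 ^ 2 = 0 := by
      rw [hξ] at hξt
      simp only [map_add, Derivation.leibniz, Derivation.map_algebraMap, t_indepVar, smul_eq_mul,
        mul_zero, add_zero, zero_add, mul_one, derivation_ofNat, if_true, one_ne_zero,
        if_false] at hξt
      rw [map_mul, map_mul, map_ofNat, map_ofNat, map_zero]
      linear_combination hξt
    obtain ⟨h₃, h₄, -⟩ := quadratic_eq_zero 1 h₃₄
    obtain rfl : c₃ = 0 := by linarith
    obtain rfl : c₄ = 0 := by linarith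
    obtain ⟨α, hα, hαf⟩ := exists_isHeatSolution hk hfu hfv hf
    refine ⟨c₀ • opTime + c₁ • opSpace + c₂ • opDilation + c₅ • opLinear k k +
      fun p => (0, Pi.single k (α p.1)), ?_, ?_⟩
    · refine Submodule.add_mem _ (Submodule.add_mem _ (Submodule.add_mem _ (Submodule.add_mem _
        ?_ ?_) ?_) ?_) (BasicOperators.mem_span_of_mem_inf ⟨α, hα, rfl⟩) <;>
        refine Submodule.smul_mem _ _ (BasicOperators.mem_span_of_mem_fin ?_) <;> simp [opsA_eq]
    · refine hc.eqOn (((components_opsA c₀ c₁ c₂).add ((components_linear k k).smul c₅)).add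
        (components_single k hαf)) ?_ ?_ fun l => ?_
      · simp [hτ]
      · simp [hξ]
      · rcases eq_or_eq_of_ne hk l with rfl | rfl
        · simp [hη, Algebra.smul_def]
        · simp [hη', hk.symm]
  · obtain ⟨η, hη, hη0⟩ := exists_components_of_mem_span (S := S) (fun X hX => ⟨k, κ, hX⟩) hZ
    have e : ∑ i : Fin 4, c i • (opsA ++ [opLinear k k]).get i = c 0 • opTime + c 1 • opSpace +
      c 2 • opDilation + c 3 • opLinear k k := Fin.sum_univ_four _
    have he : EqOn (∑ i : Fin 4, c i • (opsA ++ [opLinear k k]).get i + Z) 0 S.U := he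
    rw [e] at he
    obtain ⟨hτ, hξ, hη'⟩ := (((components_opsA (c 0) (c 1) (c 2)).add
      ((components_linear k k).smul (c 3))).add hη).eq_zero he
    have hη' : (0 : S.R) + c 3 • (Pi.single k (S.depVar k) : Fin 2 → S.R) k + η k = 0 := hη' k
    simp only [Pi.single_eq_same, Algebra.smul_def, mul_zero, add_zero, zero_add] at hτ hξ hη'
    obtain ⟨h0, h2, -⟩ := quadratic_eq_zero (S := S) 0 (a := c 0) (b := 2 * c 2) (c := 0)
      (by rw [map_mul, map_ofNat, map_zero]; linear_combination hτ)
    obtain ⟨h1, -, -⟩ := quadratic_eq_zero (S := S) 1 (a := c 1) (b := c 2) (c := 0)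
      (by rw [map_zero]; linear_combination hξ)
    funext i
    fin_cases i
    exacts [h0, h1, (mul_eq_zero.1 h2).resolve_left two_ne_zero,
      eq_zero_of_linear k (hη0 k) hη']

/-! Systems of two linear equations. -/

/-- Both equations share τ and ξ, so c₀, …, c₄ are read off from the first one and reused for the
second. Only the linear parts and the heat solutions are individual to each equation, and `coupling`
links the two variables only for equal diffusivities. -/
lemma exists_form_of_forall_const {κ : Fin 2 → ℝ} (h0 : ∀ k, κ k ≠ 0)
    (h : ∀ k, ∀ w ∈ S.K k, S.d k w = κ k) {X : Operator} (hX : S.IsSymm X) :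
    ∃ c₀ c₁ c₂ c₃ c₄ : ℝ, ∃ c₅ c₆ : Fin 2 → ℝ, ∃ α : Fin 2 → (Fin 2 → ℝ) → ℝ,
      (∀ k, IsHeatSolution S.Ω (κ k) (α k)) ∧ (κ 0 ≠ κ 1 → c₆ = 0) ∧
      EqOn X (c₀ • opTime + c₁ • opSpace + c₂ • opDilation + c₅ 0 • opLinear 0 0 +
        c₅ 1 • opLinear 1 1 + c₃ • opGalilei (κ 0) (κ 1) + c₄ • opProjective (κ 0) (κ 1) +
        c₆ 0 • opLinear 0 1 + c₆ 1 • opLinear 1 0 + (fun p => (0, Pi.single 0 (α 0 p.1))) +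
        fun p => (0, Pi.single 1 (α 1 p.1))) S.U := by
  obtain ⟨τ, ξ, η, hc⟩ := exists_components hX.1
  have h₀₁ : (0 : Fin 2) ≠ 1 := by decide
  have hd := hc.isSymm_iff.1 hX
  have e₀ := hd 0 1 h₀₁
  rw [diffusivity_eq_const (h 0)] at e₀
  obtain ⟨c₀, c₁, c₂, c₃, c₄, hτ, hξ⟩ := exists_form_of_const h₀₁ (h0 0) e₀
  have key : ∀ k k', k ≠ k' → ∃ c₅ c₆ : ℝ, ∃ f : S.R, ∃ α, IsHeatSolution S.Ω (κ k) α ∧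
      (∀ p : S.U, α p.1.1 = f.1 p) ∧ (κ 0 ≠ κ 1 → c₆ = 0) ∧
      η k = C c₅ * S.depVar k + C c₆ * S.depVar k' +
        C c₃ * (-S.indepVar 1 * (C (1 / κ k) * S.depVar k)) +
        C c₄ * (-C (1 / κ k) * (S.indepVar 1 ^ 2 + 2 * C (κ k) * S.indepVar 0) * S.depVar k) +
        f := by
    intro k k' hk
    have e := hd k k' hk
    have ht := e.ηtv (S.coefficients hk)
    rw [diffusivity_eq_const (h k)] at e
    obtain ⟨c₅, c₆, f, hη, hu, hv, hf, hv'⟩ := exists_dep_form_of_const hk (h0 k) e ht hξ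
    obtain ⟨α, hα, hαf⟩ := exists_isHeatSolution hk hu hv hf
    refine ⟨c₅, c₆, f, α, hα, hαf, fun hκ => ?_, hη⟩
    have e' := e.coupling
    rw [hv', diffusivity_eq_const (h k'), ← map_sub, ← map_mul] at e'
    refine (mul_eq_zero.1 (algebraMap_eq_zero (S := S) e')).resolve_right fun h1 => hκ ?_
    fin_cases k <;> fin_cases k' <;> first | exact absurd rfl hk | simp at h1; linarith
  obtain ⟨a₀, b₀, f₀, α₀, hα₀, hf₀, hb₀, h₀⟩ := key 0 1 h₀₁
  obtain ⟨a₁, b₁, f₁, α₁, hα₁, hf₁, hb₁, h₁⟩ := key 1 0 h₀₁.symm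
  refine ⟨c₀, c₁, c₂, c₃, c₄, ![a₀, a₁], ![b₀, b₁], ![α₀, α₁], ?_, fun hκ => ?_, ?_⟩
  · exact Fin.forall_fin_two.2 ⟨hα₀, hα₁⟩
  · rw [hb₀ hκ, hb₁ hκ]; ext i; fin_cases i <;> rfl
  · refine hc.eqOn (((((((((components_opsA c₀ c₁ c₂).add ((components_linear 0 0).smul a₀)).add
      ((components_linear 1 1).smul a₁)).add ((components_galilei κ).smul c₃)).add
      ((components_projective κ).smul c₄)).add ((components_linear 0 1).smul b₀)).add
      ((components_linear 1 0).smul b₁)).add (components_single 0 hf₀)).add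
      (components_single 1 hf₁)) ?_ ?_ (Fin.forall_fin_two.2 ⟨?_, ?_⟩)
    · simp [hτ, Algebra.smul_def]
    · simp [hξ, Algebra.smul_def]
    · rw [h₀]
      simp [Algebra.smul_def]
      ring
    · rw [h₁]
      simp [Algebra.smul_def]
      ring

/-- The τ component separates ∂_t, dilation and projective operator, then ξ separates ∂_x and the
Galilei operator. What remains is linear in u, v modulo functions of t, x, and partial
differentiation finishes. Both two-constant cases are instances. -/
lemma eq_zero_of_combination {κ : Fin 2 → ℝ} {c₀ c₁ c₂ c₃ c₄ : ℝ} {c₅ c₆ : Fin 2 → ℝ}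
    {T : Set Operator} (hT : ∀ X ∈ T, ∃ k κ, X ∈ heatOps k S.Ω κ) {Z : Operator}
    (hZ : Z ∈ Submodule.span ℝ T)
    (h : EqOn (c₀ • opTime + c₁ • opSpace + c₂ • opDilation + c₅ 0 • opLinear 0 0 +
        c₅ 1 • opLinear 1 1 + c₃ • opGalilei (κ 0) (κ 1) + c₄ • opProjective (κ 0) (κ 1) +
        c₆ 0 • opLinear 0 1 + c₆ 1 • opLinear 1 0 + Z) 0 S.U) :
    c₀ = 0 ∧ c₁ = 0 ∧ c₂ = 0 ∧ c₃ = 0 ∧ c₄ = 0 ∧ c₅ = 0 ∧ c₆ = 0 := by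
  obtain ⟨η, hη, hη0⟩ := exists_components_of_mem_span hT hZ
  obtain ⟨hτ, hξ, hη'⟩ := ((((((((components_opsA c₀ c₁ c₂).add ((components_linear 0 0).smul
      (c₅ 0))).add ((components_linear 1 1).smul (c₅ 1))).add ((components_galilei κ).smul c₃)).add
      ((components_projective κ).smul c₄)).add ((components_linear 0 1).smul (c₆ 0))).add
      ((components_linear 1 0).smul (c₆ 1))).add hη).eq_zero h
  simp only [Algebra.smul_def, mul_zero, add_zero] at hτ hξ
  obtain ⟨h₀, h₂, h₄⟩ := quadratic_eq_zero (S := S) 0 (a := c₀) (b := 2 * c₂) (c := 4 * c₄)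
    (by rw [map_mul, map_mul, map_ofNat, map_ofNat]; linear_combination hτ)
  have h₂ := (mul_eq_zero.1 h₂).resolve_left two_ne_zero
  have h₄ := (mul_eq_zero.1 h₄).resolve_left four_ne_zero
  subst h₀ h₂ h₄
  obtain ⟨h₁, h₃, -⟩ := quadratic_eq_zero (S := S) 0 (a := c₁) (b := 2 * c₃) (c := 0)
    (by
      rw [map_mul, map_ofNat, map_zero]
      rw [map_zero] at hξ
      linear_combination hξ)
  have h₃ := (mul_eq_zero.1 h₃).resolve_left two_ne_zero
  subst h₁ h₃
  have e₀ : C (c₅ 0) * S.depVar 0 + C (c₆ 0) * S.depVar 1 + η 0 = 0 := by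
    have := hη' 0
    simpa [Algebra.smul_def] using this
  have e₁ : C (c₅ 1) * S.depVar 1 + C (c₆ 1) * S.depVar 0 + η 1 = 0 := by
    have := hη' 1
    simpa [Algebra.smul_def] using this
  have aux' : ∀ {a b : ℝ} {k k' i : Fin 2}, k ≠ k' →
      C a * S.depVar k + C b * S.depVar k' + η i = 0 → a = 0 := by
    intro a b k k' i hk h
    have e := congrArg (S.frame k k').u h
    simp only [map_add, Derivation.leibniz, Derivation.map_algebraMap, u_depVar, if_true, hη0,
      smul_eq_mul, mul_one, mul_zero, add_zero, map_zero, hk.symm, if_false] at e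
    exact algebraMap_eq_zero e
  refine ⟨rfl, rfl, rfl, rfl, rfl, funext (Fin.forall_fin_two.2 ⟨?_, ?_⟩),
    funext (Fin.forall_fin_two.2 ⟨?_, ?_⟩)⟩
  · exact aux' (k := 0) (k' := 1) (by decide) e₀
  · exact aux' (k := 1) (k' := 0) (by decide) e₁
  · exact aux' (k := 1) (k' := 0) (by decide) ((congrArg (· + η 0) (add_comm _ _)).trans e₀)
  · exact aux' (k := 0) (k' := 1) (by decide) ((congrArg (· + η 1) (add_comm _ _)).trans e₁)

lemma exists_mem_heatOps {κ : Fin 2 → ℝ} :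
    ∀ X ∈ heatOps 0 S.Ω (κ 0) ∪ heatOps 1 S.Ω (κ 1), ∃ k, X ∈ heatOps k S.Ω (κ k) := by
  rintro X (hX | hX)
  exacts [⟨0, hX⟩, ⟨1, hX⟩]

lemma isMaximal_of_const_of_ne {κ : Fin 2 → ℝ} (h0 : ∀ k, κ k ≠ 0)
    (h : ∀ k, ∀ w ∈ S.K k, S.d k w = κ k) (hκ : κ 0 ≠ κ 1) :
    S.IsMaximal ⟨opsA ++ [opLinear 0 0, opLinear 1 1, opGalilei (κ 0) (κ 1),
      opProjective (κ 0) (κ 1)], heatOps 0 S.Ω (κ 0) ∪ heatOps 1 S.Ω (κ 1)⟩ := by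
  refine isMaximal_of (fun X hX => ?_) (fun X hX => ?_) (fun X hX => ?_)
    fun (c : Fin 7 → ℝ) Z hZ he => ?_
  · rcases List.mem_append.1 hX with hX | hX
    · exact forall_mem_opsA hX
    · simp only [List.mem_cons, List.not_mem_nil, or_false] at hX
      rcases hX with rfl | rfl | rfl | rfl
      exacts [isSymm_linear_self (h 0), isSymm_linear_self (h 1), isSymm_galilei h0 h,
        isSymm_projective h0 h]
  · obtain ⟨k, hX⟩ := exists_mem_heatOps X hX
    exact isSymm_heat (h k) hX
  · obtain ⟨c₀, c₁, c₂, c₃, c₄, c₅, c₆, α, hα, hc₆, he⟩ := exists_form_of_forall_const h0 h hX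
    obtain rfl := hc₆ hκ
    refine ⟨_, ?_, he⟩
    simp only [Pi.zero_apply, zero_smul, add_zero]
    refine Submodule.add_mem _ (Submodule.add_mem _ ?_
      (BasicOperators.mem_span_of_mem_inf (Or.inl ⟨α 0, hα 0, rfl⟩)))
      (BasicOperators.mem_span_of_mem_inf (Or.inr ⟨α 1, hα 1, rfl⟩))
    refine Submodule.add_mem _ (Submodule.add_mem _ (Submodule.add_mem _ (Submodule.add_mem _
      (Submodule.add_mem _ (Submodule.add_mem _ ?_ ?_) ?_) ?_) ?_) ?_) ?_ <;>
      refine Submodule.smul_mem _ _ (BasicOperators.mem_span_of_mem_fin ?_) <;> simp [opsA_eq]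
  · have e : ∑ i : Fin 7, c i • (opsA ++ [opLinear 0 0, opLinear 1 1, opGalilei (κ 0) (κ 1),
        opProjective (κ 0) (κ 1)]).get i = c 0 • opTime + c 1 • opSpace +
        c 2 • opDilation + c 3 • opLinear 0 0 + c 4 • opLinear 1 1 + c 5 • opGalilei (κ 0) (κ 1) +
        c 6 • opProjective (κ 0) (κ 1) := Fin.sum_univ_seven _
    have he : EqOn (∑ i : Fin 7, c i • (opsA ++ [opLinear 0 0, opLinear 1 1,
        opGalilei (κ 0) (κ 1), opProjective (κ 0) (κ 1)]).get i + Z) 0 S.U := he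
    rw [e] at he
    obtain ⟨h₀, h₁, h₂, h₃, h₄, h₅, -⟩ := eq_zero_of_combination (S := S) (κ := κ)
      (c₅ := ![c 3, c 4]) (c₆ := 0) (fun X hX => ⟨_, _, (exists_mem_heatOps X hX).choose_spec⟩) hZ
      (by simpa using he)
    have h₃' := congrFun h₅ 0
    have h₄' := congrFun h₅ 1
    funext i
    fin_cases i
    exacts [h₀, h₁, h₂, h₃', h₄', h₃, h₄]

lemma isMaximal_of_const {κ : ℝ} (h0 : κ ≠ 0) (h : ∀ k, ∀ w ∈ S.K k, S.d k w = κ) :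
    S.IsMaximal ⟨opsA ++ [opLinear 0 0, opLinear 1 1, opGalilei κ κ,
      opProjective κ κ, opLinear 0 1, opLinear 1 0], heatOps 0 S.Ω κ ∪ heatOps 1 S.Ω κ⟩ := by
  have hT : ∀ X ∈ heatOps 0 S.Ω κ ∪ heatOps 1 S.Ω κ, ∃ k, X ∈ heatOps k S.Ω κ :=
    exists_mem_heatOps (κ := fun _ => κ)
  refine isMaximal_of (fun X hX => ?_) (fun X hX => ?_) (fun X hX => ?_)
    fun (c : Fin 9 → ℝ) Z hZ he => ?_
  · rcases List.mem_append.1 hX with hX | hX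
    · exact forall_mem_opsA hX
    · simp only [List.mem_cons, List.not_mem_nil, or_false] at hX
      rcases hX with rfl | rfl | rfl | rfl | rfl | rfl
      exacts [isSymm_linear_self (h 0), isSymm_linear_self (h 1),
        isSymm_galilei (κ := fun _ => κ) (fun _ => h0) h,
        isSymm_projective (κ := fun _ => κ) (fun _ => h0) h,
        isSymm_linear (by decide) (h 0) (h 1), isSymm_linear (by decide) (h 1) (h 0)]
  · obtain ⟨k, hX⟩ := hT X hX
    exact isSymm_heat (h k) hX
  · obtain ⟨c₀, c₁, c₂, c₃, c₄, c₅, c₆, α, hα, -, he⟩ :=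
      exists_form_of_forall_const (κ := fun _ => κ) (fun _ => h0) h hX
    refine ⟨_, ?_, he⟩
    refine Submodule.add_mem _ (Submodule.add_mem _ ?_
      (BasicOperators.mem_span_of_mem_inf (Or.inl ⟨α 0, hα 0, rfl⟩)))
      (BasicOperators.mem_span_of_mem_inf (Or.inr ⟨α 1, hα 1, rfl⟩))
    refine Submodule.add_mem _ (Submodule.add_mem _ (Submodule.add_mem _ (Submodule.add_mem _
      (Submodule.add_mem _ (Submodule.add_mem _ (Submodule.add_mem _ (Submodule.add_mem _
      ?_ ?_) ?_) ?_) ?_) ?_) ?_) ?_) ?_ <;>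
      refine Submodule.smul_mem _ _ (BasicOperators.mem_span_of_mem_fin ?_) <;> simp [opsA_eq]
  · have e : ∑ i : Fin 9, c i • (opsA ++ [opLinear 0 0, opLinear 1 1, opGalilei κ κ,
        opProjective κ κ, opLinear 0 1, opLinear 1 0]).get i = c 0 • opTime + c 1 • opSpace +
        c 2 • opDilation + c 3 • opLinear 0 0 + c 4 • opLinear 1 1 + c 5 • opGalilei κ κ +
        c 6 • opProjective κ κ + c 7 • opLinear 0 1 + c 8 • opLinear 1 0 :=
      (Fin.sum_univ_castSucc _).trans (congrArg (· + _) (Fin.sum_univ_eight _))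
    have he : EqOn (∑ i : Fin 9, c i • (opsA ++ [opLinear 0 0, opLinear 1 1, opGalilei κ κ,
        opProjective κ κ, opLinear 0 1, opLinear 1 0]).get i + Z) 0 S.U := he
    rw [e] at he
    obtain ⟨h₀, h₁, h₂, h₃, h₄, h₅, h₆⟩ := eq_zero_of_combination (S := S) (κ := fun _ => κ)
      (c₅ := ![c 3, c 4]) (c₆ := ![c 7, c 8]) (fun X hX => ⟨_, _, (hT X hX).choose_spec⟩) hZ he
    have h₃' := congrFun h₅ 0
    have h₄' := congrFun h₅ 1
    have h₇ := congrFun h₆ 0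
    have h₈ := congrFun h₆ 1
    funext i
    fin_cases i
    exacts [h₀, h₁, h₂, h₃', h₄', h₃, h₄, h₇, h₈]

end HeatData

/-! ### The cases of the table. -/

lemma deriv_exp_mul {K : Set ℝ} (hK : IsOpen K) {d : ℝ → ℝ} (h : ∀ w ∈ K, d w = Real.exp w) :
    ∀ w ∈ K, deriv d w * (0 * w + 2) = 2 * d w := fun w hw => by
  have e : d =ᶠ[nhds w] Real.exp := by filter_upwards [hK.mem_nhds hw] with z hz using h z hz
  rw [e.deriv_eq, Real.deriv_exp, h w hw]
  ring

/-- The exponent n corresponds to p = 2/n and q = 0, so that n = −4/3 is exactly p = −3/2. The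
exponential is the remaining possibility p = 0, q = 2. -/
lemma deriv_rpow_mul {K : Set ℝ} (hK : IsOpen K) (hK0 : K ⊆ Ioi 0) {d : ℝ → ℝ} {n : ℝ}
    (hn : n ≠ 0) (h : ∀ w ∈ K, d w = w ^ n) :
    ∀ w ∈ K, deriv d w * (2 / n * w + 0) = 2 * d w := fun w hw => by
  have e : d =ᶠ[nhds w] fun z => z ^ n := by filter_upwards [hK.mem_nhds hw] with z hz using h z hz
  have hw0 : 0 < w := hK0 hw
  rw [e.deriv_eq, Real.deriv_rpow_const, h w hw, Real.rpow_sub_one hw0.ne']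
  field_simp
  ring

lemma op_eq_opScaling {η ζ : ℝ → ℝ → ℝ → ℝ → ℝ} {p q : Fin 2 → ℝ}
    (hη : ∀ t x u v, η t x u v = p 0 * u + q 0) (hζ : ∀ t x u v, ζ t x u v = p 1 * v + q 1) :
    op (fun _ _ _ _ => 0) (fun _ x _ _ => x) η ζ = opScaling p q := by
  funext z
  simp only [opScaling, op, hη, hζ]

namespace HeatData

variable {S : HeatData}

lemma isMaximal_of_specialCase {O : BasicOperators}
    (h : SpecialCase S.Ω (S.K 0) (S.K 1) (S.d 0) (S.d 1) O) : S.IsMaximal O := by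
  have h₀₁ : (0 : Fin 2) ≠ 1 := by decide
  cases h with
  | case2 k₁ hk₁ h₁ h₂ =>
    rw [opUU_eq, heatOpsU_eq]
    exact isMaximal_of_const_of_nonconstant h₀₁ hk₁.ne' h₁ (nonconstant_of_not h₂)
  | case3 k₂ hk₂ h₁ h₂ =>
    rw [opVV_eq, heatOpsV_eq]
    exact isMaximal_of_const_of_nonconstant h₀₁.symm hk₂.ne' h₂ (nonconstant_of_not h₁)
  | case4 h₁ h₂ =>
    rw [op_eq_opScaling (p := ![0, 0]) (q := ![2, 2]) (by simp) (by simp)]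
    exact IsScaling.isMaximal (Fin.forall_fin_two.2
      ⟨deriv_exp_mul (S.isOpen_K 0) h₁, deriv_exp_mul (S.isOpen_K 1) h₂⟩) (by norm_num)
  | case5 m hm hJ h₁ h₂ =>
    rw [op_eq_opScaling (p := ![0, 2 / m]) (q := ![2, 0]) (by simp) (by simp)]
    exact IsScaling.isMaximal (Fin.forall_fin_two.2
      ⟨deriv_exp_mul (S.isOpen_K 0) h₁, deriv_rpow_mul (S.isOpen_K 1) hJ hm h₂⟩) (by norm_num)
  | case6 n hn hI h₁ h₂ =>
    rw [op_eq_opScaling (p := ![2 / n, 0]) (q := ![0, 2]) (by simp) (by simp)]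
    exact IsScaling.isMaximal (Fin.forall_fin_two.2
      ⟨deriv_rpow_mul (S.isOpen_K 0) hI hn h₁, deriv_exp_mul (S.isOpen_K 1) h₂⟩) (by norm_num)
  | case7 n m hn hm hnm hI hJ h₁ h₂ =>
    rw [op_eq_opScaling (p := ![2 / n, 2 / m]) (q := ![0, 0]) (by simp) (by simp)]
    refine IsScaling.isMaximal (Fin.forall_fin_two.2
      ⟨deriv_rpow_mul (S.isOpen_K 0) hI hn h₁, deriv_rpow_mul (S.isOpen_K 1) hJ hm h₂⟩) fun h => ?_
    have e₁ : 2 / n = -3 / 2 := h.1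
    have e₂ : 2 / m = -3 / 2 := h.2
    refine hnm ⟨?_, ?_⟩
    · field_simp at e₁; linarith
    · field_simp at e₂; linarith
  | case8 hI hJ h₁ h₂ =>
    rw [op_eq_opScaling (p := fun _ => -3 / 2) (q := 0) (by simp) (by simp)]
    refine IsScaling.isMaximal_conformal (Fin.forall_fin_two.2 ⟨fun w hw => ?_, fun w hw => ?_⟩)
    · rw [← deriv_rpow_mul (S.isOpen_K 0) hI (by norm_num) h₁ w hw]
      norm_num
    · rw [← deriv_rpow_mul (S.isOpen_K 1) hJ (by norm_num) h₂ w hw]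
      norm_num
  | case9 k₁ k₂ hk₁ hk₂ hne h₁ h₂ =>
    rw [opUU_eq, opVV_eq, heatOpsU_eq, heatOpsV_eq]
    exact isMaximal_of_const_of_ne (κ := ![k₁, k₂]) (Fin.forall_fin_two.2 ⟨hk₁.ne', hk₂.ne'⟩)
      (Fin.forall_fin_two.2 ⟨h₁, h₂⟩) hne
  | case9_eq k hk h₁ h₂ =>
    rw [opUU_eq, opVV_eq, opVU_eq, opUV_eq, heatOpsU_eq, heatOpsV_eq]
    exact isMaximal_of_const hk.ne' (Fin.forall_fin_two.2 ⟨h₁, h₂⟩)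

end HeatData

/-! Normal forms of exponential and power diffusivities. -/

/-- On `K` the function `d` is the exponential or a nonconstant power with positive argument. -/
def IsExpOrPower (K : Set ℝ) (d : ℝ → ℝ) : Prop :=
  (∀ w ∈ K, d w = Real.exp w) ∨ ∃ n : ℝ, n ≠ 0 ∧ K ⊆ Ioi 0 ∧ ∀ w ∈ K, d w = w ^ n

lemma IsExpOrPower.exists_specialCase {I J : Set ℝ} {d₁ d₂ : ℝ → ℝ} (h₁ : IsExpOrPower I d₁)
    (h₂ : IsExpOrPower J d₂) (Ω : Set (Fin 2 → ℝ)) : ∃ O, SpecialCase Ω I J d₁ d₂ O := by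
  obtain h₁ | ⟨n, hn, hI, h₁⟩ := h₁ <;> obtain h₂ | ⟨m, hm, hJ, h₂⟩ := h₂
  · exact ⟨_, .case4 h₁ h₂⟩
  · exact ⟨_, .case5 m hm hJ h₁ h₂⟩
  · exact ⟨_, .case6 n hn hI h₁ h₂⟩
  · by_cases h : n = -4 / 3 ∧ m = -4 / 3
    · obtain ⟨rfl, rfl⟩ := h
      exact ⟨_, .case8 hI hJ h₁ h₂⟩
    · exact ⟨_, .case7 n m hn hm h hI hJ h₁ h₂⟩

lemma exists_specialCase_of_const {I J : Set ℝ} {d₁ d₂ : ℝ → ℝ}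
    (h : (∃ c, ∀ w ∈ I, d₁ w = c) ∨ ∃ c, ∀ w ∈ J, d₂ w = c) (hI : I.Nonempty)
    (hJ : J.Nonempty) (hd₁ : ∀ w ∈ I, 0 < d₁ w) (hd₂ : ∀ w ∈ J, 0 < d₂ w) (Ω : Set (Fin 2 → ℝ)) :
    ∃ O, SpecialCase Ω I J d₁ d₂ O := by
  have pos : ∀ {K : Set ℝ} {d : ℝ → ℝ}, K.Nonempty → (∀ w ∈ K, 0 < d w) →
      ∀ c, (∀ w ∈ K, d w = c) → 0 < c := fun hK hd c hc => by
    obtain ⟨w, hw⟩ := hK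
    exact hc w hw ▸ hd w hw
  by_cases h₁ : ∃ c, ∀ w ∈ I, d₁ w = c <;> by_cases h₂ : ∃ c, ∀ w ∈ J, d₂ w = c
  · obtain ⟨c₁, h₁⟩ := h₁
    obtain ⟨c₂, h₂⟩ := h₂
    rcases eq_or_ne c₁ c₂ with rfl | hne
    · exact ⟨_, .case9_eq c₁ (pos hI hd₁ _ h₁) h₁ h₂⟩
    · exact ⟨_, .case9 c₁ c₂ (pos hI hd₁ _ h₁) (pos hJ hd₂ _ h₂) hne h₁ h₂⟩
  · obtain ⟨c₁, h₁⟩ := h₁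
    exact ⟨_, .case2 c₁ (pos hI hd₁ _ h₁) h₁ h₂⟩
  · obtain ⟨c₂, h₂⟩ := h₂
    exact ⟨_, .case3 c₂ (pos hJ hd₂ _ h₂) h₁ h₂⟩
  · exact (h.elim h₁ h₂).elim

/-- The equation is separable: d·exp(−2w/q) is constant if p = 0, and d·|pw + q|^(−2/p) is constant
otherwise. The constant factor is absorbed into the affine substitution of w, so no rescaling of t
or x is needed. -/
lemma exists_isExpOrPower {K : Set ℝ} (hK : IsOpen K) (hKc : IsConnected K) {d : ℝ → ℝ}
    (hd : DifferentiableOn ℝ d K) (hpos : ∀ w ∈ K, 0 < d w) {p q : ℝ}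
    (h : ∀ w ∈ K, deriv d w * (p * w + q) = 2 * d w) :
    ∃ b b₀ : ℝ, ∃ d' : ℝ → ℝ, b ≠ 0 ∧ (∀ w ∈ K, d' (b * w + b₀) = d w) ∧
      IsExpOrPower ((fun w => b * w + b₀) '' K) d' := by
  have hda : ∀ w ∈ K, HasDerivAt d (deriv d w) w := fun w hw =>
    ((hd w hw).differentiableAt (hK.mem_nhds hw)).hasDerivAt
  obtain ⟨w₀, hw₀⟩ := hKc.nonempty
  have hne : ∀ w ∈ K, p * w + q ≠ 0 := fun w hw h0 => by
    have e := h w hw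
    have := hpos w hw
    rw [h0, mul_zero] at e
    linarith
  rcases eq_or_ne p 0 with rfl | hp
  · have hq : q ≠ 0 := by simpa using hne w₀ hw₀
    have key : ∀ w ∈ K, HasDerivAt (fun w => d w * Real.exp (-(2 / q) * w)) 0 w := fun w hw => by
      have e₁ := ((hasDerivAt_id w).const_mul (-(2 / q))).exp
      have e₂ := (hda w hw).mul e₁
      refine e₂.congr_deriv ?_
      have e₃ := h w hw
      simp only [id]
      have e₄ : deriv d w = 2 / q * d w := by field_simp; linear_combination e₃
      rw [e₄]; ring
    obtain ⟨c, hc⟩ := hK.exists_is_const_of_deriv_eq_zero hKc.isPreconnected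
      (fun w hw => (key w hw).differentiableAt.differentiableWithinAt) fun w hw => (key w hw).deriv
    have hc0 : 0 < c := by
      rw [← hc w₀ hw₀]
      exact mul_pos (hpos w₀ hw₀) (Real.exp_pos _)
    -- From d = c·exp(2w/q) = exp(2w/q + log c).
    refine ⟨2 / q, Real.log c, Real.exp, div_ne_zero two_ne_zero hq, fun w hw => ?_,
      Or.inl fun _ _ => rfl⟩
    rw [Real.exp_add, Real.exp_log hc0, ← hc w hw, mul_left_comm, ← Real.exp_add]
    simp
  -- A zero of pw + q in K would force d = 0 there, so on the connected set K this function has a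
  -- constant sign s, and the base of the power becomes positive.
  · obtain ⟨s, hs, hs'⟩ : ∃ s : ℝ, s ≠ 0 ∧ ∀ w ∈ K, 0 < s * (p * w + q) := by
      have hconn : IsPreconnected ((fun w => p * w + q) '' K) :=
        hKc.isPreconnected.image _ (by fun_prop)
      rcases lt_or_gt_of_ne (hne w₀ hw₀) with h0 | h0
      · refine ⟨-1, by norm_num, fun w hw => ?_⟩
        by_contra hc
        obtain ⟨z, hz, hz0⟩ := hconn.ordConnected.out (mem_image_of_mem _ hw₀)
          (mem_image_of_mem _ hw) (⟨h0.le, by linarith⟩ : (0 : ℝ) ∈ Icc _ _)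
        exact hne z hz hz0
      · refine ⟨1, by norm_num, fun w hw => ?_⟩
        by_contra hc
        obtain ⟨z, hz, hz0⟩ := hconn.ordConnected.out (mem_image_of_mem _ hw)
          (mem_image_of_mem _ hw₀) (⟨by linarith, h0.le⟩ : (0 : ℝ) ∈ Icc _ _)
        exact hne z hz hz0
    have key : ∀ w ∈ K, HasDerivAt (fun w => d w * (s * (p * w + q)) ^ (-(2 / p))) 0 w :=
      fun w hw => by
        have hr := hs' w hw
        have e₁ := ((((hasDerivAt_id w).const_mul p).add_const q).const_mul s).rpow_const
          (p := -(2 / p)) (Or.inl hr.ne')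
        have e₂ := (hda w hw).mul e₁
        refine e₂.congr_deriv ?_
        have e₃ := h w hw
        simp only [id]
        rw [Real.rpow_sub_one hr.ne']
        have h4 := hne w hw
        field_simp
        linear_combination (s * (p * w + q)) ^ (-(2 / p)) * e₃
    obtain ⟨c, hc⟩ := hK.exists_is_const_of_deriv_eq_zero hKc.isPreconnected
      (fun w hw => (key w hw).differentiableAt.differentiableWithinAt) fun w hw => (key w hw).deriv
    have hc0 : 0 < c := by
      rw [← hc w₀ hw₀]
      exact mul_pos (hpos w₀ hw₀) (Real.rpow_pos_of_pos (hs' w₀ hw₀) _)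
    have hn : 2 / p ≠ 0 := div_ne_zero two_ne_zero hp
    -- The identity c·(s(pw + q))^(2/p) = (c^(p/2)·s(pw + q))^(2/p) dictates the substitution.
    have hc' : 0 < c ^ (2 / p)⁻¹ := Real.rpow_pos_of_pos hc0 _
    have e : ∀ w, c ^ (2 / p)⁻¹ * s * p * w + c ^ (2 / p)⁻¹ * s * q =
        c ^ (2 / p)⁻¹ * (s * (p * w + q)) := fun w => by ring
    refine ⟨c ^ (2 / p)⁻¹ * s * p, c ^ (2 / p)⁻¹ * s * q, fun w => w ^ (2 / p),
      mul_ne_zero (mul_ne_zero hc'.ne' hs) hp, fun w hw => ?_, Or.inr ⟨2 / p, hn, ?_,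
      fun _ _ => rfl⟩⟩
    · have hr := hs' w hw
      change (_ : ℝ) ^ (2 / p) = _
      rw [e, Real.mul_rpow hc'.le hr.le, Real.rpow_inv_rpow hc0.le hn, ← hc w hw, mul_assoc,
        ← Real.rpow_add hr]
      simp
    · rintro _ ⟨w, hw, rfl⟩
      have h0 := mul_pos hc' (hs' w hw)
      rwa [← e] at h0

/-! ### Generic systems. -/

namespace HeatData

variable {S : HeatData}

lemma isMaximal_generic (hn : ∀ k, S.Nonconstant k) (hs : ¬ ∃ p q, S.IsScaling p q) :
    S.IsMaximal genericOps := by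
  have h₀₁ : (0 : Fin 2) ≠ 1 := by decide
  refine isMaximal_of (fun X hX => forall_mem_opsA hX) (by simp [genericOps]) (fun X hX => ?_)
    fun (c : Fin 3 → ℝ) Z hZ he => ?_
  · obtain ⟨τ, ξ, η, hc⟩ := exists_components hX.1
    have hd := hc.isSymm_iff.1 hX
    -- The function 2ξ_x − τ_t is the same for both equations. If it were not identically zero, both
    -- diffusivities would satisfy the scaling relation, which is excluded for the pair.
    have hl : ∀ k k', 2 * (S.frame k k').x ξ - (S.frame k k').t τ = 0 := by
      intro k k'
      by_contra hl
      have key : ∀ i, ∃ p q : ℝ, ∀ w ∈ S.K i, deriv (S.d i) w * (p * w + q) = 2 * S.d i w := by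
        intro i
        obtain ⟨i', hi⟩ := exists_ne i
        exact exists_affine (hd i i' hi.symm) hl
      choose p q hpq using key
      exact hs ⟨p, q, hpq⟩
    obtain ⟨c₀, c₁, c₂, hτ, hξ⟩ := eq_of_uniform h₀₁ (hd 0 1 h₀₁)
      ((hn 0).determining h₀₁ (hd 0 1 h₀₁)).2.1 (hl 0 1)
    refine ⟨c₀ • opTime + c₁ • opSpace + c₂ • opDilation, ?_,
      hc.eqOn (components_opsA c₀ c₁ c₂) hτ hξ fun k => ?_⟩
    · refine Submodule.add_mem _ (Submodule.add_mem _ ?_ ?_) ?_ <;>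
        refine Submodule.smul_mem _ _ (BasicOperators.mem_span_of_mem_fin ?_) <;>
        simp [opsA_eq, genericOps]
    · obtain ⟨k', hk⟩ := exists_ne k
      exact (hn k).eq_zero_of_determining (hd k k' hk.symm) (hl k k')
  · obtain rfl : Z = 0 := by simpa [genericOps] using hZ
    have e : ∑ i : Fin 3, c i • opsA.get i = c 0 • opTime + c 1 • opSpace + c 2 • opDilation :=
      Fin.sum_univ_three _
    have he : EqOn (∑ i : Fin 3, c i • opsA.get i + 0) 0 S.U := he
    rw [add_zero, e] at he
    obtain ⟨hτ, hξ, -⟩ := (components_opsA (c 0) (c 1) (c 2)).eq_zero he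
    obtain ⟨h0, h2, -⟩ := quadratic_eq_zero (S := S) 0 (a := c 0) (b := 2 * c 2) (c := 0)
      (by rw [map_mul, map_ofNat, map_zero]; linear_combination hτ)
    obtain ⟨h1, -, -⟩ := quadratic_eq_zero (S := S) 1 (a := c 1) (b := c 2) (c := 0)
      (by rw [map_zero]; linear_combination hξ)
    funext i
    fin_cases i
    exacts [h0, h1, (mul_eq_zero.1 h2).resolve_left two_ne_zero]

end HeatData

/-! ### The system obtained by an equivalence transformation. -/

namespace EquivTransf

variable {g : EquivTransf} {S : HeatData} {d' : Fin 2 → ℝ → ℝ}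

lemma jet2_inv (g : EquivTransf) (j : Jet2) : g.jet2 (g.inv.jet2 j) = j := by
  refine Prod.ext (Prod.ext (g.base_inv _) (funext fun k => funext fun i => ?_))
    (funext fun k => funext fun i => funext fun l => ?_)
  · have h₁ := g.hb k
    have h₂ := g.ha i
    simp only [jet2, inv]
    field_simp
  · have h₁ := g.hb k
    have h₂ := g.ha i
    have h₃ := g.ha l
    simp only [jet2, inv]
    field_simp

lemma continuous_indep (g : EquivTransf) : Continuous g.indep := by
  unfold indep; fun_prop

lemma contDiff_dep (g : EquivTransf) (k : Fin 2) : ContDiff ℝ ∞ (g.dep k) := by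
  unfold dep; fun_prop

lemma image_indep (g : EquivTransf) (s : Set (Fin 2 → ℝ)) :
    g.indep '' s = g.inv.indep ⁻¹' s :=
  congrFun (image_eq_preimage_of_inverse g.inv_indep g.indep_inv) s

lemma image_dep (g : EquivTransf) (k : Fin 2) (s : Set ℝ) : g.dep k '' s = g.inv.dep k ⁻¹' s :=
  congrFun (image_eq_preimage_of_inverse (g.inv_dep k) (g.dep_inv k)) s

/-- The system into which `g` transforms a system, with given continuations `d'` of the
diffusivities. -/
def image (g : EquivTransf) (S : HeatData) (d' : Fin 2 → ℝ → ℝ) (ha : 0 < g.a 0)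
    (hd : ∀ k, ∀ w ∈ S.K k, d' k (g.dep k w) = g.a 1 ^ 2 / g.a 0 * S.d k w) : HeatData where
  Ω := g.indep '' S.Ω
  K k := g.dep k '' S.K k
  d := d'
  isOpen_Ω := by
    rw [image_indep]
    exact S.isOpen_Ω.preimage g.inv.continuous_indep
  isConnected_Ω := S.isConnected_Ω.image _ g.continuous_indep.continuousOn
  isOpen_K k := by
    rw [image_dep]
    exact (S.isOpen_K k).preimage (g.inv.contDiff_dep k).continuous
  isConnected_K k := (S.isConnected_K k).image _ (g.contDiff_dep k).continuous.continuousOn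
  smooth_d k := by
    have h : ContDiffOn ℝ ∞ (fun w => g.a 1 ^ 2 / g.a 0 * S.d k (g.inv.dep k w))
        (g.dep k '' S.K k) :=
      contDiffOn_const.mul ((S.smooth_d k).comp (g.inv.contDiff_dep k).contDiffOn
        (image_dep g k _).le)
    refine h.congr ?_
    rintro _ ⟨w, hw, rfl⟩
    rw [hd k w hw, inv_dep]
  pos_d k := by
    rintro _ ⟨w, hw, rfl⟩
    rw [hd k w hw]
    exact mul_pos (div_pos (sq_pos_of_ne_zero (g.ha 1)) ha) (S.pos_d k w hw)

lemma relates_image (ha : 0 < g.a 0)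
    (hd : ∀ k, ∀ w ∈ S.K k, d' k (g.dep k w) = g.a 1 ^ 2 / g.a 0 * S.d k w) :
    g.Relates S (g.image S d' ha hd) where
  mem_iff p := by
    rw [HeatData.mem_U, HeatData.mem_U]
    exact and_congr ((Function.LeftInverse.injective g.inv_indep).mem_set_image)
      (forall_congr' fun k => (Function.LeftInverse.injective (g.inv_dep k)).mem_set_image)
  d_eq := hd

/-- The new diffusivity is e₁²/e₀ times the old one, and by the chain rule its derivative picks up a
further 1/b. Every term of the expression therefore scales by b/e₀. -/
lemma Relates.heatExpr_jet2 {S' : HeatData} (h : g.Relates S S') (k : Fin 2) {j : Jet2}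
    (hj : j.1.1 ∈ S.U) :
    heatExpr k (S'.d k) (g.jet2 j) = g.b k / g.a 0 * heatExpr k (S.d k) j := by
  have hw := (S.mem_U.1 hj).2 k
  have e : (fun w => S'.d k (g.dep k w)) =ᶠ[nhds (j.1.1.2 k)]
      fun w => g.a 1 ^ 2 / g.a 0 * S.d k w := by
    filter_upwards [(S.isOpen_K k).mem_nhds hw] with w hw using h.d_eq k w hw
  have hS' : DifferentiableAt ℝ (S'.d k) (g.dep k (j.1.1.2 k)) :=
    ((S'.smooth_d k).differentiableOn (by simp)).differentiableAt
      ((S'.isOpen_K k).mem_nhds ((S'.mem_U.1 ((h.mem_iff j.1.1).2 hj)).2 k))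
  have hS : DifferentiableAt ℝ (S.d k) (j.1.1.2 k) :=
    ((S.smooth_d k).differentiableOn (by simp)).differentiableAt ((S.isOpen_K k).mem_nhds hw)
  have hg : HasDerivAt (g.dep k) (g.b k) (j.1.1.2 k) := by
    exact (((hasDerivAt_id (j.1.1.2 k)).const_mul (g.b k)).add_const (g.b₀ k)).congr_deriv
      (mul_one _)
  have e₁ : deriv (S'.d k) (g.dep k (j.1.1.2 k)) * g.b k =
      g.a 1 ^ 2 / g.a 0 * deriv (S.d k) (j.1.1.2 k) := by
    have h₁ := (hS'.hasDerivAt.comp (j.1.1.2 k) hg).deriv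
    have h₂ := (hS.hasDerivAt.const_mul (g.a 1 ^ 2 / g.a 0)).deriv
    rw [← h₁, ← h₂]
    exact e.deriv_eq
  have e₂ := h.d_eq k _ hw
  have h₀ := g.ha 0
  have h₁ := g.ha 1
  have hb := g.hb k
  have e₃ : deriv (S'.d k) (g.dep k (j.1.1.2 k)) =
      g.a 1 ^ 2 / g.a 0 * deriv (S.d k) (j.1.1.2 k) / g.b k := by
    rw [← e₁, mul_div_cancel_right₀ _ hb]
  simp only [heatExpr, jet2, base]
  rw [e₂, e₃]
  field_simp

lemma carries_image (ha : 0 < g.a 0)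
    (hd : ∀ k, ∀ w ∈ S.K k, d' k (g.dep k w) = g.a 1 ^ 2 / g.a 0 * S.d k w) :
    g.Carries S.Ω (S.K 0) (S.K 1) (S.d 0) (S.d 1) (d' 0) (d' 1) := by
  have hr := relates_image ha hd
  have key : ∀ j : Jet2, g.jet2 j ∈ equationManifold (g.indep '' S.Ω) (g.dep 0 '' S.K 0)
      (g.dep 1 '' S.K 1) (d' 0) (d' 1) ↔
      j ∈ equationManifold S.Ω (S.K 0) (S.K 1) (S.d 0) (S.d 1) := by
    intro j
    refine (g.image S d' ha hd).mem_equationManifold.trans (Iff.trans ?_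
      S.mem_equationManifold.symm)
    refine Iff.trans (and_congr_left' (hr.mem_iff j.1.1)) (and_congr_right fun hj =>
      and_congr ?_ ?_)
    · refine forall_congr' fun k => forall_congr' fun i => forall_congr' fun l => ?_
      simp only [jet2]
      rw [mul_comm (g.a l), div_left_inj' (mul_ne_zero (g.ha i) (g.ha l)),
        mul_right_inj' (g.hb k)]
    · refine forall_congr' fun k => ?_
      rw [hr.heatExpr_jet2 k hj, mul_eq_zero, or_iff_right (div_ne_zero (g.hb k) (g.ha 0))]
  refine Subset.antisymm ?_ fun j hj => ?_
  · rintro _ ⟨j, hj, rfl⟩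
    exact (key j).2 hj
  · refine ⟨g.inv.jet2 j, (key _).1 ?_, g.jet2_inv j⟩
    rwa [jet2_inv]

/-- The jet with w_xx = 1 and all other parametric derivatives zero has w_t = d(w). Its image must
satisfy the new equation, which says b·d/e₀ = d̃·b/e₁², where d̃ is the new diffusivity at the new
value. -/
lemma Carries.d_eq (h : g.Carries S.Ω (S.K 0) (S.K 1) (S.d 0) (S.d 1) (d' 0) (d' 1)) (k : Fin 2)
    {w : ℝ} (hw : w ∈ S.K k) : d' k (g.dep k w) = g.a 1 ^ 2 / g.a 0 * S.d k w := by
  obtain ⟨q⟩ := (inferInstance : Nonempty S.U)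
  obtain ⟨k', hk⟩ := exists_ne k
  have hp := (HeatData.move q k hw).2
  have hj := (h.le ⟨_, S.solutionJet_mem hk.symm (HeatData.move q k hw) 0 0 1 0 0, rfl⟩ :
    g.jet2 _ ∈ equationManifold _ _ _ _ _).2.2
  have e : heatExpr k (d' k) (g.jet2
      (S.solutionJet k k' (HeatData.move q k hw) 0 0 1 0 0)) = 0 := by
    fin_cases k
    exacts [hj.1, hj.2]
  have h₀ := g.ha 0
  have h₁ := g.ha 1
  have hb := g.hb k
  simp [heatExpr, jet2, HeatData.solutionJet, base, HeatData.move] at e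
  field_simp at e ⊢
  exact mul_left_cancel₀ hb (by linear_combination -e)

end EquivTransf

/-! Reduction to the systems of the table. -/

/-- One positive diffusivity is enough to determine the sign of e₀; in cases 2 and 3 nothing is
assumed about the sign of the nonconstant one. -/
lemma SpecialCase.exists_pos {Ω : Set (Fin 2 → ℝ)} {K : Fin 2 → Set ℝ} {d : Fin 2 → ℝ → ℝ}
    {O : BasicOperators} (h : SpecialCase Ω (K 0) (K 1) (d 0) (d 1) O) :
    ∃ k, ∀ w ∈ K k, 0 < d k w := by
  cases h with
  | case2 k₁ hk₁ h₁ h₂ => exact ⟨0, fun w hw => by rwa [h₁ w hw]⟩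
  | case3 k₂ hk₂ h₁ h₂ => exact ⟨1, fun w hw => by rwa [h₂ w hw]⟩
  | case4 h₁ h₂ => exact ⟨0, fun w hw => by rw [h₁ w hw]; exact Real.exp_pos _⟩
  | case5 m hm hJ h₁ h₂ => exact ⟨0, fun w hw => by rw [h₁ w hw]; exact Real.exp_pos _⟩
  | case6 n hn hI h₁ h₂ => exact ⟨1, fun w hw => by rw [h₂ w hw]; exact Real.exp_pos _⟩
  | case7 n m hn hm hnm hI hJ h₁ h₂ =>
    exact ⟨0, fun w hw => by rw [h₁ w hw]; exact Real.rpow_pos_of_pos (hI hw) _⟩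
  | case8 hI hJ h₁ h₂ =>
    exact ⟨0, fun w hw => by rw [h₁ w hw]; exact Real.rpow_pos_of_pos (hI hw) _⟩
  | case9 k₁ k₂ hk₁ hk₂ hne h₁ h₂ => exact ⟨0, fun w hw => by rwa [h₁ w hw]⟩
  | case9_eq k hk h₁ h₂ => exact ⟨0, fun w hw => by rwa [h₁ w hw]⟩

lemma isHeatSolution_one (Ω : Set (Fin 2 → ℝ)) (κ : ℝ) : IsHeatSolution Ω κ fun _ => 1 := by
  refine ⟨contDiffOn_const, fun z _ => ?_⟩
  have e : ∀ (i : Fin 2) (c : ℝ), pderiv i (fun _ => c) = fun _ => 0 := fun i c => by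
    funext z; simp [pderiv]
  rw [e, e, e, mul_zero]

/-- The algebras of the non-generic cases contain operators that act on the dependent variables. -/
lemma SpecialCase.exists_snd_ne_zero {Ω : Set (Fin 2 → ℝ)} {I J : Set ℝ} {d₁ d₂ : ℝ → ℝ}
    {O : BasicOperators} (h : SpecialCase Ω I J d₁ d₂ O) :
    ∃ X ∈ O.span, ∀ p ∈ domain Ω I J, (X p).2 ≠ 0 := by
  have key : ∀ {X : Operator} {p : Base} (k : Fin 2), (X p).2 k ≠ 0 → (X p).2 ≠ 0 :=
    fun k h h0 => h (congrFun h0 k)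
  cases h with
  | case2 k₁ hk₁ h₁ h₂ =>
    exact ⟨_, BasicOperators.mem_span_of_mem_inf ⟨_, isHeatSolution_one Ω k₁, rfl⟩,
      fun p _ => key 0 (by simp [op])⟩
  | case3 k₂ hk₂ h₁ h₂ =>
    exact ⟨_, BasicOperators.mem_span_of_mem_inf ⟨_, isHeatSolution_one Ω k₂, rfl⟩,
      fun p _ => key 1 (by simp [op])⟩
  | case4 h₁ h₂ =>
    exact ⟨_, BasicOperators.mem_span_of_mem_fin (List.mem_append_right _ (List.mem_cons_self)),
      fun p _ => key 0 (by simp [op])⟩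
  | case5 m hm hJ h₁ h₂ =>
    exact ⟨_, BasicOperators.mem_span_of_mem_fin (List.mem_append_right _ (List.mem_cons_self)),
      fun p _ => key 0 (by simp [op])⟩
  | case6 n hn hI h₁ h₂ =>
    exact ⟨_, BasicOperators.mem_span_of_mem_fin (List.mem_append_right _ (List.mem_cons_self)),
      fun p _ => key 1 (by simp [op])⟩
  | case7 n m hn hm hnm hI hJ h₁ h₂ =>
    exact ⟨_, BasicOperators.mem_span_of_mem_fin (List.mem_append_right _ (List.mem_cons_self)),
      fun p hp => key 0 (by simpa [op, hn] using (hI hp.2.1).ne')⟩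
  | case8 hI hJ h₁ h₂ =>
    exact ⟨_, BasicOperators.mem_span_of_mem_fin (List.mem_append_right _ (List.mem_cons_self)),
      fun p hp => key 0 (by simpa [op] using (hI hp.2.1).ne')⟩
  | case9 k₁ k₂ hk₁ hk₂ hne h₁ h₂ =>
    exact ⟨_, BasicOperators.mem_span_of_mem_inf (Or.inl ⟨_, isHeatSolution_one Ω k₁, rfl⟩),
      fun p _ => key 0 (by simp [op])⟩
  | case9_eq k hk h₁ h₂ =>
    exact ⟨_, BasicOperators.mem_span_of_mem_inf (Or.inl ⟨_, isHeatSolution_one Ω k, rfl⟩),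
      fun p _ => key 0 (by simp [op])⟩

lemma snd_eq_zero_of_mem_genericOps {X : Operator} (hX : X ∈ genericOps.span) (p : Base) :
    (X p).2 = 0 := by
  induction hX using Submodule.span_induction with
  | mem X hX =>
    rcases hX with hX | hX
    · change X ∈ opsA at hX
      simp only [opsA, List.mem_cons, List.not_mem_nil, or_false] at hX
      rcases hX with rfl | rfl | rfl <;> ext i <;> fin_cases i <;> rfl
    · exact hX.elim
  | zero => rfl
  | add X Y _ _ hX hY => simp [hX, hY]
  | smul c X _ hX => simp [hX]

namespace HeatData

variable {S : HeatData}

/-- The definition of a transformation allows e₀ < 0. Comparing a positive tabulated diffusivity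
with e₁²/e₀ times the positive original one shows e₀ > 0, and then the image is again a system with
positive diffusivities. -/
lemma exists_relates_of_reducesTo {g : EquivTransf} {O : BasicOperators}
    (h : ReducesTo g S.Ω (S.K 0) (S.K 1) (S.d 0) (S.d 1) O) :
    ∃ S', g.Relates S S' ∧ SpecialCase S'.Ω (S'.K 0) (S'.K 1) (S'.d 0) (S'.d 1) O := by
  obtain ⟨d₁', d₂', hc, hs⟩ := h
  have hd : ∀ k, ∀ w ∈ S.K k, ![d₁', d₂'] k (g.dep k w) = g.a 1 ^ 2 / g.a 0 * S.d k w :=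
    fun k w hw => EquivTransf.Carries.d_eq (d' := ![d₁', d₂']) hc k hw
  have ha : 0 < g.a 0 := by
    obtain ⟨k, hk⟩ := SpecialCase.exists_pos (K := fun k => g.dep k '' S.K k)
      (d := ![d₁', d₂']) hs
    obtain ⟨w, hw⟩ := (S.isConnected_K k).nonempty
    have e := hk _ ⟨w, hw, rfl⟩
    rw [hd k w hw] at e
    exact (div_pos_iff_of_pos_left (sq_pos_of_ne_zero (g.ha 1))).1
      ((mul_pos_iff_of_pos_right (S.pos_d k w hw)).1 e)
  exact ⟨g.image S ![d₁', d₂'] ha hd, EquivTransf.relates_image ha hd, hs⟩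

/-- Operators in A have no ∂_u and ∂_v components, whereas the pullback of a suitable tabulated
operator is a symmetry that has one. -/
lemma not_isMaximal_generic_of_reducesTo {g : EquivTransf} {O : BasicOperators}
    (h : ReducesTo g S.Ω (S.K 0) (S.K 1) (S.d 0) (S.d 1) O) : ¬ S.IsMaximal genericOps := by
  intro hm
  obtain ⟨S', hr, hs⟩ := exists_relates_of_reducesTo h
  obtain ⟨X, hX, hX0⟩ := hs.exists_snd_ne_zero
  have hmax := hr.isMaximal (isMaximal_of_specialCase hs)
  obtain ⟨Y, hY, e⟩ := hm.maximal (g.pullback X) (hmax.symmetry _ (by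
    rw [EquivTransf.span_pullbackOps]
    exact ⟨X, hX, rfl⟩))
  obtain ⟨⟨p, hp⟩⟩ := (inferInstance : Nonempty S.U)
  refine hX0 (g.base p) ((hr.mem_iff p).2 hp) (funext fun k => ?_)
  have e₁ : (X (g.base p)).2 k / g.b k = (Y p).2 k := congrFun (congrArg Prod.snd (e hp)) k
  rw [snd_eq_zero_of_mem_genericOps hY] at e₁
  exact (div_eq_zero_iff.1 e₁).resolve_right (g.hb k)

/-- Reduction to the table only changes u and v; t and x are kept. -/
lemma exists_reducesTo (b b₀ : Fin 2 → ℝ) (hb : ∀ k, b k ≠ 0) (d' : Fin 2 → ℝ → ℝ)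
    (hd : ∀ k, ∀ w ∈ S.K k, d' k (b k * w + b₀ k) = S.d k w)
    (hs : ∀ Ω, ∃ O, SpecialCase Ω ((fun w => b 0 * w + b₀ 0) '' S.K 0)
      ((fun w => b 1 * w + b₀ 1) '' S.K 1) (d' 0) (d' 1) O) :
    ∃ g O, ReducesTo g S.Ω (S.K 0) (S.K 1) (S.d 0) (S.d 1) O := by
  let g : EquivTransf := ⟨1, 0, b, b₀, fun _ => one_ne_zero, hb⟩
  obtain ⟨O, hO⟩ := hs (g.indep '' S.Ω)
  refine ⟨g, O, d' 0, d' 1, EquivTransf.carries_image (g := g) (d' := d') one_pos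
    fun k w hw => ?_, hO⟩
  rw [show g.dep k w = b k * w + b₀ k from rfl, hd k w hw]
  simp [g]

/-- A system with a constant diffusivity is already in the table, so the identity transformation
serves. -/
lemma exists_reducesTo_of_const {k : Fin 2} (h : ¬ S.Nonconstant k) :
    ∃ g O, ReducesTo g S.Ω (S.K 0) (S.K 1) (S.d 0) (S.d 1) O := by
  refine exists_reducesTo 1 0 (fun _ => one_ne_zero) S.d (by simp) fun Ω => ?_
  have h' : ∃ c, ∀ w ∈ S.K k, S.d k w = c := by
    by_contra hc
    exact h (nonconstant_of_not hc)
  simp only [Pi.one_apply, Pi.zero_apply, one_mul, add_zero, image_id']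
  refine exists_specialCase_of_const ?_ (S.isConnected_K 0).nonempty (S.isConnected_K 1).nonempty
    (S.pos_d 0) (S.pos_d 1) Ω
  fin_cases k
  exacts [Or.inl h', Or.inr h']

lemma IsScaling.exists_reducesTo {p q : Fin 2 → ℝ} (h : S.IsScaling p q) :
    ∃ g O, ReducesTo g S.Ω (S.K 0) (S.K 1) (S.d 0) (S.d 1) O := by
  have key := fun k => exists_isExpOrPower (S.isOpen_K k) (S.isConnected_K k)
    ((S.smooth_d k).differentiableOn (by simp)) (S.pos_d k) (h k)
  choose b b₀ d' hb hd hs using key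
  exact HeatData.exists_reducesTo b b₀ hb d' hd fun Ω => (hs 0).exists_specialCase (hs 1) Ω

lemma isMaximal_generic_iff :
    S.IsMaximal genericOps ↔
      ¬ ∃ g O, ReducesTo g S.Ω (S.K 0) (S.K 1) (S.d 0) (S.d 1) O := by
  refine ⟨fun hm ⟨g, O, h⟩ => not_isMaximal_generic_of_reducesTo h hm, fun h => ?_⟩
  refine isMaximal_generic (fun k => ?_) fun ⟨p, q, hpq⟩ => h hpq.exists_reducesTo
  by_contra hk
  exact h (exists_reducesTo_of_const hk)

end HeatData

end HeatSystem

end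

open HeatSystem in
theorem theorem2 (Ω : Set (Fin 2 → ℝ)) (hΩ : IsOpen Ω) (hΩc : IsConnected Ω)
    (I J : Set ℝ) (hI : IsOpen I) (hIc : IsConnected I) (hJ : IsOpen J) (hJc : IsConnected J)
    (d₁ d₂ : ℝ → ℝ) (hd₁ : ContDiffOn ℝ ∞ d₁ I) (hd₂ : ContDiffOn ℝ ∞ d₂ J)
    (hpos₁ : ∀ u ∈ I, 0 < d₁ u) (hpos₂ : ∀ v ∈ J, 0 < d₂ v) :
    -- the algebras listed in the non-generic cases are the maximal ones
    (∀ O, SpecialCase Ω I J d₁ d₂ O → IsMaximalInvarianceAlgebra Ω I J d₁ d₂ O) ∧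
    -- the same up to equivalence transformations
    (∀ g O, ReducesTo g Ω I J d₁ d₂ O →
      IsMaximalInvarianceAlgebra Ω I J d₁ d₂ (g.pullbackOps O)) ∧
    -- every other system, and no further one, has the generic three-dimensional algebra
    (IsMaximalInvarianceAlgebra Ω I J d₁ d₂ genericOps ↔
      ¬ ∃ g O, ReducesTo g Ω I J d₁ d₂ O) := by
  let S : HeatData := ⟨Ω, ![I, J], ![d₁, d₂], hΩ, hΩc, Fin.forall_fin_two.2 ⟨hI, hJ⟩,
    Fin.forall_fin_two.2 ⟨hIc, hJc⟩, Fin.forall_fin_two.2 ⟨hd₁, hd₂⟩,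
    Fin.forall_fin_two.2 ⟨hpos₁, hpos₂⟩⟩
  refine ⟨fun O h => HeatData.isMaximal_of_specialCase (S := S) h, fun g O h => ?_,
    HeatData.isMaximal_generic_iff (S := S)⟩
  obtain ⟨S', hr, hs⟩ := HeatData.exists_relates_of_reducesTo (S := S) h
  exact hr.isMaximal (HeatData.isMaximal_of_specialCase hs)
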